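/- Let $n \ge 3$ and let $\mathbb{H}^n = \{(x,y) : x>0,\ y \in \mathbb{R}^{n-1}\}$ with the metric $(dx^2+dy^2)/x^2$ and the Riemannian measure $d\mu = x^{-n}\,dx\,dy$. Let $H^1(\mathbb{H}^n)$ be the space of all $u \in L^2(\mathbb{H}^n)$ whose weak gradient satisfies $|\nabla u| \in L^2(\mathbb{H}^n)$, and let $\Delta \ge 0$ be the Laplacian on $L^2(\mathbb{H}^n)$, i.e. the operator generated by the form $\int \langle \nabla u, \nabla v\rangle\, d\mu$ with form domain $H^1(\mathbb{H}^n)$. Let $V : \mathbb{H}^n \to \mathbb{C}$ belong to $L^p(\mathbb{H}^n)$ for some real $p$ with $n/2 \le p < \infty$. Then $V u \bar v$ is integrable for all $u, v \in H^1(\mathbb{H}^n)$, so that the form $$\mathfrak{t}[u,v] = \int \langle \nabla u, \nabla v\rangle\, d\mu + \int V u \bar v\, d\mu, \qquad u, v \in H^1(\mathbb{H}^n),$$ is well defined. Let $\Delta + V$ be the operator that it generates: $u \in \mathrm{Dom}(\Delta+V)$ and $(\Delta+V)u = f$ if and only if $u \in H^1(\mathbb{H}^n)$, $f \in L^2(\mathbb{H}^n)$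 and $\mathfrak{t}[u,v] = (f,v)_{L^2}$ for all $v \in H^1(\mathbb{H}^n)$. Then: 1. $T = \Delta + V$ is m-sectorial, that is, its numerical range $\{(Tu,u) : u \in \mathrm{Dom}(T),\ \|u\|=1\}$ is contained in a sector $\{z : |\arg(z-\gamma)| \le \theta\}$ with $\gamma \in \mathbb{R}$ and $0 \le \theta < \pi/2$, and for some scalar $\alpha$ the operator $S = T+\alpha$ is m-accretive: $\mathrm{Re}\,(Su,u) \ge 0$ for all $u \in \mathrm{Dom}(S)$, and for every $z$ with $\mathrm{Re}\, z > 0$ the operator $S+z$ has an inverse that is bounded on $L^2(\mathbb{H}^n)$ with $\|(S+z)^{-1}\| \le (\mathrm{Re}\, z)^{-1}$. The domain of $T$ is contained in $H^1(\mathbb{H}^n)$. 2. The spectrum of $\Delta + V$ is the union of the essential spectrum of $\Delta$ (the set of all $\lambda \in \mathbb{C}$ for which $\Delta - \lambda$ is not Fredholm) and of the set of isolated eigenvalues of $\Delta + V$ of finite algebraic multiplicity, i.e. of those eigenvalues that are isolated points of the spectrum of $\Delta + V$ and whose Riesz projection has finite rank. -/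

import Mathlib

open MeasureTheory ComplexConjugate
open scoped ContDiff InnerProductSpace

noncomputable section

namespace HypSchrodinger

/-! ### Unbounded operators in a complex Hilbert space -/

section Operators

variable {H : Type*} [NormedAddCommGroup H] [InnerProductSpace ℂ H]

/-- `R` is the bounded two-sided inverse of `T - z : D(T) → H`. -/
def IsResolvent (T : H →ₗ.[ℂ] H) (z : ℂ) (R : H →L[ℂ] H) : Prop :=
  (∀ f : H, ∃ h : R f ∈ T.domain, T ⟨R f, h⟩ - z • R f = f) ∧
    ∀ u : T.domain, R (T u - z • (u : H)) = u

/-- The resolvent set: all `z` for which `T - z` is a bijection of `D(T)` onto `H` with bounded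
inverse. -/
def resolventSet (T : H →ₗ.[ℂ] H) : Set ℂ := {z | ∃ R : H →L[ℂ] H, IsResolvent T z R}

/-- The spectrum of an unbounded operator. -/
def spectrum (T : H →ₗ.[ℂ] H) : Set ℂ := (resolventSet T)ᶜ

open Classical in
/-- The resolvent `(T - z)⁻¹` as a bounded operator (with value `0` on the spectrum). -/
def resolvent (T : H →ₗ.[ℂ] H) (z : ℂ) : H →L[ℂ] H :=
  if h : z ∈ resolventSet T then h.choose else 0

/-- The operator `T + α`, with the domain of `T`. -/
def shift (T : H →ₗ.[ℂ] H) (α : ℂ) : H →ₗ.[ℂ] H :=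
  (α • (LinearMap.id : H →ₗ[ℂ] H)) +ᵥ T

/-- `Re (Tu, u) ≥ 0` for all `u ∈ D(T)`. The inner product `⟪·, ·⟫_ℂ` is conjugate linear in its
first argument, so that `(Tu, u)` is `⟪u, T u⟫_ℂ`. -/
def IsAccretive (T : H →ₗ.[ℂ] H) : Prop :=
  ∀ u : T.domain, 0 ≤ (⟪(u : H), T u⟫_ℂ).re

/-- `T` is m-accretive: it is accretive, and for every `z` with `Re z > 0` the inverse
`(T + z)⁻¹` exists as a bounded operator on `H` and has norm at most `(Re z)⁻¹`. -/
def IsMAccretive (T : H →ₗ.[ℂ] H) : Prop :=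
  IsAccretive T ∧
    ∀ z : ℂ, 0 < z.re → -z ∈ resolventSet T ∧ ‖resolvent T (-z)‖ ≤ (z.re)⁻¹

/-- `T + α` is m-accretive for some scalar `α`. -/
def IsQuasiMAccretive (T : H →ₗ.[ℂ] H) : Prop := ∃ α : ℂ, IsMAccretive (shift T α)

/-- The numerical range of `T` lies in a sector with real vertex `γ` and semi-angle `θ < π / 2`. -/
def IsSectorial (T : H →ₗ.[ℂ] H) : Prop :=
  ∃ γ θ : ℝ, 0 ≤ θ ∧ θ < Real.pi / 2 ∧
    ∀ u : T.domain, ‖(u : H)‖ = 1 → |(⟪(u : H), T u⟫_ℂ - (γ : ℂ)).arg| ≤ θ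

/-- `T` is m-sectorial: sectorial and quasi-m-accretive. -/
def IsMSectorial (T : H →ₗ.[ℂ] H) : Prop := IsSectorial T ∧ IsQuasiMAccretive T

/-- The linear map `T - z : D(T) → H`. -/
def subScalar (T : H →ₗ.[ℂ] H) (z : ℂ) : T.domain →ₗ[ℂ] H :=
  T.toFun - z • T.domain.subtype

/-- `T - z` is a Fredholm operator: finite-dimensional kernel, closed range of finite
codimension. -/
def IsFredholmAt (T : H →ₗ.[ℂ] H) (z : ℂ) : Prop :=
  FiniteDimensional ℂ (LinearMap.ker (subScalar T z)) ∧
    IsClosed (LinearMap.range (subScalar T z) : Set H) ∧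
    FiniteDimensional ℂ (H ⧸ LinearMap.range (subScalar T z))

/-- The essential spectrum: all `z` for which `T - z` is not Fredholm. -/
def essentialSpectrum (T : H →ₗ.[ℂ] H) : Set ℂ := {z | ¬ IsFredholmAt T z}

/-- `z` is an eigenvalue of `T`. -/
def IsEigenvalue (T : H →ₗ.[ℂ] H) (z : ℂ) : Prop :=
  ∃ u : T.domain, (u : H) ≠ 0 ∧ T u = z • (u : H)

/-- The Riesz projection `-(2πi)⁻¹ ∮_{|ζ - z| = r} (T - ζ)⁻¹ dζ`. -/
def rieszProjection (T : H →ₗ.[ℂ] H) (z : ℂ) (r : ℝ) : H →L[ℂ] H :=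
  -((2 * Real.pi * Complex.I : ℂ)⁻¹ • ∮ ζ in C(z, r), resolvent T ζ)

/-- `z` is an isolated eigenvalue of finite algebraic multiplicity: it is an eigenvalue, it is the
only point of the spectrum in some closed disc around it, and the Riesz projection over the
boundary of that disc, whose rank is the algebraic multiplicity, has finite rank. -/
def IsDiscreteEigenvalue (T : H →ₗ.[ℂ] H) (z : ℂ) : Prop :=
  IsEigenvalue T z ∧ ∃ r : ℝ, 0 < r ∧ spectrum T ∩ Metric.closedBall z r = {z} ∧
    FiniteDimensional ℂ (LinearMap.range (rieszProjection T z r : H →ₗ[ℂ] H))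

/-- The set of isolated eigenvalues of finite algebraic multiplicity. -/
def discreteSpectrum (T : H →ₗ.[ℂ] H) : Set ℂ := {z | IsDiscreteEigenvalue T z}

end Operators

/-! ### Real hyperbolic space in the upper half space model

The points are `z = (x, y) ∈ ℝⁿ` with `x = z 0 > 0`, the metric is `(dx² + dy²) / x²`. -/

/-- The open upper half space. -/
def upperHalfSpace (n : ℕ) [NeZero n] : Set (EuclideanSpace ℝ (Fin n)) := {z | 0 < z 0}

/-- The Riemannian measure `x⁻ⁿ dx dy` of hyperbolic space, as a measure on `ℝⁿ` that is carried
by the upper half space. -/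
def hypMeasure (n : ℕ) [NeZero n] : Measure (EuclideanSpace ℝ (Fin n)) :=
  (volume.restrict (upperHalfSpace n)).withDensity fun z => ENNReal.ofReal ((z 0) ^ n)⁻¹

/-- The Hilbert space `L²(ℍⁿ)`. -/
abbrev L2 (n : ℕ) [NeZero n] := Lp ℂ 2 (hypMeasure n)

/-- `φ` is a real test function on hyperbolic space. -/
def IsTest (n : ℕ) [NeZero n] (φ : EuclideanSpace ℝ (Fin n) → ℝ) : Prop :=
  ContDiff ℝ ∞ φ ∧ HasCompactSupport φ ∧ tsupport φ ⊆ upperHalfSpace n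

/-- `g` is the weak gradient of `u`, in the orthonormal frame `x ∂₀, …, x ∂ₙ₋₁`: the weak partial
derivative `∂ᵢ u` is `g i / x`. In particular `∑ i, |g i|²` is the squared Riemannian length of
the gradient. -/
def IsWeakGrad {n : ℕ} [NeZero n] (u : L2 n) (g : Fin n → L2 n) : Prop :=
  ∀ (i : Fin n) (φ : EuclideanSpace ℝ (Fin n) → ℝ), IsTest n φ →
    ∫ z in upperHalfSpace n, (fderiv ℝ φ z (EuclideanSpace.single i 1)) • u z =
      - ∫ z in upperHalfSpace n, (φ z / z 0) • g i z

section Helpers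

variable {n : ℕ} [NeZero n]

lemma isOpen_upperHalfSpace : IsOpen (upperHalfSpace n) :=
  isOpen_lt continuous_const (by fun_prop)

lemma restrict_absolutelyContinuous :
    (volume.restrict (upperHalfSpace n)) ≪ hypMeasure n := by
  refine withDensity_absolutelyContinuous' (by fun_prop) ?_
  rw [ae_restrict_iff' isOpen_upperHalfSpace.measurableSet]
  refine Filter.Eventually.of_forall fun z hz => ?_
  have : 0 < z 0 := hz
  simp only [ne_eq, ENNReal.ofReal_eq_zero, not_le]
  positivity

lemma locallyIntegrableOn_L2 (u : L2 n) :
    LocallyIntegrableOn (u : EuclideanSpace ℝ (Fin n) → ℂ) (upperHalfSpace n) volume := by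
  rw [locallyIntegrableOn_iff isOpen_upperHalfSpace.isLocallyClosed]
  intro K hKU hK
  obtain ⟨M, hM⟩ := (hK.image (f := fun z : EuclideanSpace ℝ (Fin n) => z 0)
    (by fun_prop)).isBounded.subset_closedBall 0
  have hb : ∀ z ∈ K, z 0 ≤ |M| + 1 := fun z hz => by
    have := hM ⟨z, hz, rfl⟩
    simp only [mem_closedBall_zero_iff, Real.norm_eq_abs] at this
    linarith [le_abs_self (z 0), le_abs_self M]
  set C : ENNReal := ENNReal.ofReal ((|M| + 1) ^ n)
  have hC : C ≠ ⊤ := ENNReal.ofReal_ne_top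
  have hle : volume.restrict K ≤ C • hypMeasure n := by
    refine Measure.le_iff.2 fun s hs => ?_
    rw [Measure.smul_apply, hypMeasure, withDensity_apply _ hs, smul_eq_mul,
      Measure.restrict_restrict hs, Measure.restrict_apply hs,
      ← lintegral_const_mul _ (by fun_prop)]
    calc volume (s ∩ K) = ∫⁻ _ in s ∩ K, 1 := by simp
      _ ≤ ∫⁻ z in s ∩ K, C * ENNReal.ofReal ((z 0) ^ n)⁻¹ := by
          refine setLIntegral_mono (by fun_prop) fun z hz => ?_
          have h0 : 0 < z 0 := hKU hz.2
          rw [← ENNReal.ofReal_mul (by positivity), ENNReal.one_le_ofReal,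
            ← div_eq_mul_inv, one_le_div (by positivity)]
          exact pow_le_pow_left₀ h0.le (hb z hz.2) n
      _ ≤ _ := lintegral_mono_set (Set.inter_subset_inter_right s hKU)
  have h2 : MemLp (u : EuclideanSpace ℝ (Fin n) → ℂ) 2 (volume.restrict K) :=
    (Lp.memLp u).of_measure_le_smul hC hle
  have : IsFiniteMeasure (volume.restrict K) := ⟨by simpa using hK.measure_lt_top⟩
  exact h2.integrable (by norm_num)

lemma integrable_smul_L2 (u : L2 n) {ψ φ : EuclideanSpace ℝ (Fin n) → ℝ}
    (hψ : ContinuousOn ψ (upperHalfSpace n)) (hφ : HasCompactSupport φ)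
    (hU : tsupport φ ⊆ upperHalfSpace n) (h0 : ∀ z, z ∉ tsupport φ → ψ z = 0) :
    Integrable (fun z => ψ z • u z) volume := by
  have h1 := (locallyIntegrableOn_L2 u).continuousOn_smul
    isOpen_upperHalfSpace.isLocallyClosed hψ
  have h2 := (locallyIntegrableOn_iff isOpen_upperHalfSpace.isLocallyClosed).1 h1 _ hU hφ
  refine (integrableOn_iff_integrable_of_support_subset ?_).1 h2
  intro z hz
  by_contra hc
  exact hz (by simp [h0 z hc])

lemma integrable_test_left (u : L2 n) (i : Fin n) {φ : EuclideanSpace ℝ (Fin n) → ℝ}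
    (hφ : IsTest n φ) :
    Integrable (fun z => (fderiv ℝ φ z (EuclideanSpace.single i 1)) • u z) volume := by
  refine integrable_smul_L2 u ?_ hφ.2.1 hφ.2.2 ?_
  · exact ((hφ.1.continuous_fderiv (by simp)).clm_apply continuous_const).continuousOn
  · intro z hz
    have : fderiv ℝ φ z = 0 := by
      by_contra hc
      exact hz (support_fderiv_subset ℝ hc)
    simp [this]

lemma integrable_test_right (u : L2 n) {φ : EuclideanSpace ℝ (Fin n) → ℝ} (hφ : IsTest n φ) :
    Integrable (fun z => (φ z / z 0) • u z) volume := by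
  refine integrable_smul_L2 u ?_ hφ.2.1 hφ.2.2 ?_
  · exact hφ.1.continuous.continuousOn.div (by fun_prop) fun z hz => (ne_of_gt hz)
  · intro z hz
    simp [image_eq_zero_of_notMem_tsupport hz]

lemma isWeakGrad_zero : IsWeakGrad (0 : L2 n) 0 := by
  intro i φ _
  have h : ((0 : L2 n) : EuclideanSpace ℝ (Fin n) → ℂ) =ᵐ[volume.restrict (upperHalfSpace n)] 0 :=
    restrict_absolutelyContinuous.ae_le (Lp.coeFn_zero ℂ 2 (hypMeasure n))
  rw [integral_eq_zero_of_ae, integral_eq_zero_of_ae, neg_zero]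
  · filter_upwards [h] with z hz
    simp only [Pi.zero_apply, hz, smul_zero]
  · filter_upwards [h] with z hz
    simp only [Pi.zero_apply, hz, smul_zero]

lemma IsWeakGrad.add {u v : L2 n} {g h : Fin n → L2 n} (hu : IsWeakGrad u g)
    (hv : IsWeakGrad v h) : IsWeakGrad (u + v) (g + h) := by
  intro i φ hφ
  have h1 := restrict_absolutelyContinuous.ae_le (Lp.coeFn_add u v)
  have h2 := restrict_absolutelyContinuous.ae_le (Lp.coeFn_add (g i) (h i))
  rw [integral_congr_ae (g := fun z => (fderiv ℝ φ z (EuclideanSpace.single i 1)) • u z +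
      (fderiv ℝ φ z (EuclideanSpace.single i 1)) • v z),
    integral_congr_ae (f := fun z => (φ z / z 0) • ((g + h) i) z)
      (g := fun z => (φ z / z 0) • g i z + (φ z / z 0) • h i z),
    integral_add (integrable_test_left u i hφ).integrableOn
      (integrable_test_left v i hφ).integrableOn,
    integral_add (integrable_test_right (g i) hφ).integrableOn
      (integrable_test_right (h i) hφ).integrableOn, hu i φ hφ, hv i φ hφ, neg_add]
  · filter_upwards [h2] with z hz
    simp only [Pi.add_apply, hz, smul_add]
  · filter_upwards [h1] with z hz
    simp only [hz, Pi.add_apply, smul_add]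

lemma IsWeakGrad.smul {u : L2 n} {g : Fin n → L2 n} (c : ℂ) (hu : IsWeakGrad u g) :
    IsWeakGrad (c • u) (c • g) := by
  intro i φ hφ
  have h1 := restrict_absolutelyContinuous.ae_le (Lp.coeFn_smul c u)
  have h2 := restrict_absolutelyContinuous.ae_le (Lp.coeFn_smul c (g i))
  rw [integral_congr_ae (g := fun z => c • ((fderiv ℝ φ z (EuclideanSpace.single i 1)) • u z)),
    integral_congr_ae (f := fun z => (φ z / z 0) • ((c • g) i) z)
      (g := fun z => c • ((φ z / z 0) • g i z)),
    integral_smul, integral_smul, hu i φ hφ, smul_neg]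
  · filter_upwards [h2] with z hz
    simp only [Pi.smul_apply, hz]
    rw [smul_comm]
  · filter_upwards [h1] with z hz
    simp only [hz, Pi.smul_apply]
    rw [smul_comm]

end Helpers

/-- The Sobolev space `H¹(ℍⁿ)` of all `u ∈ L²(ℍⁿ)` whose weak gradient is square integrable with
respect to the hyperbolic metric and measure. -/
def H1 (n : ℕ) [NeZero n] : Submodule ℂ (L2 n) where
  carrier := {u | ∃ g, IsWeakGrad u g}
  zero_mem' := ⟨0, isWeakGrad_zero⟩
  add_mem' := fun ⟨g, hg⟩ ⟨h, hh⟩ => ⟨g + h, hg.add hh⟩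
  smul_mem' := fun c _ ⟨g, hg⟩ => ⟨c • g, hg.smul c⟩

/-- The graph of the operator generated by the form
`𝔱[u, v] = ∫ ⟨∇u, ∇v⟩ dμ + ∫ V u v̄ dμ` with form domain `H¹(ℍⁿ)`: all pairs `(u, f)` with
`u ∈ H¹(ℍⁿ)` and `𝔱[u, v] = (f, v)` for every `v ∈ H¹(ℍⁿ)`. -/
def formGraph (n : ℕ) [NeZero n] (V : EuclideanSpace ℝ (Fin n) → ℂ) :
    Submodule ℂ (L2 n × L2 n) where
  carrier := {w | ∃ g, IsWeakGrad w.1 g ∧ ∀ v h, IsWeakGrad v h →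
    Integrable (fun z => V z * w.1 z * conj (v z)) (hypMeasure n) ∧
    ∑ i, ⟪h i, g i⟫_ℂ + ∫ z, V z * w.1 z * conj (v z) ∂(hypMeasure n) = ⟪v, w.2⟫_ℂ}
  zero_mem' := by
    refine ⟨0, isWeakGrad_zero, fun v h _ => ?_⟩
    have h0 : (fun z => V z * ((0 : L2 n × L2 n).1 : EuclideanSpace ℝ (Fin n) → ℂ) z * conj (v z))
        =ᵐ[hypMeasure n] 0 := by
      filter_upwards [Lp.coeFn_zero ℂ 2 (hypMeasure n)] with z hz
      simp only [Prod.fst_zero, hz, Pi.zero_apply, mul_zero, zero_mul]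
    refine ⟨(integrable_zero _ _ _).congr h0.symm, ?_⟩
    rw [integral_eq_zero_of_ae h0]
    simp
  add_mem' := by
    rintro ⟨u, f⟩ ⟨u', f'⟩ ⟨g, hg, hu⟩ ⟨g', hg', hu'⟩
    refine ⟨g + g', hg.add hg', fun v h hv => ?_⟩
    obtain ⟨hi, he⟩ := hu v h hv
    obtain ⟨hi', he'⟩ := hu' v h hv
    have h0 : (fun z => V z * ((u + u' : L2 n) : EuclideanSpace ℝ (Fin n) → ℂ) z * conj (v z))
        =ᵐ[hypMeasure n] fun z => V z * u z * conj (v z) + V z * u' z * conj (v z) := by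
      filter_upwards [Lp.coeFn_add u u'] with z hz
      simp only [hz, Pi.add_apply]
      ring
    refine ⟨(hi.add hi').congr h0.symm, ?_⟩
    simp only [Prod.mk_add_mk]
    rw [integral_congr_ae h0, integral_add hi hi', inner_add_right, ← he, ← he']
    simp only [Pi.add_apply, inner_add_right, Finset.sum_add_distrib]
    ring
  smul_mem' := by
    rintro c ⟨u, f⟩ ⟨g, hg, hu⟩
    refine ⟨c • g, hg.smul c, fun v h hv => ?_⟩
    obtain ⟨hi, he⟩ := hu v h hv
    have h0 : (fun z => V z * ((c • u : L2 n) : EuclideanSpace ℝ (Fin n) → ℂ) z * conj (v z))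
        =ᵐ[hypMeasure n] fun z => c * (V z * u z * conj (v z)) := by
      filter_upwards [Lp.coeFn_smul c u] with z hz
      simp only [hz, Pi.smul_apply, smul_eq_mul]
      ring
    refine ⟨(hi.const_mul c).congr h0.symm, ?_⟩
    simp only [Prod.smul_mk]
    rw [integral_congr_ae h0, integral_const_mul, inner_smul_right, ← he]
    simp only [Pi.smul_apply, inner_smul_right, ← Finset.mul_sum]
    ring

section SingleValued

variable {n : ℕ} [NeZero n]

lemma hypMeasure_absolutelyContinuous :
    hypMeasure n ≪ volume.restrict (upperHalfSpace n) :=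
  withDensity_absolutelyContinuous _ _

/-- A function in `L²(ℍⁿ)` that is orthogonal to all test functions, up to a positive continuous
weight, vanishes. -/
lemma eq_zero_of_integral_test (u : L2 n) (w : EuclideanSpace ℝ (Fin n) → ℝ)
    (hw : ContinuousOn w (upperHalfSpace n)) (hw0 : ∀ z ∈ upperHalfSpace n, w z ≠ 0)
    (h : ∀ φ, IsTest n φ → ∫ z in upperHalfSpace n, (φ z * w z) • u z = 0) : u = 0 := by
  have hl := (locallyIntegrableOn_L2 u).continuousOn_smul
    isOpen_upperHalfSpace.isLocallyClosed hw
  have hz := isOpen_upperHalfSpace.ae_eq_zero_of_integral_contDiff_smul_eq_zero hl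
    (fun φ h1 h2 h3 => by
      rw [← h φ ⟨h1, h2, h3⟩, setIntegral_eq_integral_of_forall_compl_eq_zero]
      · simp only [mul_smul]
      · intro z hzU
        simp [image_eq_zero_of_notMem_tsupport fun hc => hzU (h3 hc)])
  have hz' : ∀ᵐ z ∂(volume.restrict (upperHalfSpace n)), u z = 0 := by
    rw [ae_restrict_iff' isOpen_upperHalfSpace.measurableSet]
    filter_upwards [hz] with z hzz hzU
    exact (smul_eq_zero.1 (hzz hzU)).resolve_left (hw0 z hzU)
  exact (Lp.eq_zero_iff_ae_eq_zero).2 (hypMeasure_absolutelyContinuous.ae_le hz')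

lemma IsWeakGrad.eq_zero {g : Fin n → L2 n} (h : IsWeakGrad 0 g) : g = 0 := by
  funext i
  refine eq_zero_of_integral_test (g i) (fun z => (z 0)⁻¹) ?_ ?_ fun φ hφ => ?_
  · exact ContinuousOn.inv₀ (by fun_prop) fun z hz => ne_of_gt hz
  · exact fun z hz => inv_ne_zero (ne_of_gt hz)
  · have h1 := h i φ hφ
    have h2 := isWeakGrad_zero (n := n) i φ hφ
    have h3 : ∫ z in upperHalfSpace n, (φ z / z 0) • (0 : L2 n) z = 0 := by
      refine integral_eq_zero_of_ae ?_
      filter_upwards [restrict_absolutelyContinuous.ae_le (Lp.coeFn_zero ℂ 2 (hypMeasure n))]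
        with z hz
      simp only [Pi.zero_apply, hz, smul_zero]
    simp only [Pi.zero_apply] at h2
    rw [h2, h3, neg_zero] at h1
    simpa [div_eq_mul_inv] using (neg_eq_zero.1 h1.symm)

lemma isFiniteMeasureOnCompacts_aux {K : Set (EuclideanSpace ℝ (Fin n))} (hK : IsCompact K)
    (hKU : K ⊆ upperHalfSpace n) : hypMeasure n K < ⊤ := by
  rw [hypMeasure, withDensity_apply _ hK.measurableSet,
    Measure.restrict_restrict hK.measurableSet, Set.inter_eq_left.2 hKU]
  have hc : ContinuousOn (fun z : EuclideanSpace ℝ (Fin n) => ((z 0) ^ n)⁻¹) K :=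
    ContinuousOn.inv₀ (by fun_prop) fun z hz => pow_ne_zero _ (ne_of_gt (hKU hz))
  exact (hc.integrableOn_compact hK).lintegral_lt_top

/-- Continuous functions with compact support in the half space belong to `L²(ℍⁿ)`. -/
lemma memLp_of_compact {ψ : EuclideanSpace ℝ (Fin n) → ℝ} (hψ : Continuous ψ)
    (hc : HasCompactSupport ψ) (hU : tsupport ψ ⊆ upperHalfSpace n) :
    MemLp (fun z => (ψ z : ℂ)) 2 (hypMeasure n) := by
  have hK : IsCompact (tsupport ψ) := hc
  obtain ⟨C, hC⟩ := hc.exists_bound_of_continuous hψ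
  have : IsFiniteMeasure ((hypMeasure n).restrict (tsupport ψ)) :=
    ⟨by simpa using isFiniteMeasureOnCompacts_aux hK hU⟩
  have h1 : MemLp (fun z => (ψ z : ℂ)) 2 ((hypMeasure n).restrict (tsupport ψ)) :=
    MemLp.of_bound (Complex.continuous_ofReal.comp hψ).aestronglyMeasurable C
      (Filter.Eventually.of_forall fun z => by simpa using hC z)
  have h2 := (memLp_indicator_iff_restrict hK.measurableSet).2 h1
  refine h2.ae_eq (Filter.Eventually.of_forall fun z => ?_)
  by_cases hz : z ∈ tsupport ψ
  · simp [hz]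
  · simp [hz, image_eq_zero_of_notMem_tsupport hz]

/-- Test functions belong to `H¹(ℍⁿ)`. -/
lemma exists_isWeakGrad_of_isTest {ψ : EuclideanSpace ℝ (Fin n) → ℝ} (hψ : IsTest n ψ) :
    ∃ (v : L2 n) (h : Fin n → L2 n), IsWeakGrad v h ∧
      ∀ᵐ z ∂(volume.restrict (upperHalfSpace n)), v z = (ψ z : ℂ) := by
  have hd : ∀ i : Fin n, Continuous fun z => fderiv ℝ ψ z (EuclideanSpace.single i 1) := fun i =>
    (hψ.1.continuous_fderiv (by simp)).clm_apply continuous_const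
  have hts : ∀ i : Fin n,
      tsupport (fun z => z 0 * fderiv ℝ ψ z (EuclideanSpace.single i 1)) ⊆ tsupport ψ := fun i => by
    refine closure_minimal (fun z hz => ?_) (isClosed_tsupport ψ)
    refine support_fderiv_subset ℝ (f := ψ) fun hc => hz ?_
    simp [hc]
  have hm : ∀ i : Fin n, MemLp (fun z =>
      ((z 0 * fderiv ℝ ψ z (EuclideanSpace.single i 1) : ℝ) : ℂ)) 2 (hypMeasure n) := fun i =>
    memLp_of_compact ((by fun_prop : Continuous fun z : EuclideanSpace ℝ (Fin n) => z 0).mul (hd i))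
      (hψ.2.1.of_isClosed_subset (isClosed_tsupport _) (hts i)) ((hts i).trans hψ.2.2)
  have hv := memLp_of_compact hψ.1.continuous hψ.2.1 hψ.2.2
  refine ⟨hv.toLp _, fun i => (hm i).toLp _, fun i φ hφ => ?_,
    restrict_absolutelyContinuous.ae_le hv.coeFn_toLp⟩
  have h1 := restrict_absolutelyContinuous.ae_le hv.coeFn_toLp
  have h2 := restrict_absolutelyContinuous.ae_le (hm i).coeFn_toLp
  have hdφ : Continuous fun z => fderiv ℝ φ z (EuclideanSpace.single i 1) :=
    (hφ.1.continuous_fderiv (by simp)).clm_apply continuous_const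
  have hcφ : HasCompactSupport fun z => fderiv ℝ φ z (EuclideanSpace.single i 1) :=
    hφ.2.1.fderiv_apply ℝ _
  have ibp := integral_mul_fderiv_eq_neg_fderiv_mul_of_integrable (𝕜 := ℝ)
    (μ := (volume : Measure (EuclideanSpace ℝ (Fin n)))) (f := ψ) (g := φ)
    (v := EuclideanSpace.single i 1)
    (((hd i).mul hφ.1.continuous).integrable_of_hasCompactSupport hφ.2.1.mul_left)
    ((hψ.1.continuous.mul hdφ).integrable_of_hasCompactSupport hcφ.mul_left)
    ((hψ.1.continuous.mul hφ.1.continuous).integrable_of_hasCompactSupport hφ.2.1.mul_left)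
    (fun z _ => hψ.1.differentiable (by simp) z) (fun z _ => hφ.1.differentiable (by simp) z)
  have e1 : ∫ z in upperHalfSpace n, (fderiv ℝ φ z (EuclideanSpace.single i 1)) • hv.toLp _ z =
      ((∫ z, ψ z * fderiv ℝ φ z (EuclideanSpace.single i 1) : ℝ) : ℂ) := by
    rw [← integral_complex_ofReal]
    refine Eq.trans (integral_congr_ae ?_) (setIntegral_eq_integral_of_forall_compl_eq_zero
      (f := fun z => ((ψ z * fderiv ℝ φ z (EuclideanSpace.single i 1) : ℝ) : ℂ)) ?_)
    · filter_upwards [h1] with z hz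
      rw [hz, Complex.real_smul]
      push_cast
      ring
    · intro z hz
      simp [image_eq_zero_of_notMem_tsupport fun hc => hz (hψ.2.2 hc)]
  have e2 : ∫ z in upperHalfSpace n, (φ z / z 0) • (hm i).toLp _ z =
      ((∫ z, fderiv ℝ ψ z (EuclideanSpace.single i 1) * φ z : ℝ) : ℂ) := by
    rw [← integral_complex_ofReal]
    refine Eq.trans (integral_congr_ae ?_) (setIntegral_eq_integral_of_forall_compl_eq_zero
      (f := fun z => ((fderiv ℝ ψ z (EuclideanSpace.single i 1) * φ z : ℝ) : ℂ)) ?_)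
    · filter_upwards [h2, ae_restrict_mem isOpen_upperHalfSpace.measurableSet] with z hz hzU
      have h0 : (z 0 : ℂ) ≠ 0 := by exact_mod_cast (ne_of_gt (show 0 < z 0 from hzU))
      rw [hz, Complex.real_smul]
      push_cast
      field_simp
    · intro z hz
      simp [image_eq_zero_of_notMem_tsupport fun hc => hz (hφ.2.2 hc)]
  rw [e1, e2, ibp, Complex.ofReal_neg]

lemma integral_hypMeasure (F : EuclideanSpace ℝ (Fin n) → ℂ) :
    ∫ z, F z ∂(hypMeasure n) = ∫ z in upperHalfSpace n, ((z 0) ^ n)⁻¹ • F z := by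
  unfold hypMeasure
  rw [integral_withDensity_eq_integral_toReal_smul₀ (by fun_prop)
    (Filter.Eventually.of_forall fun _ => ENNReal.ofReal_lt_top)]
  refine setIntegral_congr_fun isOpen_upperHalfSpace.measurableSet fun z hz => ?_
  have : 0 < z 0 := hz
  simp only
  rw [ENNReal.toReal_ofReal (by positivity)]

/-- The operator generated by the form is single valued, because `H¹(ℍⁿ)` is dense. -/
lemma formGraph_single_valued (V : EuclideanSpace ℝ (Fin n) → ℂ) (w : L2 n × L2 n)
    (hw : w ∈ formGraph n V) (h0 : w.1 = 0) : w.2 = 0 := by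
  obtain ⟨u, f⟩ := w
  obtain ⟨g, hg, hf⟩ := hw
  simp only at h0 hg hf
  subst h0
  obtain rfl := hg.eq_zero
  refine eq_zero_of_integral_test f (fun z => ((z 0) ^ n)⁻¹) ?_ ?_ fun φ hφ => ?_
  · exact ContinuousOn.inv₀ (by fun_prop) fun z hz => pow_ne_zero _ (ne_of_gt hz)
  · exact fun z hz => inv_ne_zero (pow_ne_zero _ (ne_of_gt hz))
  · obtain ⟨v, h, hv, hvφ⟩ := exists_isWeakGrad_of_isTest hφ
    have h1 := (hf v h hv).2
    rw [integral_eq_zero_of_ae] at h1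
    · simp only [Pi.zero_apply, inner_zero_right, Finset.sum_const_zero, add_zero] at h1
      rw [L2.inner_def, integral_hypMeasure] at h1
      refine Eq.trans (integral_congr_ae ?_) h1.symm
      filter_upwards [hvφ, ae_restrict_mem isOpen_upperHalfSpace.measurableSet] with z hz hzU
      have : 0 < z 0 := hzU
      rw [hz]
      simp only [RCLike.inner_apply, Complex.conj_ofReal, Complex.real_smul]
      push_cast
      ring
    · filter_upwards [Lp.coeFn_zero ℂ 2 (hypMeasure n)] with z hz
      simp only [hz, Pi.zero_apply, mul_zero, zero_mul]

end SingleValued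

/-- The Schrödinger operator `Δ + V` in `L²(ℍⁿ)`, generated by the form
`∫ ⟨∇u, ∇v⟩ dμ + ∫ V u v̄ dμ` on `H¹(ℍⁿ)`. -/
def schrodinger (n : ℕ) [NeZero n] (V : EuclideanSpace ℝ (Fin n) → ℂ) : L2 n →ₗ.[ℂ] L2 n :=
  (formGraph n V).toLinearPMap

/-- The graph of the operator `Δ + V` is the one prescribed by the form. -/
lemma schrodinger_graph (n : ℕ) [NeZero n] (V : EuclideanSpace ℝ (Fin n) → ℂ) :
    (schrodinger n V).graph = formGraph n V :=
  Submodule.toLinearPMap_graph_eq _ (formGraph_single_valued V)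

/-- The (nonnegative) Laplacian `Δ` in `L²(ℍⁿ)`, generated by the Dirichlet form
`∫ ⟨∇u, ∇v⟩ dμ` on `H¹(ℍⁿ)`. -/
def laplacian (n : ℕ) [NeZero n] : L2 n →ₗ.[ℂ] L2 n := schrodinger n 0

end HypSchrodinger

end

/-! Let W be H¹(ℍⁿ) with its graph inner product, J : W → L² the embedding and B the operator on W
that represents the form of V. The form of Δ + V - z is represented on W by the bounded pencil A(z)
= 1 + B - (1 + z) J*J, and (Δ + V - z)⁻¹ = J A(z)⁻¹ J* whenever A(z) is invertible. Everything thus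
reduces to bounded operators on one Hilbert space, and the domains of Δ and Δ + V need not be
compared.

Two facts about B are needed (`exists_compact_potential_operator`): it is a norm limit of operators
of finite rank, and |(w, Bw)| ≤ ‖w‖²/2 + C‖Jw‖². Both follow from a bound |V| ≤ ε + s + M·1_ball
with s small in L^(n/2): Hölder and the Sobolev inequality control s, and local compactness of J
controls the last term. The Sobolev inequality and local compactness come from ℝⁿ: multiplication by
a cut-off of z₀^(1 - n/2) sends H¹(ℍⁿ) to functions with Euclidean gradient in L², with bounds
uniform in the radius of the cut-off. Mollification then reduces to smooth functions.

The relative bound makes A(z) coercive when Re z is very negative, so Lax-Milgram gives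
m-sectoriality (`IsFormOperator.isMSectorial`).

For the spectrum (`IsFormOperator.spectrum_eq`), the property "invertible up to finite rank" is
stable under adding ±B. For V = 0 the pencil A₀(z) has it exactly when Δ - z is Fredholm, by
self-adjointness. If Δ - z is Fredholm, then near z the invertibility of A is decided by a finite
determinant holomorphic in z. It does not vanish identically, because off the real axis A always has
the property, and each open half plane contains points where A is coercive. So a point of the
spectrum at which Δ - z is Fredholm is isolated, and the singular part of A⁻¹ there has finite rank
(`IsFredholmIndexZero.exists_inverse_eq`), hence so has the Riesz projection. Conversely, off the
spectrum of Δ + V the operator A₀(z) = A(z) - B has the property, so Δ - z is Fredholm. -/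

noncomputable section

namespace HypSchrodinger

/-! ### Perturbations of invertible operators by operators of finite rank -/

section FiniteRank

variable {W : Type*} [NormedAddCommGroup W] [InnerProductSpace ℂ W]

/-- `X` is invertible up to an additive perturbation of finite rank. -/
def IsFredholmIndexZero (X : W →L[ℂ] W) : Prop :=
  ∃ F : W →L[ℂ] W, (F : W →ₗ[ℂ] W).HasFiniteRange ∧ IsUnit (X + F)

/-- `B` is a limit, in the operator norm, of operators of finite rank. -/
def IsFiniteRankLimit (B : W →L[ℂ] W) : Prop :=
  ∀ ε : ℝ, 0 < ε → ∃ F : W →L[ℂ] W, (F : W →ₗ[ℂ] W).HasFiniteRange ∧ ‖B - F‖ < ε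

lemma IsUnit.isFredholmIndexZero {X : W →L[ℂ] W} (h : IsUnit X) : IsFredholmIndexZero X :=
  ⟨0, by simp, by simpa using h⟩

lemma IsFiniteRankLimit.neg {B : W →L[ℂ] W} (h : IsFiniteRankLimit B) :
    IsFiniteRankLimit (-B) := by
  intro ε hε
  obtain ⟨F, hF, hB⟩ := h ε hε
  refine ⟨-F, by simpa using hF.neg, ?_⟩
  rwa [← norm_neg, neg_sub_neg, neg_sub]

/-- Units form an open set: if G has finite rank and is close enough to B, then X + B + (F - G) is
still invertible, so G is absorbed into the finite-rank correction. -/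
lemma IsFredholmIndexZero.add [CompleteSpace W] {X B : W →L[ℂ] W} (hX : IsFredholmIndexZero X)
    (hB : IsFiniteRankLimit B) : IsFredholmIndexZero (X + B) := by
  obtain ⟨F, hF, hU⟩ := hX
  obtain ⟨ε, hε, hball⟩ := Metric.isOpen_iff.1 (Units.isOpen (R := W →L[ℂ] W)) _ hU
  obtain ⟨G, hG, hBG⟩ := hB ε hε
  refine ⟨F - G, ?_, hball ?_⟩
  · simpa using hF.sub hG
  · rw [Metric.mem_ball, dist_eq_norm]
    rw [show X + B + (F - G) - (X + F) = B - G by abel]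
    exact hBG

/-- The inverse of X + F inverts X from both sides modulo operators of finite rank. -/
lemma IsFredholmIndexZero.isFredholm [CompleteSpace W] {X : W →L[ℂ] W}
    (hX : IsFredholmIndexZero X) : X.IsFredholm := by
  obtain ⟨F, hF, U, hU⟩ := hX
  have hX : X = U - F := by rw [hU]; abel
  have h1 : (↑U⁻¹ : W →L[ℂ] W) * X - 1 = -(↑U⁻¹ * F) := by rw [hX, mul_sub]; simp
  have h2 : X * (↑U⁻¹ : W →L[ℂ] W) - 1 = -(F * ↑U⁻¹) := by rw [hX, sub_mul]; simp
  refine ContinuousLinearMap.IsFredholm.of_isQuasiInverse (v := ↑U⁻¹) ⟨?_, ?_⟩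
  · refine LinearMap.FiniteRangeSetoid.equiv_iff_hasNoetherianRange.2 ?_
    change (((↑U⁻¹ : W →L[ℂ] W) * X - 1 : W →L[ℂ] W) : W →ₗ[ℂ] W).HasNoetherianRange
    rw [h1]
    exact (hF.comp_left ((↑U⁻¹ : W →L[ℂ] W) : W →ₗ[ℂ] W)).neg.hasNoetherianRange
  · refine LinearMap.FiniteRangeSetoid.equiv_iff_hasNoetherianRange.2 ?_
    change ((X * (↑U⁻¹ : W →L[ℂ] W) - 1 : W →L[ℂ] W) : W →ₗ[ℂ] W).HasNoetherianRange
    rw [h2]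
    exact (hF.comp_right ((↑U⁻¹ : W →L[ℂ] W) : W →ₗ[ℂ] W)).neg.hasNoetherianRange

/-- A self-adjoint operator with closed range and finite-dimensional kernel has index zero. -/
lemma isFredholmIndexZero_of_isSelfAdjoint [CompleteSpace W] {X : W →L[ℂ] W}
    (hX : IsSelfAdjoint X) (hc : IsClosed (X.range : Set W))
    [FiniteDimensional ℂ X.ker] : IsFredholmIndexZero X := by
  have hadj : ContinuousLinearMap.adjoint X = X := by rw [← ContinuousLinearMap.star_eq_adjoint]; exact hX
  have horth : X.rangeᗮ = X.ker := by rw [ContinuousLinearMap.orthogonal_range, hadj]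
  have hclosed : X.kerᗮ = X.range := by
    rw [← horth, Submodule.orthogonal_orthogonal_eq_closure]
    exact IsClosed.submodule_topologicalClosure_eq hc
  have hker : ∀ w, X (X.ker.starProjection w) = 0 := fun w =>
    (X.ker.starProjection_apply_mem w : X.ker.starProjection w ∈ X.ker)
  -- The correction is the orthogonal projection onto the kernel: X is bijective on (ker X)ᗮ = range
  -- X, and the projection is the identity on ker X.
  refine ⟨X.ker.starProjection, ?_, ContinuousLinearMap.isUnit_iff_bijective.2 ⟨?_, ?_⟩⟩
  · rw [LinearMap.hasFiniteRange_iff_range]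
    have : ((X.ker.starProjection : W →L[ℂ] W) : W →ₗ[ℂ] W).range = X.ker :=
      Submodule.range_starProjection _
    rw [this]
    exact (Submodule.fg_iff_finiteDimensional _).2 inferInstance
  · refine (injective_iff_map_eq_zero _).2 fun w hw => ?_
    simp only [add_apply] at hw
    have h1 : ⟪X.ker.starProjection w, X w⟫_ℂ = 0 := by
      rw [← ContinuousLinearMap.adjoint_inner_left, hadj, hker, inner_zero_left]
    have h2 : X.ker.starProjection w = 0 := by
      have := congrArg (fun y => ⟪X.ker.starProjection w, y⟫_ℂ) hw
      simpa [inner_add_right, h1] using this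
    rw [h2, add_zero] at hw
    rw [← h2]
    exact (Submodule.starProjection_eq_self_iff.2 hw).symm
  · intro y
    have hy : y - X.ker.starProjection y ∈ X.range := by
      rw [← hclosed]
      exact Submodule.sub_starProjection_mem_orthogonal y
    obtain ⟨w, hw⟩ := hy
    have hP : ∀ v, X.ker.starProjection (X.ker.starProjection v) = X.ker.starProjection v :=
      fun v => Submodule.starProjection_eq_self_iff.2 (Submodule.starProjection_apply_mem _ v)
    refine ⟨w - X.ker.starProjection w + X.ker.starProjection y, ?_⟩
    have hw' : X w = y - X.ker.starProjection y := hw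
    simp only [add_apply, map_add, map_sub, hker, hP, hw']
    abel

/-- A finite-rank criterion for approximability. -/
lemma isFiniteRankLimit_of_norm_le [CompleteSpace W] {B : W →L[ℂ] W}
    (h : ∀ ε : ℝ, 0 < ε → ∃ (m : ℕ) (ℓ : Fin m → W →L[ℂ] ℂ) (C : ℝ),
      ∀ w, ‖B w‖ ≤ ε * ‖w‖ + C * ∑ j, ‖ℓ j w‖) : IsFiniteRankLimit B := by
  intro ε hε
  obtain ⟨m, ℓ, C, hB⟩ := h (ε / 2) (by positivity)
  let L : W →L[ℂ] (Fin m → ℂ) := ContinuousLinearMap.pi ℓ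
  have hLc : IsClosed (L.ker : Set W) := L.isClosed_ker
  have : CompleteSpace L.ker := hLc.completeSpace_coe
  let P : W →L[ℂ] W := L.ker.starProjection
  -- `P` projects onto the common kernel of the functionals, which has finite codimension, so `1 -
  -- P` has finite rank. On the range of `P` the functionals vanish and only the small term of the
  -- bound is left.
  refine ⟨B * (1 - P), ?_, ?_⟩
  · have h1 : ((1 - P : W →L[ℂ] W) : W →ₗ[ℂ] W).HasFiniteRange := by
      rw [LinearMap.HasFiniteRange, Submodule.range_fg_iff_ker_cofg]
      refine Submodule.CoFG.of_le (S := L.ker) (fun w hw => ?_) (Submodule.CoFG.ker _)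
      have : P w = w := Submodule.starProjection_eq_self_iff.2 hw
      simp [this]
    exact h1.comp_left (B : W →ₗ[ℂ] W)
  · have : B - B * (1 - P) = B * P := by rw [mul_sub, mul_one, sub_sub_cancel]
    rw [this]
    refine lt_of_le_of_lt (ContinuousLinearMap.opNorm_le_bound _ (by positivity) fun w => ?_)
      (half_lt_self hε)
    have h0 : ∀ j, ℓ j (P w) = 0 := fun j =>
      congrFun (show L (P w) = 0 from Submodule.starProjection_apply_mem L.ker w) j
    calc ‖B (P w)‖ ≤ ε / 2 * ‖P w‖ + C * ∑ j, ‖ℓ j (P w)‖ := hB _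
      _ = ε / 2 * ‖P w‖ := by simp [h0]
      _ ≤ ε / 2 * ‖w‖ := by gcongr; exact Submodule.norm_starProjection_apply_le _ w

/-- An operator of finite rank is a finite sum of operators of rank one. -/
lemma exists_eq_sum_smulRight [CompleteSpace W] {F : W →L[ℂ] W}
    (hF : (F : W →ₗ[ℂ] W).HasFiniteRange) :
    ∃ (m : ℕ) (ℓ : Fin m → W →L[ℂ] ℂ) (a : Fin m → W), F = ∑ j, (ℓ j).smulRight (a j) := by
  have : FiniteDimensional ℂ F.range := (Submodule.fg_iff_finiteDimensional _).1 hF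
  let b := stdOrthonormalBasis ℂ F.range
  refine ⟨_, fun j => (innerSL ℂ (b j : W)).comp F, fun j => (b j : W), ?_⟩
  ext w
  have h := congrArg (Subtype.val) (b.sum_repr' ⟨F w, ⟨w, rfl⟩⟩)
  simp only [Submodule.coe_sum, Submodule.coe_smul, Submodule.coe_inner] at h
  simp only [sum_apply, ContinuousLinearMap.smulRight_apply,
    ContinuousLinearMap.comp_apply, innerSL_apply_apply]
  exact h.symm

end FiniteRank

/-! ### Analytic Fredholm theory for linear operator pencils -/

section Pencil

open Filter Topology

variable {W : Type*} [NormedAddCommGroup W] [InnerProductSpace ℂ W]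

/-- The matrix `δᵢⱼ - ℓᵢ (E aⱼ)` whose invertibility decides that of `E⁻¹ - ∑ ℓⱼ ⊗ aⱼ`. -/
def schurMatrix {m : ℕ} (ℓ : Fin m → W →L[ℂ] ℂ) (a : Fin m → W) (E : W →L[ℂ] W) :
    Matrix (Fin m) (Fin m) ℂ :=
  fun i j => (1 : Matrix (Fin m) (Fin m) ℂ) i j - ℓ i (E (a j))

/-- The operator `∑ Nᵢⱼ ℓⱼ ⊗ aᵢ`. -/
def matrixOperator {m : ℕ} (ℓ : Fin m → W →L[ℂ] ℂ) (a : Fin m → W)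
    (N : Matrix (Fin m) (Fin m) ℂ) : W →L[ℂ] W :=
  ∑ i, ∑ j, N i j • (ℓ j).smulRight (a i)

variable {m : ℕ} {ℓ : Fin m → W →L[ℂ] ℂ} {a : Fin m → W}

lemma matrixOperator_apply (N : Matrix (Fin m) (Fin m) ℂ) (w : W) :
    matrixOperator ℓ a N w = ∑ i, (N.mulVec fun j => ℓ j w) i • a i := by
  simp [matrixOperator, Matrix.mulVec, dotProduct, Finset.sum_smul, smul_smul]

lemma sum_smulRight_eq_matrixOperator :
    ∑ j, (ℓ j).smulRight (a j) = matrixOperator ℓ a 1 := by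
  ext w
  simp [matrixOperator_apply]

/-- Since ℓᵢ (E aⱼ) is the entry of `1 - schurMatrix ℓ a E`, products of these operators with E in
between are computed by matrix products. Inverting a finite-rank perturbation becomes matrix
algebra. -/
lemma matrixOperator_mul (N N' : Matrix (Fin m) (Fin m) ℂ) (E : W →L[ℂ] W) :
    matrixOperator ℓ a N * E * matrixOperator ℓ a N' =
      matrixOperator ℓ a (N * (1 - schurMatrix ℓ a E) * N') := by
  ext w
  change matrixOperator ℓ a N (E (matrixOperator ℓ a N' w)) = _
  simp only [matrixOperator_apply]
  refine Finset.sum_congr rfl fun i _ => ?_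
  congr 1
  rw [← Matrix.mulVec_mulVec, ← Matrix.mulVec_mulVec]
  congr 2
  funext k
  simp [schurMatrix, Matrix.mulVec, dotProduct, map_sum, mul_comm]

lemma matrixOperator_sub (N N' : Matrix (Fin m) (Fin m) ℂ) :
    matrixOperator ℓ a (N - N') = matrixOperator ℓ a N - matrixOperator ℓ a N' := by
  ext w
  simp [matrixOperator_apply, Matrix.sub_mulVec, sub_smul]

/-- The inverse of a perturbation of finite rank. -/
lemma mul_eq_one_of_det_schurMatrix_ne_zero {X E : W →L[ℂ] W} (h1 : X * E = 1) (h2 : E * X = 1)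
    (hd : (schurMatrix ℓ a E).det ≠ 0) :
    (X - ∑ j, (ℓ j).smulRight (a j)) *
        (E + E * matrixOperator ℓ a (schurMatrix ℓ a E)⁻¹ * E) = 1 ∧
      (E + E * matrixOperator ℓ a (schurMatrix ℓ a E)⁻¹ * E) *
        (X - ∑ j, (ℓ j).smulRight (a j)) = 1 := by
  set M := schurMatrix ℓ a E with hM
  have hu : IsUnit M.det := hd.isUnit
  rw [sum_smulRight_eq_matrixOperator]
  set G := matrixOperator ℓ a 1
  set L := matrixOperator ℓ a M⁻¹
  have e1 : G * E * L = L - G := by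
    rw [matrixOperator_mul, ← hM, one_mul, sub_mul, one_mul, Matrix.mul_nonsing_inv _ hu,
      matrixOperator_sub]
  have e2 : L * E * G = L - G := by
    rw [matrixOperator_mul, ← hM, mul_one, mul_sub, mul_one, Matrix.nonsing_inv_mul _ hu,
      matrixOperator_sub]
  constructor
  · calc (X - G) * (E + E * L * E) = X * E + (X * E) * L * E - G * E - (G * E * L) * E := by
          noncomm_ring
      _ = 1 := by rw [h1, e1]; noncomm_ring
  · calc (E + E * L * E) * (X - G) = E * X + E * L * (E * X) - E * G - E * (L * E * G) := by
          noncomm_ring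
      _ = 1 := by rw [h2, e2]; noncomm_ring

/-- A null vector c of the matrix gives w = E (∑ cⱼ aⱼ) with ℓᵢ w = cᵢ. Hence w ≠ 0, and the
perturbation cancels X w. -/
lemma exists_ne_zero_of_det_schurMatrix_eq_zero {X E : W →L[ℂ] W} (h1 : X * E = 1)
    (hd : (schurMatrix ℓ a E).det = 0) :
    ∃ w ≠ 0, (X - ∑ j, (ℓ j).smulRight (a j)) w = 0 := by
  obtain ⟨c, hc, hMc⟩ := Matrix.exists_mulVec_eq_zero_iff.2 hd
  have hX : ∀ w, X (E w) = w := fun w => congrArg (fun T : W →L[ℂ] W => T w) h1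
  have hc' : ∀ i, ℓ i (E (∑ j, c j • a j)) = c i := fun i => by
    have := congrFun hMc i
    simp only [Matrix.mulVec, dotProduct, schurMatrix, sub_mul, Finset.sum_sub_distrib,
      Pi.zero_apply, Matrix.one_apply, ite_mul, one_mul, zero_mul, Finset.sum_ite_eq,
      Finset.mem_univ, if_true] at this
    rw [sub_eq_zero] at this
    rw [this]
    simp [map_sum, mul_comm]
  refine ⟨E (∑ j, c j • a j), fun h0 => hc (funext fun i => ?_), ?_⟩
  · rw [← hc' i, h0, map_zero, Pi.zero_apply]
  · simp only [sub_apply, hX, sum_apply, ContinuousLinearMap.smulRight_apply, hc', sub_self]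

lemma analyticAt_det {M : ℂ → Matrix (Fin m) (Fin m) ℂ} {z₀ : ℂ}
    (hM : ∀ i j, AnalyticAt ℂ (fun z => M z i j) z₀) : AnalyticAt ℂ (fun z => (M z).det) z₀ := by
  simp only [Matrix.det_apply']
  refine Finset.analyticAt_fun_sum _ fun σ _ => analyticAt_const.mul ?_
  exact Finset.analyticAt_fun_prod _ fun i _ => hM _ _

lemma analyticAt_adjugate {M : ℂ → Matrix (Fin m) (Fin m) ℂ} {z₀ : ℂ}
    (hM : ∀ i j, AnalyticAt ℂ (fun z => M z i j) z₀) (i j : Fin m) :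
    AnalyticAt ℂ (fun z => (M z).adjugate i j) z₀ := by
  simp only [Matrix.adjugate_apply]
  refine analyticAt_det fun k l => ?_
  by_cases hk : k = j
  · subst hk
    simpa using analyticAt_const
  · simpa [Matrix.updateRow_ne hk] using hM k l

lemma analyticAt_inverse_pencil [CompleteSpace W] {X K : W →L[ℂ] W} {z₀ : ℂ}
    (h : IsUnit (X - z₀ • K)) : AnalyticAt ℂ (fun z => Ring.inverse (X - z • K)) z₀ := by
  obtain ⟨U, hU⟩ := h
  have h1 : AnalyticAt ℂ (fun z : ℂ => X - z • K) z₀ :=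
    analyticAt_const.sub (analyticAt_id.smul analyticAt_const)
  refine AnalyticAt.fun_comp (g := Ring.inverse) ?_ h1
  rw [← hU]
  exact analyticAt_inverse (𝕜 := ℂ) U

lemma eventually_isUnit_pencil [CompleteSpace W] {X K : W →L[ℂ] W} {z₀ : ℂ}
    (h : IsUnit (X - z₀ • K)) : ∀ᶠ z in 𝓝 z₀, IsUnit (X - z • K) := by
  have hc : Continuous fun z : ℂ => X - z • K := by fun_prop
  exact (Units.isOpen.preimage hc).mem_nhds h

/-- The Neumann expansion of the inverse of a pencil, with remainder. -/
lemma inverse_pencil_eq {X K : W →L[ℂ] W} {z₀ z : ℂ} (h₀ : IsUnit (X - z₀ • K))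
    (h : IsUnit (X - z • K)) (k : ℕ) :
    Ring.inverse (X - z • K) =
      ∑ l ∈ Finset.range k, (z - z₀) ^ l •
        ((Ring.inverse (X - z₀ • K) * K) ^ l * Ring.inverse (X - z₀ • K)) +
      (z - z₀) ^ k • ((Ring.inverse (X - z₀ • K) * K) ^ k * Ring.inverse (X - z • K)) := by
  set E₀ := Ring.inverse (X - z₀ • K)
  set E := Ring.inverse (X - z • K)
  -- The resolvent identity for the pencil; iterating it gives the expansion.
  have hE : E = E₀ + (z - z₀) • (E₀ * K * E) := by
    have h1 : E₀ * (X - z₀ • K) = 1 := Ring.inverse_mul_cancel _ h₀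
    have h2 : (X - z • K) * E = 1 := Ring.mul_inverse_cancel _ h
    calc E = E₀ * (X - z₀ • K) * E := by rw [h1, one_mul]
      _ = E₀ * ((X - z • K) * E) + (z - z₀) • (E₀ * K * E) := by
        have : X - z₀ • K = X - z • K + (z - z₀) • K := by rw [sub_smul]; abel
        rw [this, mul_add, add_mul, mul_assoc, mul_smul_comm, smul_mul_assoc]
      _ = _ := by rw [h2, mul_one]
  induction k with
  | zero => simp
  | succ k ih =>
    rw [Finset.sum_range_succ]
    nth_rw 1 [ih]
    have : (E₀ * K) ^ k * E = (E₀ * K) ^ k * E₀ + (z - z₀) • ((E₀ * K) ^ (k + 1) * E) := by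
      nth_rw 1 [hE]
      rw [mul_add, mul_smul_comm, pow_succ, mul_assoc, mul_assoc, mul_assoc]
    rw [this, smul_add, smul_smul, ← pow_succ, add_assoc]

variable [CompleteSpace W] {A K : W →L[ℂ] W} {z₀ : ℂ}

/-- The local form of a pencil near a point where it is Fredholm of index zero. -/
lemma IsFredholmIndexZero.exists_local (h : IsFredholmIndexZero (A - z₀ • K)) :
    ∃ (X : W →L[ℂ] W) (m : ℕ) (ℓ : Fin m → W →L[ℂ] ℂ) (a : Fin m → W),
      A = X - ∑ j, (ℓ j).smulRight (a j) ∧ IsUnit (X - z₀ • K) ∧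
      (∀ i j, AnalyticAt ℂ
        (fun z => schurMatrix ℓ a (Ring.inverse (X - z • K)) i j) z₀) := by
  obtain ⟨F, hF, hU⟩ := h
  obtain ⟨m, ℓ, a, rfl⟩ := exists_eq_sum_smulRight hF
  have hU' : IsUnit ((A + ∑ j, (ℓ j).smulRight (a j)) - z₀ • K) := by
    rwa [add_sub_right_comm]
  refine ⟨A + ∑ j, (ℓ j).smulRight (a j), m, ℓ, a, by abel, hU', fun i j => ?_⟩
  refine analyticAt_const.sub ?_
  exact (((ℓ i).comp (ContinuousLinearMap.apply ℂ W (a j))).analyticAt _).fun_comp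
    (analyticAt_inverse_pencil hU')

/-- The Fredholm alternative: a nonzero Schur determinant would give an explicit inverse, and a zero
one gives a null vector. -/
lemma IsFredholmIndexZero.exists_ker (h : IsFredholmIndexZero (A - z₀ • K))
    (hn : ¬ IsUnit (A - z₀ • K)) : ∃ w ≠ 0, (A - z₀ • K) w = 0 := by
  obtain ⟨X, m, ℓ, a, rfl, hX, -⟩ := h.exists_local
  rw [sub_right_comm] at hn ⊢
  have h1 := Ring.mul_inverse_cancel _ hX
  have h2 := Ring.inverse_mul_cancel _ hX
  refine exists_ne_zero_of_det_schurMatrix_eq_zero h1 ?_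
  by_contra hd
  obtain ⟨e1, e2⟩ := mul_eq_one_of_det_schurMatrix_ne_zero h1 h2 hd
  exact hn ⟨⟨_, _, e1, e2⟩, rfl⟩

/-- The Schur determinant is holomorphic at `z₀`, so it either vanishes identically near `z₀` or has
no zero in a punctured neighbourhood. -/
lemma IsFredholmIndexZero.eventually_or (h : IsFredholmIndexZero (A - z₀ • K)) :
    (∀ᶠ z in 𝓝 z₀, ¬ IsUnit (A - z • K)) ∨ ∀ᶠ z in 𝓝[≠] z₀, IsUnit (A - z • K) := by
  obtain ⟨X, m, ℓ, a, rfl, hX, hM⟩ := h.exists_local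
  have hu := eventually_isUnit_pencil hX
  rcases (analyticAt_det hM).eventually_eq_zero_or_eventually_ne_zero with h0 | h0
  · left
    filter_upwards [hu, h0] with z hz hd hU
    obtain ⟨w, hw, hw0⟩ :=
      exists_ne_zero_of_det_schurMatrix_eq_zero (Ring.mul_inverse_cancel _ hz) hd
    rw [sub_right_comm] at hw0
    exact hw ((ContinuousLinearMap.isUnit_iff_bijective.1 hU).1 (hw0.trans (map_zero _).symm))
  · right
    filter_upwards [nhdsWithin_le_nhds hu, h0] with z hz hd
    obtain ⟨e1, e2⟩ := mul_eq_one_of_det_schurMatrix_ne_zero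
      (Ring.mul_inverse_cancel _ hz) (Ring.inverse_mul_cancel _ hz) hd
    rw [sub_right_comm]
    exact ⟨⟨_, _, e1, e2⟩, rfl⟩

/-- Near an isolated singularity the inverse of a pencil is, up to a holomorphic function, a sum
of products of fixed operators of finite rank with operator functions that are continuous away
from the singularity. -/
lemma IsFredholmIndexZero.exists_inverse_eq (h : IsFredholmIndexZero (A - z₀ • K))
    (hi : ∀ᶠ z in 𝓝[≠] z₀, IsUnit (A - z • K)) :
    ∃ (r : ℝ) (ι : Type) (_ : Fintype ι) (F : ι → W →L[ℂ] W) (Φ : ℂ → W →L[ℂ] W)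
      (Ψ : ι → ℂ → W →L[ℂ] W), 0 < r ∧ (∀ i, (F i : W →ₗ[ℂ] W).HasFiniteRange) ∧
      DifferentiableOn ℂ Φ (Metric.closedBall z₀ r) ∧
      (∀ i, ContinuousOn (Ψ i) (Metric.sphere z₀ r)) ∧
      ∀ z ∈ Metric.closedBall z₀ r, z ≠ z₀ → IsUnit (A - z • K) ∧
        Ring.inverse (A - z • K) = Φ z + ∑ i, F i * Ψ i z := by
  obtain ⟨X, m, ℓ, a, rfl, hX, hM⟩ := h.exists_local
  set M : ℂ → Matrix (Fin m) (Fin m) ℂ := fun z => schurMatrix ℓ a (Ring.inverse (X - z • K))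
  have hd := analyticAt_det hM
  have hE := analyticAt_inverse_pencil hX
  have hu := eventually_isUnit_pencil hX
  have hnd : ¬ ∀ᶠ z in 𝓝 z₀, (M z).det = 0 := by
    intro h0
    obtain ⟨z, ⟨h1, h2⟩, h3⟩ :=
      (((hu.and h0).filter_mono nhdsWithin_le_nhds).and hi).exists
    obtain ⟨w, hw, hw0⟩ :=
      exists_ne_zero_of_det_schurMatrix_eq_zero (Ring.mul_inverse_cancel _ h1) h2
    rw [sub_right_comm] at hw0
    exact hw ((ContinuousLinearMap.isUnit_iff_bijective.1 h3).1 (hw0.trans (map_zero _).symm))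
  -- The determinant has a zero of finite order `k` with `q z₀ ≠ 0`; by Cramer's rule the inverse
  -- Schur matrix has a pole of order at most `k`.
  obtain ⟨k, q, hq, hq0, hdq⟩ := hd.exists_eventuallyEq_pow_smul_nonzero_iff.2 hnd
  have hqi : AnalyticAt ℂ (fun z => (q z)⁻¹) z₀ := hq.inv hq0
  have hadj := analyticAt_adjugate hM
  have hq0' : ∀ᶠ z in 𝓝 z₀, q z ≠ 0 := hq.continuousAt.eventually_ne hq0
  have hevent : ∀ᶠ z in 𝓝 z₀, IsUnit (X - z • K) ∧ (M z).det = (z - z₀) ^ k • q z ∧ q z ≠ 0 ∧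
      AnalyticAt ℂ (fun z => (q z)⁻¹) z ∧
      (∀ i j, AnalyticAt ℂ (fun z => (M z).adjugate i j) z) ∧
      AnalyticAt ℂ (fun z => Ring.inverse (X - z • K)) z := by
    filter_upwards [hu, hdq, hq0', hqi.eventually_analyticAt,
      eventually_all.2 fun i => eventually_all.2 fun j => (hadj i j).eventually_analyticAt,
      hE.eventually_analyticAt] with z h1 h2 h3 h4 h5 h6
    exact ⟨h1, h2, h3, h4, h5, h6⟩
  obtain ⟨r, hr, hball⟩ := Metric.nhds_basis_closedBall.eventually_iff.1 hevent
  set E : ℂ → W →L[ℂ] W := fun z => Ring.inverse (X - z • K)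
  set T : ℕ → W →L[ℂ] W := fun l => (E z₀ * K) ^ l
  have hdE : ∀ z ∈ Metric.closedBall z₀ r, DifferentiableAt ℂ E z := fun z hz =>
    (hball hz).2.2.2.2.2.differentiableAt
  set R : Fin m → Fin m → W →L[ℂ] W := fun i j => (ℓ j).smulRight (a i)
  -- In the term E M⁻¹ E of the inverse the left factor E is expanded at `z₀` to order `k`. The
  -- remainder carries (z - z₀)^k, which cancels the pole and goes into the holomorphic part. Each
  -- of the `k` leading terms has a fixed finite-rank factor on the left, and its scalar pole is
  -- moved into the right factor.
  refine ⟨r, Fin m × Fin m × Fin k, inferInstance,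
    fun s => T s.2.2 * E z₀ * R s.1 s.2.1,
    fun z => E z + ∑ i, ∑ j, ((q z)⁻¹ * (M z).adjugate i j) • (T k * E z * R i j * E z),
    fun s z => ((z - z₀) ^ (s.2.2 : ℕ) * (((z - z₀) ^ k)⁻¹ * ((q z)⁻¹ * (M z).adjugate s.1 s.2.1))) •
      E z, hr, fun s => ?_, fun z hz => ?_, fun s z hz => ?_, fun z hz hne => ?_⟩
  · have : ((R s.1 s.2.1 : W →L[ℂ] W) : W →ₗ[ℂ] W).HasFiniteRange := by
      refine LinearMap.HasFiniteRange.comp_left (u := (ℓ s.2.1 : W →ₗ[ℂ] ℂ)) (by simp)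
        (LinearMap.toSpanSingleton ℂ W (a s.1))
    exact this.comp_left ((T s.2.2 * E z₀ : W →L[ℂ] W) : W →ₗ[ℂ] W)
  · have h1 := hball hz
    have hE1 := hdE z hz
    refine (hE1.add (DifferentiableAt.fun_sum fun i _ => DifferentiableAt.fun_sum fun j _ => ?_)
      ).differentiableWithinAt
    refine (h1.2.2.2.1.differentiableAt.mul (h1.2.2.2.2.1 i j).differentiableAt).smul ?_
    exact (((differentiableAt_const _).mul hE1).mul (differentiableAt_const _)).mul hE1
  · have hz' := Metric.sphere_subset_closedBall hz
    have h1 := hball hz'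
    have hne : z - z₀ ≠ 0 := by
      intro h0
      rw [mem_sphere_iff_norm, h0, norm_zero] at hz
      exact hr.ne hz
    refine (ContinuousAt.fun_smul ?_ (hdE z hz').continuousAt).continuousWithinAt
    refine ContinuousAt.fun_mul (by fun_prop) (ContinuousAt.fun_mul ?_
      (h1.2.2.2.1.continuousAt.mul (h1.2.2.2.2.1 _ _).continuousAt))
    exact ContinuousAt.inv₀ (by fun_prop) (pow_ne_zero _ hne)
  · obtain ⟨h1, h2, h3, -, -, -⟩ := hball hz
    have hne' : z - z₀ ≠ 0 := sub_ne_zero.2 hne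
    have hdet : (M z).det ≠ 0 := by
      rw [h2]
      exact smul_ne_zero (pow_ne_zero _ hne') h3
    obtain ⟨e1, e2⟩ := mul_eq_one_of_det_schurMatrix_ne_zero
      (Ring.mul_inverse_cancel _ h1) (Ring.inverse_mul_cancel _ h1) hdet
    rw [sub_right_comm X]
    refine ⟨⟨⟨_, _, e1, e2⟩, rfl⟩, ?_⟩
    rw [Ring.inverse_unit ⟨_, _, e1, e2⟩]
    change E z + E z * matrixOperator ℓ a (M z)⁻¹ * E z = _
    rw [add_assoc, add_right_inj]
    set c : Fin m → Fin m → ℂ := fun i j => (q z)⁻¹ * (M z).adjugate i j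
    have hN : ∀ i j, (M z)⁻¹ i j = ((z - z₀) ^ k)⁻¹ * c i j := fun i j => by
      rw [Matrix.inv_def, h2, Ring.inverse_eq_inv', Matrix.smul_apply, smul_eq_mul, smul_eq_mul,
        mul_inv, mul_assoc]
    have hexp := inverse_pencil_eq hX h1 k
    change E z = ∑ l ∈ Finset.range k, (z - z₀) ^ l • (T l * E z₀) +
      (z - z₀) ^ k • (T k * E z) at hexp
    have hpk : ((z - z₀) ^ k)⁻¹ * (z - z₀) ^ k = 1 := inv_mul_cancel₀ (pow_ne_zero _ hne')
    simp only [Fintype.sum_prod_type, matrixOperator, hN, Finset.mul_sum, Finset.sum_mul]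
    rw [← Finset.sum_add_distrib]
    refine Finset.sum_congr rfl fun i _ => ?_
    rw [← Finset.sum_add_distrib]
    refine Finset.sum_congr rfl fun j _ => ?_
    change E z * ((((z - z₀) ^ k)⁻¹ * c i j) • R i j) * E z = c i j • (T k * E z * R i j * E z) +
      ∑ l : Fin k, T l * E z₀ * R i j *
        (((z - z₀) ^ (l : ℕ) * (((z - z₀) ^ k)⁻¹ * c i j)) • E z)
    nth_rw 1 [hexp]
    rw [← Fin.sum_univ_eq_sum_range (fun l => (z - z₀) ^ l • (T l * E z₀)) k, add_mul, add_mul,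
      add_comm, Finset.sum_mul, Finset.sum_mul]
    congr 1
    · simp only [smul_mul_assoc, mul_smul_comm, smul_smul]
      congr 1
      rw [mul_right_comm, hpk, one_mul]
    · refine Finset.sum_congr rfl fun l _ => ?_
      simp only [smul_mul_assoc, mul_smul_comm, smul_smul, mul_assoc]
      congr 1
      ring

end Pencil

/-! ### Resolvents -/

section Resolvent

variable {H : Type*} [NormedAddCommGroup H] [InnerProductSpace ℂ H] {T : H →ₗ.[ℂ] H}

lemma IsResolvent.unique {z : ℂ} {R R' : H →L[ℂ] H} (h : IsResolvent T z R)
    (h' : IsResolvent T z R') : R = R' := by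
  ext f
  obtain ⟨hf, e⟩ := h.1 f
  have := h'.2 ⟨R f, hf⟩
  rw [e] at this
  exact this.symm

lemma IsResolvent.resolvent_eq {z : ℂ} {R : H →L[ℂ] H} (h : IsResolvent T z R) :
    resolvent T z = R := by
  have hz : z ∈ resolventSet T := ⟨R, h⟩
  rw [resolvent, dif_pos hz]
  exact hz.choose_spec.unique h

lemma IsResolvent.shift {z α : ℂ} {R : H →L[ℂ] H} (h : IsResolvent T (z - α) R) :
    IsResolvent (shift T α) z R := by
  refine ⟨fun f => ?_, fun u => ?_⟩
  · obtain ⟨hf, e⟩ := h.1 f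
    refine ⟨hf, ?_⟩
    change α • R f + T ⟨R f, hf⟩ - z • R f = f
    nth_rw 4 [← e]
    rw [sub_smul]
    abel
  · have := h.2 u
    change R (α • (u : H) + T u - z • (u : H)) = u
    nth_rw 3 [← this]
    congr 1
    rw [sub_smul]
    abel

/-- Pairing (T + z) R f = f with R f and using accretivity gives Re z ‖R f‖² ≤ Re (f, R f), and
Cauchy-Schwarz finishes. -/
lemma IsResolvent.norm_le {z : ℂ} (hz : 0 < z.re) (hT : IsAccretive T) {R : H →L[ℂ] H}
    (h : IsResolvent T (-z) R) : ‖R‖ ≤ (z.re)⁻¹ := by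
  refine R.opNorm_le_bound (by positivity) fun f => ?_
  obtain ⟨hf, e⟩ := h.1 f
  have h1 : z.re * ‖R f‖ ^ 2 ≤ (⟪R f, f⟫_ℂ).re := by
    have h2 := hT ⟨R f, hf⟩
    nth_rw 3 [← e]
    rw [neg_smul, sub_neg_eq_add, inner_add_right, inner_smul_right, Complex.add_re,
      inner_self_eq_norm_sq_to_K]
    change _ ≤ _ + (z * ((‖R f‖ : ℝ) : ℂ) ^ 2).re
    rw [← Complex.ofReal_pow, Complex.re_mul_ofReal]
    linarith
  have h3 : (⟪R f, f⟫_ℂ).re ≤ ‖R f‖ * ‖f‖ :=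
    (Complex.re_le_norm _).trans (norm_inner_le_norm _ _)
  rw [inv_mul_eq_div, le_div_iff₀ hz]
  rcases (norm_nonneg (R f)).eq_or_lt with h0 | h0
  · rw [← h0, zero_mul]
    positivity
  · refine le_of_mul_le_mul_left ?_ h0
    nlinarith

lemma abs_arg_le_of_abs_im_le {z : ℂ} (h : |z.im| ≤ z.re) : |z.arg| ≤ Real.pi / 4 := by
  have hre : 0 ≤ z.re := (abs_nonneg _).trans h
  rw [Complex.arg_of_re_nonneg hre]
  have hpi := Real.pi_pos
  have key : |z.im / ‖z‖| ≤ Real.sin (Real.pi / 4) := by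
    rw [Real.sin_pi_div_four, abs_div, abs_norm]
    refine div_le_of_le_mul₀ (norm_nonneg _) (by positivity) ?_
    refine abs_le_of_sq_le_sq' ?_ (by positivity) |>.2
    rw [mul_pow, div_pow, Real.sq_sqrt (by norm_num), Complex.sq_norm, Complex.normSq_apply,
      sq_abs]
    nlinarith [abs_le_abs_of_nonneg (abs_nonneg _) h, sq_abs z.im, sq_le_sq.2
      (show |z.im| ≤ |z.re| by rwa [abs_of_nonneg hre])]
  obtain ⟨k1, k2⟩ := abs_le.1 key
  rw [abs_le]
  refine ⟨?_, ?_⟩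
  · rw [Real.le_arcsin_iff_sin_le' ⟨by linarith, by linarith⟩, Real.sin_neg]
    exact k1
  · rw [Real.arcsin_le_iff_le_sin' ⟨by linarith, by linarith⟩]
    exact k2

end Resolvent

/-! ### Operators generated by forms -/

section FormOperator

open Filter Topology ContinuousLinearMap

variable {H W : Type*} [NormedAddCommGroup H] [InnerProductSpace ℂ H] [CompleteSpace H]
  [NormedAddCommGroup W] [InnerProductSpace ℂ W] [CompleteSpace W]

/-- The bounded operator on the form domain `W` that represents the form
`(w, v) ↦ (w, v)_W + (B w, v)_W - (J w, J v)_H`. -/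
def formMap (J : W →L[ℂ] H) (B : W →L[ℂ] W) : W →L[ℂ] W := 1 + B - adjoint J ∘L J

/-- `T` is the operator in `H` generated by the form that is represented by `formMap J B`. -/
def IsFormOperator (T : H →ₗ.[ℂ] H) (J : W →L[ℂ] H) (B : W →L[ℂ] W) : Prop :=
  ∀ u f, (u, f) ∈ T.graph ↔ ∃ w, J w = u ∧ formMap J B w = adjoint J f

/-- The form, shifted by `z`. -/
def formPencil (J : W →L[ℂ] H) (B : W →L[ℂ] W) (z : ℂ) : W →L[ℂ] W :=
  formMap J B - z • (adjoint J ∘L J)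

variable {T : H →ₗ.[ℂ] H} {J : W →L[ℂ] H} {B : W →L[ℂ] W} {z : ℂ}

lemma formPencil_apply (w : W) :
    formPencil J B z w = formMap J B w - z • adjoint J (J w) := rfl

lemma inner_formMap (w : W) :
    ⟪w, formMap J B w⟫_ℂ = (‖w‖ ^ 2 : ℝ) + ⟪w, B w⟫_ℂ - (‖J w‖ ^ 2 : ℝ) := by
  have h1 : ⟪w, w⟫_ℂ = ((‖w‖ ^ 2 : ℝ) : ℂ) := by
    rw [inner_self_eq_norm_sq_to_K]
    push_cast
    rfl
  have h2 : ⟪J w, J w⟫_ℂ = ((‖J w‖ ^ 2 : ℝ) : ℂ) := by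
    rw [inner_self_eq_norm_sq_to_K]
    push_cast
    rfl
  rw [← h1, ← h2, ← adjoint_inner_right, ← inner_add_right, ← inner_sub_right]
  rfl

lemma inner_formPencil (w : W) :
    ⟪w, formPencil J B z w⟫_ℂ = (‖w‖ ^ 2 : ℝ) + ⟪w, B w⟫_ℂ - (1 + z) * (‖J w‖ ^ 2 : ℝ) := by
  have h2 : ⟪J w, J w⟫_ℂ = ((‖J w‖ ^ 2 : ℝ) : ℂ) := by
    rw [inner_self_eq_norm_sq_to_K]
    push_cast
    rfl
  rw [formPencil_apply, inner_sub_right, inner_formMap, inner_smul_right, adjoint_inner_right, h2]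
  ring

/-- Forms with a relative bound below one are coercive far to the left. -/
lemma isUnit_formPencil {C : ℝ} (hB : ∀ w, ‖⟪w, B w⟫_ℂ‖ ≤ 1 / 2 * ‖w‖ ^ 2 + C * ‖J w‖ ^ 2)
    (hz : z.re ≤ -(C + 1)) : IsUnit (formPencil J B z) := by
  refine isUnit_of_forall_le_norm_inner_map _ (c := 1 / 2) (by norm_num) fun w => ?_
  rw [norm_inner_symm, inner_formPencil]
  refine le_trans ?_ (Complex.re_le_norm _)
  have h1 := (abs_le.1 ((Complex.abs_re_le_norm _).trans (hB w))).1
  rw [Complex.sub_re, Complex.add_re, Complex.ofReal_re, Complex.re_mul_ofReal, Complex.add_re,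
    Complex.one_re]
  have h2 : 0 ≤ (-(C + 1) - z.re) * ‖J w‖ ^ 2 := mul_nonneg (by linarith) (by positivity)
  push_cast
  nlinarith

/-- For B = 0 the quadratic form is q = ‖w‖² - (1 + z)‖J w‖². Its imaginary part controls ‖J w‖²,
which in turn bounds ‖w‖² by a multiple of |q|. Coercivity off the real axis follows. -/
lemma isUnit_formPencil_zero (hz : z.im ≠ 0) : IsUnit (formPencil J 0 z) := by
  -- With x = ‖w‖² and y = ‖J w‖²: |Im z| y ≤ |q| and x ≤ |q| + |1 + z| y yield |Im z| x ≤ (|1 + z|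
  -- + |Im z|) |q|.
  have hd : 0 < |z.im| / (‖1 + z‖ + |z.im|) := by positivity
  obtain ⟨c, hc⟩ : ∃ c : NNReal, (c : ℝ) = |z.im| / (‖1 + z‖ + |z.im|) := ⟨⟨_, hd.le⟩, rfl⟩
  rw [← hc, NNReal.coe_pos] at hd
  refine isUnit_of_forall_le_norm_inner_map _ hd fun w => ?_
  rw [norm_inner_symm, inner_formPencil]
  simp only [zero_apply, inner_zero_right, add_zero, hc]
  have hs : 0 < ‖1 + z‖ + |z.im| := by positivity
  rw [mul_div_assoc', div_le_iff₀ hs]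
  set x := ‖w‖ ^ 2
  set y := ‖J w‖ ^ 2
  have hy : 0 ≤ y := by positivity
  set q : ℂ := (x : ℂ) - (1 + z) * (y : ℂ)
  have h1 : |z.im| * y ≤ ‖q‖ := by
    have := Complex.abs_im_le_norm q
    simpa [q, abs_mul, abs_of_nonneg hy] using this
  have h2 : x ≤ ‖q‖ + ‖1 + z‖ * y := by
    have h3 : (x : ℂ) = q + (1 + z) * y := by simp [q]
    calc x ≤ ‖(x : ℂ)‖ := by rw [Complex.norm_real]; exact Real.le_norm_self _
      _ ≤ ‖q‖ + ‖(1 + z) * (y : ℂ)‖ := by rw [h3]; exact norm_add_le _ _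
      _ = ‖q‖ + ‖1 + z‖ * y := by rw [norm_mul, Complex.norm_real, Real.norm_of_nonneg hy]
  have h3 := abs_nonneg z.im
  have h4 := norm_nonneg (1 + z)
  nlinarith [mul_le_mul_of_nonneg_left h2 h3, mul_le_mul_of_nonneg_left h1 h4]

namespace IsFormOperator

lemma exists_of_domain (hT : IsFormOperator T J B) (u : T.domain) :
    ∃ w, J w = u ∧ formMap J B w = adjoint J (T u) :=
  (hT u (T u)).1 (LinearPMap.mem_graph T u)

lemma exists_mem_domain (hT : IsFormOperator T J B) {w : W} {f : H}
    (h : formMap J B w = adjoint J f) : ∃ hw : J w ∈ T.domain, T ⟨J w, hw⟩ = f := by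
  obtain ⟨y, h1, h2⟩ := (LinearPMap.mem_graph_iff T).1 ((hT (J w) f).2 ⟨w, rfl, h⟩)
  simp only at h1 h2
  refine ⟨h1 ▸ y.2, ?_⟩
  rw [← h2]
  congr 1
  exact Subtype.ext h1.symm

lemma exists_formPencil (hT : IsFormOperator T J B) (z : ℂ) (u : T.domain) :
    ∃ w, J w = u ∧ formPencil J B z w = adjoint J (T u - z • (u : H)) := by
  obtain ⟨w, h1, h2⟩ := hT.exists_of_domain u
  exact ⟨w, h1, by rw [formPencil_apply, h1, h2, map_sub, map_smul]⟩

lemma exists_mem_domain' (hT : IsFormOperator T J B) {w : W} {f : H}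
    (h : formPencil J B z w = adjoint J f) :
    ∃ hw : J w ∈ T.domain, T ⟨J w, hw⟩ = f + z • J w := by
  refine hT.exists_mem_domain ?_
  rw [map_add, map_smul, ← h, formPencil_apply, sub_add_cancel]

/-- The resolvent in terms of the inverse on the form domain. -/
lemma isResolvent (hT : IsFormOperator T J B) (h : IsUnit (formPencil J B z)) :
    IsResolvent T z (J ∘L Ring.inverse (formPencil J B z) ∘L adjoint J) := by
  refine ⟨fun f => ?_, fun u => ?_⟩
  · have h1 : formPencil J B z (Ring.inverse (formPencil J B z) (adjoint J f)) = adjoint J f :=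
      congrArg (fun X : W →L[ℂ] W => X (adjoint J f)) (Ring.mul_inverse_cancel _ h)
    obtain ⟨hw, e⟩ := hT.exists_mem_domain' h1
    refine ⟨hw, ?_⟩
    exact sub_eq_iff_eq_add.2 e
  · obtain ⟨w, h1, h2⟩ := hT.exists_formPencil z u
    change J (Ring.inverse (formPencil J B z) (adjoint J (T u - z • (u : H)))) = u
    rw [← h2, ← h1]
    exact congrArg (fun X : W →L[ℂ] W => J (X w)) (Ring.inverse_mul_cancel _ h)

/-- The resolvent solves the pencil equation only for right-hand sides in the range of J*. A general
g is first solved at the reference point `z₀`; the error at z is then (z - z₀) J*J w₀, which does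
lie in that range. -/
lemma isUnit_of_mem_resolventSet (hT : IsFormOperator T J B) (hJ : Function.Injective J) {z₀ : ℂ}
    (h₀ : IsUnit (formPencil J B z₀)) (hz : z ∈ resolventSet T) :
    IsUnit (formPencil J B z) := by
  obtain ⟨R, hR1, hR2⟩ := hz
  refine isUnit_iff_bijective.2 ⟨(injective_iff_map_eq_zero _).2 fun w hw => ?_, fun g => ?_⟩
  · obtain ⟨hd, e⟩ := hT.exists_mem_domain' (hw.trans (map_zero (adjoint J)).symm)
    have h1 := hR2 ⟨J w, hd⟩
    rw [e, zero_add, sub_self, map_zero] at h1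
    exact hJ (h1.symm.trans (map_zero J).symm)
  · obtain ⟨w₀, hw₀⟩ := (isUnit_iff_bijective.1 h₀).2 g
    obtain ⟨hd, e⟩ := hR1 ((z - z₀) • J w₀)
    obtain ⟨w, -, h2⟩ := hT.exists_formPencil z ⟨_, hd⟩
    rw [e] at h2
    refine ⟨w₀ + w, ?_⟩
    rw [map_add, h2, ← hw₀, formPencil_apply, formPencil_apply, map_smul, sub_smul]
    abel

lemma ker_subScalar_map_le (hT : IsFormOperator T J B) :
    (LinearMap.ker (subScalar T z)).map T.domain.subtype ≤
      (formPencil J B z).ker.map (J : W →ₗ[ℂ] H) := by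
  rintro _ ⟨u, hu, rfl⟩
  obtain ⟨w, h1, h2⟩ := hT.exists_formPencil z u
  have : T u - z • (u : H) = 0 := hu
  rw [this, map_zero] at h2
  exact ⟨w, h2, h1⟩

lemma ker_le_comap (hT : IsFormOperator T J B) {w : W} (hw : formPencil J B z w = 0) :
    ∃ u : T.domain, subScalar T z u = 0 ∧ (u : H) = J w := by
  obtain ⟨hd, e⟩ := hT.exists_mem_domain' (hw.trans (map_zero (adjoint J)).symm)
  refine ⟨⟨J w, hd⟩, ?_, rfl⟩
  change T ⟨J w, hd⟩ - z • J w = 0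
  rw [e, zero_add, sub_self]

lemma range_subScalar (hT : IsFormOperator T J B) :
    LinearMap.range (subScalar T z) =
      (formPencil J B z).range.comap (adjoint J : H →ₗ[ℂ] W) := by
  ext f
  constructor
  · rintro ⟨u, rfl⟩
    obtain ⟨w, -, h2⟩ := hT.exists_formPencil z u
    exact ⟨w, h2⟩
  · rintro ⟨w, hw⟩
    obtain ⟨hd, e⟩ := hT.exists_mem_domain' hw
    refine ⟨⟨J w, hd⟩, ?_⟩
    change T ⟨J w, hd⟩ - z • J w = f
    rw [e, add_sub_cancel_right]

/-- The kernel of T - z lies in the image under J of the kernel of the pencil, and its range is the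
preimage under J* of the range of the pencil. Closedness and finite codimension pass to preimages.
-/
lemma isFredholmAt (hT : IsFormOperator T J B)
    (h : IsFredholmIndexZero (formPencil J B z)) : IsFredholmAt T z := by
  have hF := h.isFredholm
  have := hF.finite_ker
  have := hF.finite_coker
  rw [IsFredholmAt, hT.range_subScalar]
  refine ⟨?_, hF.isClosed_range.preimage (adjoint J).continuous, ?_⟩
  · have h1 : FiniteDimensional ℂ ((LinearMap.ker (subScalar T z)).map T.domain.subtype) :=
      Submodule.finiteDimensional_of_le hT.ker_subScalar_map_le
    exact LinearEquiv.finiteDimensional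
      (Submodule.equivMapOfInjective _ T.domain.subtype_injective (LinearMap.ker (subScalar T z))).symm
  · rw [← Submodule.ker_mkQ (formPencil J B z).range, ← LinearMap.ker_comp]
    exact Submodule.CoFG.ker _

/-- Off the real axis the pencil is invertible. On the real axis it is self-adjoint, and a
finite-dimensional kernel together with a closed range forces index zero. -/
lemma isFredholmIndexZero (hT : IsFormOperator T J 0) (hJ : Function.Injective J)
    (h : IsFredholmAt T z) : IsFredholmIndexZero (formPencil J 0 z) := by
  by_cases hz : z.im = 0
  swap
  · exact IsUnit.isFredholmIndexZero (isUnit_formPencil_zero hz)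
  obtain ⟨hk, hr, -⟩ := h
  have hker : FiniteDimensional ℂ (formPencil J 0 z).ker := by
    have h1 : ((formPencil J 0 z).ker).map (J : W →ₗ[ℂ] H) ≤
        (LinearMap.ker (subScalar T z)).map T.domain.subtype := by
      rintro _ ⟨w, hw, rfl⟩
      obtain ⟨u, h2, h3⟩ := hT.ker_le_comap (show formPencil J 0 z w = 0 from hw)
      exact ⟨u, h2, h3⟩
    have h2 := Submodule.finiteDimensional_of_le h1
    exact LinearEquiv.finiteDimensional
      (Submodule.equivMapOfInjective (J : W →ₗ[ℂ] H) hJ (formPencil J 0 z).ker).symm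
  refine isFredholmIndexZero_of_isSelfAdjoint ?_ ?_
  · have hz' : IsSelfAdjoint z := Complex.conj_eq_iff_im.2 hz
    have hK : IsSelfAdjoint (adjoint J ∘L J) := (isPositive_adjoint_comp_self J).isSelfAdjoint
    rw [formPencil, formMap, add_zero]
    exact ((IsSelfAdjoint.one _).sub hK).sub (hz'.smul hK)
  -- The pencil is 1 - (1 + z) J*J, so y lies in its range exactly when (1 + z) J*J y does, that is,
  -- when (1 + z) J y lies in the range of T - z. Closedness of the range is thus transported from H
  -- to W.
  · have h1 : ((formPencil J 0 z).range : Set W) =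
        (fun y => (1 + z) • J y) ⁻¹' (LinearMap.range (subScalar T z) : Set H) := by
      ext y
      have h2 : y = formPencil J 0 z y + adjoint J ((1 + z) • J y) := by
        rw [formPencil_apply, formMap, map_smul, add_smul]
        simp
      have h3 : formPencil J 0 z y ∈ (formPencil J 0 z).range := ⟨y, rfl⟩
      rw [Set.mem_preimage, hT.range_subScalar, SetLike.mem_coe, SetLike.mem_coe,
        Submodule.mem_comap]
      nth_rw 1 [h2]
      exact Submodule.add_mem_iff_right _ h3
    rw [h1]
    exact hr.preimage (by fun_prop)

lemma inner_apply (hT : IsFormOperator T J B) (u : T.domain) :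
    ∃ w, J w = u ∧ ⟪(u : H), T u⟫_ℂ = (‖w‖ ^ 2 : ℝ) + ⟪w, B w⟫_ℂ - (‖(u : H)‖ ^ 2 : ℝ) := by
  obtain ⟨w, h1, h2⟩ := hT.exists_of_domain u
  refine ⟨w, h1, ?_⟩
  rw [← h1, ← inner_formMap, h2, adjoint_inner_right]

/-- Operators generated by forms with a relative bound below one are m-sectorial. -/
lemma isMSectorial (hT : IsFormOperator T J B) {C : ℝ}
    (hB : ∀ w, ‖⟪w, B w⟫_ℂ‖ ≤ 1 / 2 * ‖w‖ ^ 2 + C * ‖J w‖ ^ 2) : IsMSectorial T := by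
  -- For ‖u‖ = 1 the bound gives Re (Tu, u) ≥ ‖w‖²/2 - C - 1 and |Im (Tu, u)| ≤ ‖w‖²/2 + C. With
  -- vertex -(2C + 1) the real part dominates the imaginary part, whence the angle π/4. The shift C
  -- + 1 makes the real part nonnegative.
  refine ⟨⟨-(2 * C + 1), Real.pi / 4, by positivity, by linarith [Real.pi_pos], fun u hu => ?_⟩,
    ((C + 1 : ℝ) : ℂ), ?_⟩
  · obtain ⟨w, h1, h2⟩ := hT.inner_apply u
    refine abs_arg_le_of_abs_im_le ?_
    have h3 := hB w
    rw [h1, hu] at h3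
    have h4 := (Complex.abs_im_le_norm _).trans h3
    have h5 := (abs_le.1 ((Complex.abs_re_le_norm _).trans h3)).1
    rw [h2, hu]
    simp only [Complex.sub_im, Complex.add_im, Complex.ofReal_im, Complex.sub_re, Complex.add_re,
      Complex.ofReal_re, zero_add, sub_zero]
    linarith
  · have hacc : IsAccretive (shift T ((C + 1 : ℝ) : ℂ)) := by
      intro u
      obtain ⟨w, h1, h2⟩ := hT.inner_apply u
      change 0 ≤ (⟪(u : H), ((C + 1 : ℝ) : ℂ) • (u : H) + T u⟫_ℂ).re
      have h5 := (abs_le.1 ((Complex.abs_re_le_norm _).trans (hB w))).1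
      rw [h1] at h5
      have h6 : ⟪(u : H), (u : H)⟫_ℂ = ((‖(u : H)‖ ^ 2 : ℝ) : ℂ) := by
        rw [inner_self_eq_norm_sq_to_K]
        push_cast
        rfl
      rw [inner_add_right, inner_smul_right, h6, ← Complex.ofReal_mul]
      erw [h2]
      simp only [Complex.sub_re, Complex.add_re, Complex.ofReal_re]
      nlinarith [sq_nonneg ‖w‖]
    refine ⟨hacc, fun z hz => ?_⟩
    have hu : IsUnit (formPencil J B (-z - ((C + 1 : ℝ) : ℂ))) := by
      refine isUnit_formPencil hB ?_
      rw [Complex.sub_re, Complex.neg_re, Complex.ofReal_re]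
      linarith
    have hR := (hT.isResolvent hu).shift
    refine ⟨⟨_, hR⟩, ?_⟩
    rw [hR.resolvent_eq]
    exact hR.norm_le hz hacc

end IsFormOperator

end FormOperator

/-! ### The spectrum of operators generated by forms -/

section FormSpectrum

open Filter Topology ContinuousLinearMap

lemma circleIntegral_clm_apply {E F : Type*} [NormedAddCommGroup E] [NormedSpace ℂ E]
    [CompleteSpace E] [NormedAddCommGroup F] [NormedSpace ℂ F] [CompleteSpace F] (L : E →L[ℂ] F)
    {f : ℂ → E} {c : ℂ} {r : ℝ} (hf : CircleIntegrable f c r) :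
    ∮ z in C(c, r), L (f z) = L (∮ z in C(c, r), f z) := by
  rw [circleIntegral, circleIntegral, ← ContinuousLinearMap.intervalIntegral_comp_comm L hf.out]
  simp only [map_smul]

variable {H W : Type*} [NormedAddCommGroup H] [InnerProductSpace ℂ H] [CompleteSpace H]
  [NormedAddCommGroup W] [InnerProductSpace ℂ W] [CompleteSpace W]
  {T T₀ : H →ₗ.[ℂ] H} {J : W →L[ℂ] H} {B : W →L[ℂ] W} {z : ℂ}

lemma formPencil_eq_add : formPencil J B z = formPencil J 0 z + B := by
  rw [formPencil, formPencil, formMap, formMap]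
  abel

/-- The singular set of the form pencil has empty interior. -/
lemma not_eventually_not_isUnit {C : ℝ}
    (hB : ∀ w, ‖⟪w, B w⟫_ℂ‖ ≤ 1 / 2 * ‖w‖ ^ 2 + C * ‖J w‖ ^ 2) (hB' : IsFiniteRankLimit B)
    (z : ℂ) : ¬ ∀ᶠ ζ in 𝓝 z, ¬ IsUnit (formPencil J B ζ) := by
  have hindex : ∀ ζ : ℂ, ζ.im ≠ 0 → IsFredholmIndexZero (formMap J B - ζ • (adjoint J ∘L J)) := by
    intro ζ hζ
    change IsFredholmIndexZero (formPencil J B ζ)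
    rw [formPencil_eq_add]
    exact (IsUnit.isFredholmIndexZero (isUnit_formPencil_zero hζ)).add hB'
  set S : Set ℂ := {ζ | ∀ᶠ ξ in 𝓝 ζ, ¬ IsUnit (formPencil J B ξ)} with hS
  have hSo : IsOpen S := isOpen_setOfPred_eventually_nhds
  -- Inside a connected set off the real axis, `S` is open, and relatively closed by the local
  -- alternative. If it met `U`, it would contain `U`, including a point far to the left, where the
  -- pencil is invertible.
  have key : ∀ U : Set ℂ, IsPreconnected U → (∀ ζ ∈ U, ζ.im ≠ 0) →
      (∃ ζ ∈ U, ζ.re ≤ -(C + 1)) → U ∩ S = ∅ := by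
    rintro U hU him ⟨ζ₁, hζ₁, hre⟩
    by_contra hne
    have hsub : U ⊆ S := by
      refine hU.subset_of_closure_inter_subset hSo (Set.nonempty_iff_ne_empty.2 hne) ?_
      rintro ζ ⟨hcl, hζ⟩
      rcases (hindex ζ (him ζ hζ)).eventually_or with h | h
      · exact h
      · exfalso
        by_cases hζS : ζ ∈ S
        · obtain ⟨ξ, h1, h2⟩ := (h.and (nhdsWithin_le_nhds (show ∀ᶠ ξ in 𝓝 ζ, _ from hζS))).exists
          exact h2 h1
        · rw [eventually_nhdsWithin_iff, eventually_iff, mem_nhds_iff] at h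
          obtain ⟨O, hO, hOo, hζO⟩ := h
          obtain ⟨ξ, hξO, hξS⟩ := mem_closure_iff.1 hcl O hOo hζO
          have hne : ξ ≠ ζ := fun h0 => hζS (h0 ▸ hξS)
          exact (show ∀ᶠ x in 𝓝 ξ, ¬ IsUnit (formPencil J B x) from hξS).self_of_nhds (hO hξO hne)
    exact (show ∀ᶠ x in 𝓝 ζ₁, ¬ IsUnit (formPencil J B x) from hsub hζ₁).self_of_nhds
      (isUnit_formPencil hB hre)
  have hup := key {ζ | 0 < ζ.im} (convex_halfSpace_im_gt 0).isPreconnected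
    (fun ζ hζ => (show 0 < ζ.im from hζ).ne') ⟨⟨-(C + 1), 1⟩, by simp, le_rfl⟩
  have hlo := key {ζ | ζ.im < 0} (convex_halfSpace_im_lt 0).isPreconnected
    (fun ζ hζ => (show ζ.im < 0 from hζ).ne) ⟨⟨-(C + 1), -1⟩, by simp, le_rfl⟩
  intro hz
  -- The open set `S` would now be contained in the real line, so a small vertical displacement
  -- gives a contradiction.
  obtain ⟨ε, hε, hball⟩ := Metric.isOpen_iff.1 hSo z hz
  have hmem : ∀ t : ℝ, |t| < ε → z + t * Complex.I ∈ S := fun t ht => hball (by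
    simpa [Metric.mem_ball, dist_eq_norm] using ht)
  have hnot : ∀ ζ ∈ S, ζ.im = 0 := by
    intro ζ hζ
    by_contra h0
    rcases lt_or_gt_of_ne h0 with h | h
    · exact Set.eq_empty_iff_forall_notMem.1 hlo ζ ⟨h, hζ⟩
    · exact Set.eq_empty_iff_forall_notMem.1 hup ζ ⟨h, hζ⟩
  have h1 := hnot _ (hmem 0 (by simpa using hε))
  have h2 := hnot _ (hmem (ε / 2) (by rw [abs_of_pos (by positivity)]; linarith))
  simp at h1 h2
  rw [h1] at h2
  simp at h2
  exact hε.ne' h2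

namespace IsFormOperator

/-- Isolation comes from the local alternative, and J sends a null vector of the pencil to an
eigenvector. In the contour integral of the resolvent the holomorphic part drops out by Cauchy's
theorem; what remains has its range in the sum of the ranges of the finite-rank operators J Fᵢ. -/
lemma isDiscreteEigenvalue (hT : IsFormOperator T J B) (hJ : Function.Injective J) {C : ℝ}
    (hB : ∀ w, ‖⟪w, B w⟫_ℂ‖ ≤ 1 / 2 * ‖w‖ ^ 2 + C * ‖J w‖ ^ 2) (hB' : IsFiniteRankLimit B)
    (hz : z ∈ spectrum T) (hF : IsFredholmIndexZero (formPencil J B z)) :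
    IsDiscreteEigenvalue T z := by
  have hn : ¬ IsUnit (formPencil J B z) := fun h => hz ⟨_, hT.isResolvent h⟩
  have hi : ∀ᶠ ζ in 𝓝[≠] z, IsUnit (formMap J B - ζ • (adjoint J ∘L J)) :=
    (IsFredholmIndexZero.eventually_or hF).resolve_left (not_eventually_not_isUnit hB hB' z)
  obtain ⟨w, hw, hw0⟩ := IsFredholmIndexZero.exists_ker hF hn
  obtain ⟨u, hu, huw⟩ := hT.ker_le_comap hw0
  obtain ⟨r, ι, _, F, Φ, Ψ, hr, hFr, hΦ, hΨ, hinv⟩ := IsFredholmIndexZero.exists_inverse_eq hF hi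
  refine ⟨⟨u, fun h0 => hw (hJ ?_), sub_eq_zero.1 hu⟩, r, hr, ?_, ?_⟩
  · rw [← huw, h0, map_zero]
  · refine Set.Subset.antisymm (fun ζ hζ => ?_) (Set.singleton_subset_iff.2
      ⟨hz, Metric.mem_closedBall_self hr.le⟩)
    by_contra hne
    exact hζ.1 ⟨_, hT.isResolvent (hinv ζ hζ.2 hne).1⟩
  · have hres : ∀ ζ ∈ Metric.sphere z r, resolvent T ζ =
        J ∘L Φ ζ ∘L adjoint J + ∑ i, (J ∘L F i) ∘L (Ψ i ζ ∘L adjoint J) := by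
      intro ζ hζ
      have hne : ζ ≠ z := by
        rintro rfl
        rw [mem_sphere_iff_norm, sub_self, norm_zero] at hζ
        exact hr.ne hζ
      obtain ⟨h1, h2⟩ := hinv ζ (Metric.sphere_subset_closedBall hζ) hne
      rw [(hT.isResolvent h1).resolvent_eq, formPencil, h2]
      ext f
      simp [map_sum]
    let Λ : (W →L[ℂ] W) →L[ℂ] (H →L[ℂ] W) := (compL ℂ H W W).flip (adjoint J)
    have hΛ : ∀ X, Λ X = X ∘L adjoint J := fun _ => rfl
    have hc1 : ContinuousOn (fun ζ => J ∘L Φ ζ ∘L adjoint J) (Metric.closedBall z r) :=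
      (compL ℂ H W H J).continuous.comp_continuousOn (Λ.continuous.comp_continuousOn hΦ.continuousOn)
    have hc2 : ∀ i, ContinuousOn (fun ζ => Ψ i ζ ∘L adjoint J) (Metric.sphere z r) := fun i =>
      Λ.continuous.comp_continuousOn (hΨ i)
    have hc3 : ∀ i, ContinuousOn (fun ζ => (J ∘L F i) ∘L (Ψ i ζ ∘L adjoint J))
        (Metric.sphere z r) := fun i =>
      (compL ℂ H W H (J ∘L F i)).continuous.comp_continuousOn (hc2 i)
    have h0 : ∮ ζ in C(z, r), J ∘L Φ ζ ∘L adjoint J = 0 := by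
      refine Complex.circleIntegral_eq_zero_of_differentiable_on_off_countable hr.le
        Set.countable_empty hc1 fun ζ hζ => ?_
      have h1 : DifferentiableAt ℂ Φ ζ :=
        hΦ.differentiableAt (Metric.closedBall_mem_nhds_of_mem hζ.1)
      exact ((compL ℂ H W H J).differentiableAt).comp ζ (Λ.differentiableAt.comp ζ h1)
    have hint : ∮ ζ in C(z, r), resolvent T ζ =
        ∑ i, (J ∘L F i) ∘L ∮ ζ in C(z, r), (Ψ i ζ ∘L adjoint J) := by
      rw [circleIntegral.integral_congr hr.le hres, circleIntegral.integral_add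
        ((hc1.mono Metric.sphere_subset_closedBall).circleIntegrable hr.le)
        ((continuousOn_finsetSum _ fun i _ => hc3 i).circleIntegrable hr.le), h0, zero_add,
        circleIntegral.integral_fun_sum fun i _ => (hc3 i).circleIntegrable hr.le]
      exact Finset.sum_congr rfl fun i _ =>
        circleIntegral_clm_apply (compL ℂ H W H (J ∘L F i)) ((hc2 i).circleIntegrable hr.le)
    have hfin : ∀ i, FiniteDimensional ℂ (LinearMap.range ((J ∘L F i : W →L[ℂ] H) : W →ₗ[ℂ] H)) :=
      fun i => (Submodule.fg_iff_finiteDimensional _).1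
        ((hFr i).comp_left (J : W →ₗ[ℂ] H))
    refine Submodule.finiteDimensional_of_le
      (S₂ := ⨆ i, LinearMap.range ((J ∘L F i : W →L[ℂ] H) : W →ₗ[ℂ] H)) ?_
    rintro _ ⟨f, rfl⟩
    rw [rieszProjection, hint]
    change -((2 * Real.pi * Complex.I : ℂ)⁻¹ •
      (∑ i, (J ∘L F i) ∘L ∮ ζ in C(z, r), (Ψ i ζ ∘L adjoint J)) f) ∈ _
    refine Submodule.neg_mem _ (Submodule.smul_mem _ _ ?_)
    rw [sum_apply]
    exact Submodule.sum_mem _ fun i _ => Submodule.mem_iSup_of_mem i ⟨_, rfl⟩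

/-- The spectrum of the perturbed operator consists of the essential spectrum of the unperturbed
operator and of isolated eigenvalues of finite algebraic multiplicity. -/
lemma spectrum_eq (hT : IsFormOperator T J B) (hT₀ : IsFormOperator T₀ J 0)
    (hJ : Function.Injective J) {C : ℝ}
    (hB : ∀ w, ‖⟪w, B w⟫_ℂ‖ ≤ 1 / 2 * ‖w‖ ^ 2 + C * ‖J w‖ ^ 2) (hB' : IsFiniteRankLimit B) :
    spectrum T = essentialSpectrum T₀ ∪ discreteSpectrum T := by
  have hunit : IsUnit (formPencil J B (-(C + 1) : ℝ)) := isUnit_formPencil hB le_rfl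
  refine Set.Subset.antisymm (fun z hz => ?_) (Set.union_subset (fun z hz hres => ?_) ?_)
  · by_cases h : IsFredholmAt T₀ z
    · right
      refine hT.isDiscreteEigenvalue hJ hB hB' hz ?_
      rw [formPencil_eq_add]
      exact (hT₀.isFredholmIndexZero hJ h).add hB'
    · exact Or.inl h
  -- A point of the resolvent set of T makes the perturbed pencil invertible; subtracting B leaves
  -- the unperturbed pencil invertible up to finite rank.
  · refine hz (hT₀.isFredholmAt ?_)
    have h1 := IsUnit.isFredholmIndexZero (hT.isUnit_of_mem_resolventSet hJ hunit hres)
    have h2 := h1.add hB'.neg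
    rwa [formPencil_eq_add, add_neg_cancel_right] at h2
  · rintro z ⟨-, r, hr, hsp, -⟩
    exact (hsp.symm ▸ Set.mem_singleton z : z ∈ spectrum T ∩ Metric.closedBall z r).1

end IsFormOperator

end FormSpectrum

/-! ### The Sobolev space as a Hilbert space -/

section Sobolev

open Filter Topology ContinuousLinearMap

/-- The product of `n + 1` copies of `L²(ℍⁿ)`, for a function and the components of its gradient. -/
abbrev JetSpace (n : ℕ) [NeZero n] := PiLp 2 fun _ : Option (Fin n) => L2 n

variable {n : ℕ} [NeZero n]

/-- Pairs of a function in `H¹(ℍⁿ)` and its weak gradient. -/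
def sobolevGraph (n : ℕ) [NeZero n] : Submodule ℂ (JetSpace n) where
  carrier := {w | IsWeakGrad (w none) fun i => w (some i)}
  zero_mem' := isWeakGrad_zero
  add_mem' := fun hu hv => hu.add hv
  smul_mem' := fun c _ hu => hu.smul c

/-- The factor z₀ⁿ cancels the hyperbolic density, so Euclidean integration against a continuous
function with compact support in the half space is a bounded functional on L²(ℍⁿ). This gives
closedness of the weak gradient and the functionals in the compactness argument. -/
lemma integral_smul_eq_inner {ψ : EuclideanSpace ℝ (Fin n) → ℝ} (hψ : Continuous ψ)
    (hc : HasCompactSupport ψ) (hU : tsupport ψ ⊆ upperHalfSpace n) :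
    ∃ v : L2 n, ∀ u : L2 n, ∫ z in upperHalfSpace n, ψ z • u z = ⟪v, u⟫_ℂ := by
  have hsub : tsupport (fun z : EuclideanSpace ℝ (Fin n) => (z 0) ^ n * ψ z) ⊆ tsupport ψ :=
    closure_minimal (fun z hz => subset_tsupport ψ (right_ne_zero_of_mul hz)) (isClosed_tsupport ψ)
  have hm := memLp_of_compact (n := n) (ψ := fun z => (z 0) ^ n * ψ z) (by fun_prop)
    (hc.of_isClosed_subset (isClosed_tsupport _) hsub) (hsub.trans hU)
  refine ⟨hm.toLp _, fun u => ?_⟩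
  rw [L2.inner_def, integral_hypMeasure]
  refine integral_congr_ae ?_
  filter_upwards [restrict_absolutelyContinuous.ae_le hm.coeFn_toLp,
    ae_restrict_mem isOpen_upperHalfSpace.measurableSet] with z hz hzU
  have h0 : (z 0 : ℂ) ≠ 0 := by exact_mod_cast (ne_of_gt (show 0 < z 0 from hzU))
  rw [hz]
  simp only [RCLike.inner_apply, Complex.conj_ofReal, Complex.real_smul]
  push_cast
  field_simp

/-- Each test function imposes an equality between two continuous functionals. -/
lemma isClosed_sobolevGraph : IsClosed (sobolevGraph n : Set (JetSpace n)) := by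
  have : (sobolevGraph n : Set (JetSpace n)) =
      ⋂ (i : Fin n) (φ : EuclideanSpace ℝ (Fin n) → ℝ) (_ : IsTest n φ),
        {w : JetSpace n | ∫ z in upperHalfSpace n,
          (fderiv ℝ φ z (EuclideanSpace.single i 1)) • (w none) z =
            - ∫ z in upperHalfSpace n, (φ z / z 0) • (w (some i)) z} := by
    ext w
    simp only [Set.mem_iInter]
    rfl
  rw [this]
  refine isClosed_iInter fun i => isClosed_iInter fun φ => isClosed_iInter fun hφ => ?_
  have hφ0 : ∀ z, z ∉ upperHalfSpace n → φ z = 0 := fun z hz =>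
    image_eq_zero_of_notMem_tsupport fun hc => hz (hφ.2.2 hc)
  obtain ⟨v₁, hv₁⟩ := integral_smul_eq_inner (n := n)
    (ψ := fun z => fderiv ℝ φ z (EuclideanSpace.single i 1))
    ((hφ.1.continuous_fderiv (by simp)).clm_apply continuous_const)
    (hφ.2.1.fderiv_apply ℝ _)
    (((tsupport_fderiv_apply_subset ℝ _)).trans hφ.2.2)
  have hsub : tsupport (fun z : EuclideanSpace ℝ (Fin n) => φ z / z 0) ⊆ tsupport φ :=
    closure_minimal (fun z hz => subset_tsupport φ (left_ne_zero_of_mul hz)) (isClosed_tsupport φ)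
  have hcont : Continuous fun z : EuclideanSpace ℝ (Fin n) => φ z / z 0 := by
    refine continuous_iff_continuousAt.2 fun z => ?_
    by_cases hz : z ∈ tsupport φ
    · exact ContinuousAt.div hφ.1.continuous.continuousAt (by fun_prop) (ne_of_gt (hφ.2.2 hz))
    · refine (continuousAt_const (y := (0 : ℝ))).congr ?_
      filter_upwards [(isClosed_tsupport φ).isOpen_compl.mem_nhds hz] with y hy
      rw [image_eq_zero_of_notMem_tsupport hy, zero_div]
  obtain ⟨v₂, hv₂⟩ := integral_smul_eq_inner (n := n) hcont
    (hφ.2.1.of_isClosed_subset (isClosed_tsupport _) hsub) (hsub.trans hφ.2.2)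
  simp only [hv₁, hv₂]
  exact isClosed_eq (by fun_prop) (by fun_prop)

instance : CompleteSpace (sobolevGraph n) := isClosed_sobolevGraph.completeSpace_coe

/-- The embedding of the Sobolev space in `L²(ℍⁿ)`. -/
def sobolevEmbedding (n : ℕ) [NeZero n] : sobolevGraph n →L[ℂ] L2 n :=
  (PiLp.proj 2 (fun _ : Option (Fin n) => L2 n) none : JetSpace n →L[ℂ] L2 n) ∘L
    (sobolevGraph n).subtypeL

/-- The components of the gradient. -/
def sobolevGrad (w : sobolevGraph n) : Fin n → L2 n := fun i => (w : JetSpace n) (some i)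

lemma isWeakGrad_sobolevGrad (w : sobolevGraph n) :
    IsWeakGrad (sobolevEmbedding n w) (sobolevGrad w) := w.2

lemma exists_sobolevGraph {u : L2 n} {g : Fin n → L2 n} (h : IsWeakGrad u g) :
    ∃ w : sobolevGraph n, sobolevEmbedding n w = u ∧ sobolevGrad w = g :=
  ⟨⟨WithLp.toLp 2 fun o => o.elim u g, h⟩, rfl, rfl⟩

lemma sobolev_inner (v w : sobolevGraph n) :
    ⟪v, w⟫_ℂ = ⟪sobolevEmbedding n v, sobolevEmbedding n w⟫_ℂ +
      ∑ i, ⟪sobolevGrad v i, sobolevGrad w i⟫_ℂ := by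
  rw [Submodule.coe_inner, PiLp.inner_apply, Fintype.sum_option]
  rfl

lemma sobolev_norm_sq (w : sobolevGraph n) :
    ‖w‖ ^ 2 = ‖sobolevEmbedding n w‖ ^ 2 + ∑ i, ‖sobolevGrad w i‖ ^ 2 := by
  rw [Submodule.coe_norm, PiLp.norm_sq_eq_of_L2, Fintype.sum_option]
  rfl

lemma norm_sobolevEmbedding_le (w : sobolevGraph n) : ‖sobolevEmbedding n w‖ ≤ ‖w‖ := by
  refine le_of_sq_le_sq ?_ (norm_nonneg w)
  rw [sobolev_norm_sq w]
  have : 0 ≤ ∑ i, ‖sobolevGrad w i‖ ^ 2 := Finset.sum_nonneg fun i _ => by positivity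
  linarith

lemma norm_sobolevGrad_le (w : sobolevGraph n) (i : Fin n) : ‖sobolevGrad w i‖ ≤ ‖w‖ := by
  refine le_of_sq_le_sq ?_ (norm_nonneg w)
  rw [sobolev_norm_sq w]
  have := Finset.single_le_sum (f := fun i => ‖sobolevGrad w i‖ ^ 2)
    (fun i _ => by positivity) (Finset.mem_univ i)
  nlinarith [sq_nonneg ‖sobolevEmbedding n w‖]

lemma sobolevEmbedding_injective : Function.Injective (sobolevEmbedding n) := by
  refine (injective_iff_map_eq_zero _).2 fun w hw => ?_
  have h1 := isWeakGrad_sobolevGrad w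
  rw [hw] at h1
  have h2 := h1.eq_zero
  have h3 := sobolev_norm_sq w
  rw [hw, h2] at h3
  simpa using h3

lemma mem_H1_iff {u : L2 n} : u ∈ H1 n ↔ ∃ w, sobolevEmbedding n w = u := by
  constructor
  · rintro ⟨g, hg⟩
    obtain ⟨w, h1, -⟩ := exists_sobolevGraph hg
    exact ⟨w, h1⟩
  · rintro ⟨w, rfl⟩
    exact ⟨_, isWeakGrad_sobolevGrad w⟩

lemma schrodinger_domain_le (V : EuclideanSpace ℝ (Fin n) → ℂ) :
    (schrodinger n V).domain ≤ H1 n := by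
  intro u hu
  have h := LinearPMap.mem_graph (schrodinger n V) ⟨u, hu⟩
  rw [schrodinger_graph] at h
  obtain ⟨g, hg, -⟩ := h
  exact ⟨g, hg⟩

/-- `Δ + V` is the operator generated by the form, in the abstract sense. -/
lemma isFormOperator_schrodinger {V : EuclideanSpace ℝ (Fin n) → ℂ}
    {B : sobolevGraph n →L[ℂ] sobolevGraph n}
    (hint : ∀ w v : sobolevGraph n, Integrable
      (fun z => V z * sobolevEmbedding n w z * conj (sobolevEmbedding n v z)) (hypMeasure n))
    (hB : ∀ w v : sobolevGraph n, ⟪v, B w⟫_ℂ =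
      ∫ z, V z * sobolevEmbedding n w z * conj (sobolevEmbedding n v z) ∂(hypMeasure n)) :
    IsFormOperator (schrodinger n V) (sobolevEmbedding n) B := by
  have key : ∀ v w : sobolevGraph n, ⟪v, formMap (sobolevEmbedding n) B w⟫_ℂ =
      ∑ i, ⟪sobolevGrad v i, sobolevGrad w i⟫_ℂ +
      ∫ z, V z * sobolevEmbedding n w z * conj (sobolevEmbedding n v z) ∂(hypMeasure n) := by
    intro v w
    change ⟪v, w + B w - adjoint (sobolevEmbedding n) (sobolevEmbedding n w)⟫_ℂ = _
    rw [inner_sub_right, inner_add_right, adjoint_inner_right, hB, sobolev_inner]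
    ring
  intro u f
  rw [schrodinger_graph]
  constructor
  · rintro ⟨g, hg, h⟩
    obtain ⟨w, h1, h2⟩ := exists_sobolevGraph hg
    simp only at h1
    refine ⟨w, h1, ext_inner_left ℂ fun v => ?_⟩
    rw [key, adjoint_inner_right, h1, h2]
    exact (h _ _ (isWeakGrad_sobolevGrad v)).2
  · rintro ⟨w, rfl, h⟩
    refine ⟨sobolevGrad w, isWeakGrad_sobolevGrad w, fun v g hv => ?_⟩
    obtain ⟨v', rfl, rfl⟩ := exists_sobolevGraph hv
    refine ⟨hint w v', ?_⟩
    rw [← key, h, adjoint_inner_right]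

/-- The operator on the form domain that represents the form of the potential. -/
lemma exists_potential_operator {V : EuclideanSpace ℝ (Fin n) → ℂ} {C : ℝ}
    (hint : ∀ w v : sobolevGraph n, Integrable
      (fun z => V z * sobolevEmbedding n w z * conj (sobolevEmbedding n v z)) (hypMeasure n))
    (hC : ∀ w v : sobolevGraph n,
      ‖∫ z, V z * sobolevEmbedding n w z * conj (sobolevEmbedding n v z) ∂(hypMeasure n)‖ ≤
        C * ‖v‖ * ‖w‖) :
    ∃ B : sobolevGraph n →L[ℂ] sobolevGraph n, ∀ w v : sobolevGraph n, ⟪v, B w⟫_ℂ =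
      ∫ z, V z * sobolevEmbedding n w z * conj (sobolevEmbedding n v z) ∂(hypMeasure n) := by
  let b : sobolevGraph n →ₗ⋆[ℂ] sobolevGraph n →ₗ[ℂ] ℂ :=
    LinearMap.mk₂'ₛₗ (starRingEnd ℂ) (RingHom.id ℂ) (fun v w =>
      ∫ z, V z * sobolevEmbedding n w z * conj (sobolevEmbedding n v z) ∂(hypMeasure n))
      (fun v v' w => by
        rw [← integral_add (hint _ _) (hint _ _), map_add]
        refine integral_congr_ae ?_
        filter_upwards [Lp.coeFn_add (sobolevEmbedding n v) (sobolevEmbedding n v')] with z hz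
        rw [hz, Pi.add_apply, map_add]
        ring)
      (fun c v w => by
        rw [smul_eq_mul, ← integral_const_mul, map_smul]
        refine integral_congr_ae ?_
        filter_upwards [Lp.coeFn_smul c (sobolevEmbedding n v)] with z hz
        rw [hz, Pi.smul_apply, smul_eq_mul, map_mul]
        ring)
      (fun v w w' => by
        rw [← integral_add (hint _ _) (hint _ _), map_add]
        refine integral_congr_ae ?_
        filter_upwards [Lp.coeFn_add (sobolevEmbedding n w) (sobolevEmbedding n w')] with z hz
        rw [hz, Pi.add_apply]
        ring)
      (fun c v w => by
        rw [RingHom.id_apply, smul_eq_mul, ← integral_const_mul, map_smul]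
        refine integral_congr_ae ?_
        filter_upwards [Lp.coeFn_smul c (sobolevEmbedding n w)] with z hz
        rw [hz, Pi.smul_apply, smul_eq_mul]
        ring)
  let b' : sobolevGraph n →L⋆[ℂ] sobolevGraph n →L[ℂ] ℂ :=
    LinearMap.mkContinuous₂ b C fun v w => hC w v
  -- The Riesz operator of `b'` acts in the first slot of the inner product; its adjoint acts in the
  -- second.
  refine ⟨adjoint (InnerProductSpace.continuousLinearMapOfBilin b'), fun w v => ?_⟩
  rw [adjoint_inner_right, InnerProductSpace.continuousLinearMapOfBilin_apply]
  rfl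

end Sobolev

/-! ### Cut-off functions on hyperbolic space -/

section Cutoff

open Filter Topology

variable {n : ℕ} [NeZero n]

/-- The hyperbolic ball around `(1, 0)` of radius `arcosh R`. -/
def hypBall (n : ℕ) [NeZero n] (R : ℝ) : Set (EuclideanSpace ℝ (Fin n)) :=
  {z | 1 + ‖z‖ ^ 2 ≤ 2 * R * z 0}

omit [NeZero n] in
lemma coord_le_norm (z : EuclideanSpace ℝ (Fin n)) (i : Fin n) : |z i| ≤ ‖z‖ := by
  simpa using PiLp.norm_apply_le z i

lemma pos_of_mem_hypBall {R : ℝ} (hR : 0 < R) {z : EuclideanSpace ℝ (Fin n)}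
    (hz : z ∈ hypBall n R) : 0 < z 0 := by
  have h : 1 + ‖z‖ ^ 2 ≤ 2 * R * z 0 := hz
  by_contra h0
  nlinarith [sq_nonneg ‖z‖, mul_nonneg hR.le (sub_nonneg.2 (not_lt.1 h0))]

lemma norm_le_of_mem_hypBall {R : ℝ} (hR : 0 < R) {z : EuclideanSpace ℝ (Fin n)}
    (hz : z ∈ hypBall n R) : ‖z‖ ≤ 2 * R := by
  have h : 1 + ‖z‖ ^ 2 ≤ 2 * R * z 0 := hz
  have h1 := (le_abs_self _).trans (coord_le_norm z 0)
  have h2 : ‖z‖ * ‖z‖ ≤ 2 * R * ‖z‖ := by nlinarith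
  rcases (norm_nonneg z).eq_or_lt with h0 | h0
  · rw [← h0]
    positivity
  · exact le_of_mul_le_mul_right h2 h0

lemma isCompact_hypBall {R : ℝ} (hR : 0 < R) : IsCompact (hypBall n R) := by
  refine Metric.isCompact_of_isClosed_isBounded (isClosed_le (by fun_prop) (by fun_prop)) ?_
  refine (Metric.isBounded_closedBall (x := 0) (r := 2 * R)).subset fun z hz => ?_
  simpa using norm_le_of_mem_hypBall hR hz

lemma hypBall_subset {R : ℝ} (hR : 0 < R) : hypBall n R ⊆ upperHalfSpace n :=
  fun _ hz => pos_of_mem_hypBall hR hz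

/-- The hyperbolic cosine of the hyperbolic distance to `(1, 0)`. -/
def coshDist (z : EuclideanSpace ℝ (Fin n)) : ℝ := (1 + ‖z‖ ^ 2) / (2 * z 0)

lemma coshDist_le_iff {R : ℝ} {z : EuclideanSpace ℝ (Fin n)} (hz : z ∈ upperHalfSpace n) :
    coshDist z ≤ R ↔ z ∈ hypBall n R := by
  have h0 : 0 < z 0 := hz
  rw [coshDist, div_le_iff₀ (by positivity), hypBall, Set.mem_ofPred_eq,
    show R * (2 * z 0) = 2 * R * z 0 by ring]

open Classical in
/-- A smooth cut-off of the function `z₀ ^ (1 - n / 2)`. -/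
def weightedCutoff (n : ℕ) [NeZero n] (R : ℝ) (z : EuclideanSpace ℝ (Fin n)) : ℝ :=
  if 0 < z 0 then Real.smoothTransition (2 - coshDist z / R) * (z 0) ^ (1 - (n : ℝ) / 2) else 0

lemma weightedCutoff_of_mem {R : ℝ} (hR : 0 < R) {z : EuclideanSpace ℝ (Fin n)}
    (hz : z ∈ hypBall n R) : weightedCutoff n R z = (z 0) ^ (1 - (n : ℝ) / 2) := by
  have h0 := pos_of_mem_hypBall hR hz
  have h1 := (coshDist_le_iff h0).2 hz
  rw [weightedCutoff, if_pos h0, Real.smoothTransition.one_of_one_le, one_mul]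
  have : coshDist z / R ≤ 1 := (div_le_one hR).2 h1
  linarith

lemma support_weightedCutoff_subset {R : ℝ} (hR : 0 < R) :
    Function.support (weightedCutoff n R) ⊆ hypBall n (2 * R) := by
  intro z hz
  by_cases h0 : 0 < z 0
  · rw [Function.mem_support, weightedCutoff, if_pos h0] at hz
    have h1 : Real.smoothTransition (2 - coshDist z / R) ≠ 0 := left_ne_zero_of_mul hz
    have h2 : 0 < 2 - coshDist z / R := by
      by_contra h
      exact h1 (Real.smoothTransition.zero_of_nonpos (not_lt.1 h))
    rw [← coshDist_le_iff h0]
    have h3 : coshDist z / R ≤ 2 := by linarith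
    rwa [div_le_iff₀ hR] at h3
  · exact absurd (if_neg h0) hz

lemma tsupport_weightedCutoff_subset {R : ℝ} (hR : 0 < R) :
    tsupport (weightedCutoff n R) ⊆ hypBall n (2 * R) :=
  closure_minimal (support_weightedCutoff_subset hR) (isCompact_hypBall (by positivity)).isClosed

lemma weightedCutoff_eventuallyEq {R : ℝ} {z : EuclideanSpace ℝ (Fin n)}
    (hz : z ∈ upperHalfSpace n) : weightedCutoff n R =ᶠ[𝓝 z] fun z =>
      Real.smoothTransition (2 - coshDist z / R) * (z 0) ^ (1 - (n : ℝ) / 2) := by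
  filter_upwards [isOpen_upperHalfSpace.mem_nhds hz] with y hy
  exact if_pos hy

lemma hasFDerivAt_coord (z : EuclideanSpace ℝ (Fin n)) :
    HasFDerivAt (fun z : EuclideanSpace ℝ (Fin n) => z 0)
      (EuclideanSpace.proj 0 : EuclideanSpace ℝ (Fin n) →L[ℝ] ℝ) z :=
  (EuclideanSpace.proj 0 : EuclideanSpace ℝ (Fin n) →L[ℝ] ℝ).hasFDerivAt

lemma isTest_weightedCutoff {R : ℝ} (hR : 0 < R) : IsTest n (weightedCutoff n R) := by
  have h1 := tsupport_weightedCutoff_subset (n := n) hR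
  have hR2 : 0 < 2 * R := by positivity
  refine ⟨contDiff_iff_contDiffAt.2 fun z => ?_,
    (isCompact_hypBall hR2).of_isClosed_subset (isClosed_tsupport _) h1,
    h1.trans (hypBall_subset hR2)⟩
  by_cases hz : z ∈ tsupport (weightedCutoff n R)
  swap
  · exact contDiffAt_const.congr_of_eventuallyEq (notMem_tsupport_iff_eventuallyEq.1 hz)
  have h0 : 0 < z 0 := pos_of_mem_hypBall hR2 (h1 hz)
  refine ContDiffAt.congr_of_eventuallyEq ?_ (weightedCutoff_eventuallyEq h0)
  have hc : ContDiffAt ℝ ∞ (fun z : EuclideanSpace ℝ (Fin n) => z 0) z :=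
    (EuclideanSpace.proj 0 : EuclideanSpace ℝ (Fin n) →L[ℝ] ℝ).contDiff.contDiffAt
  refine ContDiffAt.mul ?_ (hc.rpow_const_of_ne h0.ne')
  refine Real.smoothTransition.contDiff.contDiffAt.comp z ?_
  refine contDiffAt_const.sub (ContDiffAt.div_const ?_ _)
  exact ContDiffAt.div (contDiffAt_const.add (contDiff_norm_sq ℝ).contDiffAt)
    (contDiffAt_const.mul hc) (by positivity)

/-- The derivative vanishes outside [0, 1] and is continuous. Its vanishing for t < 0 removes the
region where `coshDist` is large compared with the cut-off radius. -/
lemma exists_bound_deriv_smoothTransition : ∃ M : ℝ, 0 ≤ M ∧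
    (∀ t, |deriv Real.smoothTransition t| ≤ M) ∧
      ∀ t, t < 0 → deriv Real.smoothTransition t = 0 := by
  have hneg : ∀ t, t < 0 → deriv Real.smoothTransition t = 0 := fun t ht => by
    have : Real.smoothTransition =ᶠ[𝓝 t] fun _ => 0 := by
      filter_upwards [Iio_mem_nhds ht] with s hs
      exact Real.smoothTransition.zero_of_nonpos (le_of_lt hs)
    rw [this.deriv_eq, deriv_const]
  have hpos : ∀ t, 1 < t → deriv Real.smoothTransition t = 0 := fun t ht => by
    have : Real.smoothTransition =ᶠ[𝓝 t] fun _ => 1 := by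
      filter_upwards [Ioi_mem_nhds ht] with s hs
      exact Real.smoothTransition.one_of_one_le (le_of_lt hs)
    rw [this.deriv_eq, deriv_const]
  have hcont : Continuous (deriv Real.smoothTransition) :=
    (Real.smoothTransition.contDiff (n := 1)).continuous_deriv le_rfl
  obtain ⟨M, hM⟩ := (isCompact_Icc (a := (0 : ℝ)) (b := 1)).exists_bound_of_continuousOn
    hcont.continuousOn
  refine ⟨|M|, abs_nonneg _, fun t => ?_, hneg⟩
  by_cases h0 : t < 0
  · rw [hneg t h0, abs_zero]
    positivity
  by_cases h1 : 1 < t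
  · rw [hpos t h1, abs_zero]
    positivity
  · exact (hM t ⟨not_lt.1 h0, not_lt.1 h1⟩).trans (le_abs_self M)

/-- The factor 1 / z₀ is the hyperbolic scaling: the hyperbolic gradient of `coshDist` is at most 3
`coshDist`. Hence a cut-off in `coshDist / R` has a hyperbolic gradient bounded independently of R.
-/
lemma hasFDerivAt_coshDist {z : EuclideanSpace ℝ (Fin n)} (hz : z ∈ upperHalfSpace n) :
    ∃ L : EuclideanSpace ℝ (Fin n) →L[ℝ] ℝ, HasFDerivAt coshDist L z ∧
      ∀ v, |L v| ≤ 3 * coshDist z / z 0 * ‖v‖ := by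
  have h0 : 0 < z 0 := hz
  have hf : 0 < coshDist z := by
    rw [coshDist]
    positivity
  have h1 : HasFDerivAt (fun z : EuclideanSpace ℝ (Fin n) => 1 + ‖z‖ ^ 2)
      (2 • innerSL ℝ z) z := (hasStrictFDerivAt_norm_sq z).hasFDerivAt.const_add 1
  have h2 := (hasDerivAt_inv (show (2 * z 0) ≠ 0 by positivity)).comp_hasFDerivAt z
    ((hasFDerivAt_coord z).const_mul 2)
  refine ⟨_, h1.mul h2, fun v => ?_⟩
  have hv0 := coord_le_norm v 0
  have hzv := abs_real_inner_le_norm z v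
  -- From ‖z‖² ≤ 2 z₀ `coshDist z` and z₀ ≤ ‖z‖.
  have hzf : ‖z‖ ≤ 2 * coshDist z := by
    have h3 : coshDist z * (2 * z 0) = 1 + ‖z‖ ^ 2 := by
      rw [coshDist, div_mul_cancel₀]
      positivity
    have h4 := (le_abs_self _).trans (coord_le_norm z 0)
    nlinarith [norm_nonneg z, mul_le_mul_of_nonneg_left h4 hf.le]
  have e : ((2 * z 0) ^ 2)⁻¹ * (2 * z 0 * (2 * inner ℝ z v) - (1 + ‖z‖ ^ 2) * (2 * v 0)) =
      (inner ℝ z v - coshDist z * v 0) / z 0 := by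
    rw [coshDist]
    field_simp
  have e' : |(inner ℝ z v - coshDist z * v 0) / z 0| ≤ 3 * coshDist z / z 0 * ‖v‖ := by
    rw [abs_div, abs_of_pos h0, div_mul_eq_mul_div]
    gcongr
    calc |inner ℝ z v - coshDist z * v 0| ≤ |inner ℝ z v| + |coshDist z * v 0| := abs_sub _ _
      _ ≤ ‖z‖ * ‖v‖ + coshDist z * ‖v‖ := by
        rw [abs_mul, abs_of_pos hf]
        gcongr
      _ ≤ 3 * coshDist z * ‖v‖ := by nlinarith [norm_nonneg v]
  rw [← e] at e'
  convert e' using 2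
  simp [innerSL_apply_apply]
  field_simp
  ring

/-- The weighted cut-off functions satisfy bounds that are uniform in the radius. -/
lemma exists_bound_weightedCutoff : ∃ C : ℝ, 0 ≤ C ∧ ∀ R : ℝ, 0 < R →
    ∀ z ∈ upperHalfSpace n, |weightedCutoff n R z / z 0| ≤ C * (z 0) ^ (-((n : ℝ) / 2)) ∧
      ∀ i, |fderiv ℝ (weightedCutoff n R) z (EuclideanSpace.single i 1)| ≤
        C * (z 0) ^ (-((n : ℝ) / 2)) := by
  obtain ⟨M, hM0, hM, hMneg⟩ := exists_bound_deriv_smoothTransition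
  -- The 1 bounds the cut-off itself, 6M the derivative of the cut-off (3 · 2R / R times M), and |1
  -- - n/2| the derivative of the power of z₀.
  refine ⟨1 + 6 * M + |1 - (n : ℝ) / 2|, by positivity, fun R hR z hz => ?_⟩
  have h0 : 0 < z 0 := hz
  set p : ℝ := (z 0) ^ (-((n : ℝ) / 2))
  have hp : 0 < p := Real.rpow_pos_of_pos h0 _
  have hp1 : (z 0) ^ (1 - (n : ℝ) / 2) = z 0 * p := by
    rw [sub_eq_add_neg, Real.rpow_add h0, Real.rpow_one]
  have hs0 := Real.smoothTransition.nonneg (2 - coshDist z / R)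
  have hs1 := Real.smoothTransition.le_one (2 - coshDist z / R)
  refine ⟨?_, fun i => ?_⟩
  · rw [weightedCutoff, if_pos h0, hp1, abs_of_nonneg (by positivity)]
    rw [show Real.smoothTransition (2 - coshDist z / R) * (z 0 * p) / z 0 =
      Real.smoothTransition (2 - coshDist z / R) * p by field_simp]
    gcongr
    have := abs_nonneg (1 - (n : ℝ) / 2)
    linarith
  · obtain ⟨L, hL, hLb⟩ := hasFDerivAt_coshDist hz
    have hsmooth : HasDerivAt Real.smoothTransition
        (deriv Real.smoothTransition (2 - coshDist z / R)) (2 - coshDist z / R) :=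
      ((Real.smoothTransition.contDiff (n := 1)).differentiable one_ne_zero _).hasDerivAt
    have h1 : HasFDerivAt (fun z => Real.smoothTransition (2 - coshDist z / R))
        (deriv Real.smoothTransition (2 - coshDist z / R) • -(R⁻¹ • L)) z :=
      by
        simp only [div_eq_mul_inv] at hsmooth ⊢
        exact hsmooth.comp_hasFDerivAt z ((hL.mul_const R⁻¹).const_sub 2)
    have h2 := (hasFDerivAt_coord z).rpow_const (p := 1 - (n : ℝ) / 2) (Or.inl h0.ne')
    have h3 := (h1.mul h2).congr_of_eventuallyEq (weightedCutoff_eventuallyEq hz)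
    rw [h3.fderiv]
    set e : EuclideanSpace ℝ (Fin n) := EuclideanSpace.single i 1
    have he : ‖e‖ = 1 := by simp [e]
    have he0 : |e 0| ≤ 1 := he ▸ coord_le_norm e 0
    have hLe := hLb e
    rw [he, mul_one] at hLe
    set d := deriv Real.smoothTransition (2 - coshDist z / R) with hd
    -- Where `coshDist z > 2R` the derivative `d` vanishes; elsewhere `coshDist z ≤ 2R` cancels the
    -- 1 / R.
    have hdL : |d| * |L e| / R * z 0 ≤ 6 * M := by
      by_cases hlarge : 2 < coshDist z / R
      · rw [hd, hMneg _ (by linarith)]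
        simp
        positivity
      · have h5 : coshDist z ≤ 2 * R := by
          rwa [not_lt, div_le_iff₀ hR] at hlarge
        calc |d| * |L e| / R * z 0 ≤ M * (3 * (2 * R) / z 0) / R * z 0 := by
              gcongr
              · exact hM _
              · exact hLe.trans (by gcongr)
          _ = 6 * M := by
            field_simp
            ring
    have hrp : (z 0) ^ (1 - (n : ℝ) / 2 - 1) = p := by
      rw [sub_right_comm, sub_self, zero_sub]
    rw [hrp, hp1]
    set s := Real.smoothTransition (2 - coshDist z / R)
    have e1 : (s • ((1 - (n : ℝ) / 2) * p) • (EuclideanSpace.proj 0 :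
        EuclideanSpace ℝ (Fin n) →L[ℝ] ℝ) + (z 0 * p) • d • -(R⁻¹ • L)) e =
        s * ((1 - (n : ℝ) / 2) * p * e 0) + -(z 0 * p * (d * (R⁻¹ * L e))) := by simp
    rw [e1]
    calc |s * ((1 - (n : ℝ) / 2) * p * e 0) + -(z 0 * p * (d * (R⁻¹ * L e)))|
        ≤ s * (|1 - (n : ℝ) / 2| * p * |e 0|) + |d| * |L e| / R * z 0 * p := by
          refine (abs_add_le _ _).trans (add_le_add (le_of_eq ?_) (le_of_eq ?_))
          · rw [abs_mul, abs_mul, abs_mul, abs_of_nonneg hs0, abs_of_pos hp]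
          · rw [abs_neg, abs_mul, abs_mul, abs_mul, abs_mul, abs_of_pos hp, abs_of_pos h0,
              abs_of_pos (inv_pos.2 hR)]
            field_simp
      _ ≤ 1 * (|1 - (n : ℝ) / 2| * p * 1) + 6 * M * p := by gcongr
      _ ≤ (1 + 6 * M + |1 - (n : ℝ) / 2|) * p := by nlinarith

end Cutoff

/-! ### Averages in `L²` -/

section Averages

open Filter Topology
open scoped ENNReal

lemma eLpNorm_two_sq {X F : Type*} [MeasurableSpace X] [NormedAddCommGroup F] (f : X → F)
    (μ : Measure X) : eLpNorm f 2 μ ^ 2 = ∫⁻ x, ‖f x‖ₑ ^ 2 ∂μ := by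
  have := eLpNorm_nnreal_pow_eq_lintegral (f := f) (μ := μ) (p := 2) (by norm_num)
  simpa using this

lemma eLpNorm_two_le_iff {X F : Type*} [MeasurableSpace X] [NormedAddCommGroup F] {f : X → F}
    {μ : Measure X} {D : ℝ≥0∞} : eLpNorm f 2 μ ≤ D ↔ ∫⁻ x, ‖f x‖ₑ ^ 2 ∂μ ≤ D ^ 2 := by
  rw [← eLpNorm_two_sq, ENNReal.pow_le_pow_left_iff (by norm_num)]

/-- Minkowski's inequality for averages in `L²`. -/
lemma eLpNorm_integral_le {X Y F : Type*} [MeasurableSpace X] [MeasurableSpace Y]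
    [NormedAddCommGroup F] [NormedSpace ℝ F] {μ : Measure X} [SFinite μ]
    {ν : Measure Y} [IsProbabilityMeasure ν] {k : X → Y → F}
    (hk : AEStronglyMeasurable (Function.uncurry k) (μ.prod ν)) {D : ℝ≥0∞}
    (hD : ∀ᵐ t ∂ν, eLpNorm (fun x => k x t) 2 μ ≤ D) :
    eLpNorm (fun x => ∫ t, k x t ∂ν) 2 μ ≤ D := by
  rw [eLpNorm_two_le_iff]
  have h1 : ∀ᵐ x ∂μ, AEMeasurable (fun t => ‖k x t‖ₑ) ν := by
    filter_upwards [hk.prodMk_left] with x hx using hx.enorm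
  -- On a probability space the L¹ norm is at most the L² norm; Tonelli then exchanges the
  -- integrals.
  calc ∫⁻ x, ‖∫ t, k x t ∂ν‖ₑ ^ 2 ∂μ ≤ ∫⁻ x, ∫⁻ t, ‖k x t‖ₑ ^ 2 ∂ν ∂μ := by
        refine lintegral_mono_ae ?_
        filter_upwards [hk.prodMk_left] with x hx
        have h2 := eLpNorm_le_eLpNorm_of_exponent_le (p := 1) (q := 2) (by norm_num) hx
        rw [eLpNorm_one_eq_lintegral_enorm] at h2
        rw [← eLpNorm_two_sq]
        gcongr
        exact (enorm_integral_le_lintegral_enorm _).trans h2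
    _ = ∫⁻ t, ∫⁻ x, ‖k x t‖ₑ ^ 2 ∂μ ∂ν :=
        lintegral_lintegral_swap (hk.enorm.pow_const 2)
    _ ≤ ∫⁻ _, D ^ 2 ∂ν := by
        refine lintegral_mono_ae ?_
        filter_upwards [hD] with t ht
        exact eLpNorm_two_le_iff.1 ht
    _ = D ^ 2 := by simp

end Averages

/-! ### Mollification -/

section Mollification

open Filter Topology
open scoped ENNReal Convolution

variable {E : Type*} [NormedAddCommGroup E] [InnerProductSpace ℝ E] [FiniteDimensional ℝ E]
  [MeasurableSpace E] [BorelSpace E]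

/-- Convolution with a normed bump function. -/
def mollify (φ : ContDiffBump (0 : E)) (G : E → ℂ) : E → ℂ :=
  φ.normed volume ⋆[ContinuousLinearMap.lsmul ℝ ℝ, volume] G

/-- The probability measure whose density is a normed bump function. -/
def bumpMeasure (φ : ContDiffBump (0 : E)) : Measure E :=
  volume.withDensity fun t => ENNReal.ofReal (φ.normed volume t)

instance (φ : ContDiffBump (0 : E)) : IsProbabilityMeasure (bumpMeasure φ) := by
  refine ⟨?_⟩
  rw [bumpMeasure, withDensity_apply _ MeasurableSet.univ, Measure.restrict_univ,
    ← ofReal_integral_eq_lintegral_ofReal φ.integrable_normed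
      (Eventually.of_forall fun t => φ.nonneg_normed t), φ.integral_normed, ENNReal.ofReal_one]

lemma integral_bumpMeasure (φ : ContDiffBump (0 : E)) (f : E → ℂ) :
    ∫ t, f t ∂(bumpMeasure φ) = ∫ t, φ.normed volume t • f t := by
  rw [bumpMeasure, integral_withDensity_eq_integral_toReal_smul
    (φ.continuous_normed.measurable.ennreal_ofReal)
    (Eventually.of_forall fun _ => ENNReal.ofReal_lt_top)]
  refine integral_congr_ae (Eventually.of_forall fun t => ?_)
  simp only [ENNReal.toReal_ofReal (φ.nonneg_normed t)]

lemma mollify_eq (φ : ContDiffBump (0 : E)) (G : E → ℂ) (x : E) :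
    mollify φ G x = ∫ t, G (x - t) ∂(bumpMeasure φ) := by
  rw [integral_bumpMeasure]
  rfl

lemma ae_bumpMeasure (φ : ContDiffBump (0 : E)) :
    ∀ᵐ t ∂(bumpMeasure φ), ‖t‖ ≤ φ.rOut := by
  rw [bumpMeasure, ae_withDensity_iff φ.continuous_normed.measurable.ennreal_ofReal]
  refine Eventually.of_forall fun t ht => ?_
  have h1 : t ∈ Function.support (φ.normed volume) := fun h0 => ht (by rw [h0, ENNReal.ofReal_zero])
  rw [φ.support_normed_eq, mem_ball_zero_iff] at h1
  exact h1.le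

lemma eLpNorm_comp_sub (G : E → ℂ) (hG : Measurable G) (p : ℝ≥0∞) (t : E) :
    eLpNorm (fun x => G (x - t)) p volume = eLpNorm G p volume :=
  eLpNorm_comp_measurePreserving hG.aestronglyMeasurable (measurePreserving_sub_right volume t)

/-- Mollification does not increase the `L²` norm. -/
lemma eLpNorm_mollify_le (φ : ContDiffBump (0 : E)) {G : E → ℂ} (hG : Measurable G) :
    eLpNorm (mollify φ G) 2 volume ≤ eLpNorm G 2 volume := by
  have h : mollify φ G = fun x => ∫ t, G (x - t) ∂(bumpMeasure φ) := funext (mollify_eq φ G)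
  rw [h]
  refine eLpNorm_integral_le ?_ (Eventually.of_forall fun t => (eLpNorm_comp_sub G hG 2 t).le)
  exact (hG.comp (measurable_fst.sub measurable_snd)).aestronglyMeasurable

/-- The mollification error is controlled by small translations. -/
lemma eLpNorm_sub_mollify_le (φ : ContDiffBump (0 : E)) {G : E → ℂ} (hG : Measurable G)
    (hGi : Integrable G) {D : ℝ≥0∞}
    (hD : ∀ t, ‖t‖ ≤ φ.rOut → eLpNorm (fun x => G x - G (x - t)) 2 volume ≤ D) :
    eLpNorm (fun x => G x - mollify φ G x) 2 volume ≤ D := by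
  have hint : ∀ x, Integrable (fun t => G (x - t)) (bumpMeasure φ) := fun x => by
    have h1 : Integrable (fun t => G (x - t)) volume := hGi.comp_sub_left x
    obtain ⟨C, hC⟩ := φ.hasCompactSupport_normed (μ := volume).exists_bound_of_continuous
      φ.continuous_normed
    rw [bumpMeasure, integrable_withDensity_iff_integrable_smul'
      φ.continuous_normed.measurable.ennreal_ofReal
      (Eventually.of_forall fun _ => ENNReal.ofReal_lt_top)]
    simp only [ENNReal.toReal_ofReal (φ.nonneg_normed _)]
    simp only [Complex.real_smul]
    exact h1.bdd_mul (c := C)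
      (Complex.continuous_ofReal.comp φ.continuous_normed).aestronglyMeasurable
      (Eventually.of_forall fun t => by simpa using hC t)
  have h : (fun x => G x - mollify φ G x) =
      fun x => ∫ t, (G x - G (x - t)) ∂(bumpMeasure φ) := by
    funext x
    rw [integral_sub (integrable_const _) (hint x), integral_const, mollify_eq]
    simp
  rw [h]
  refine eLpNorm_integral_le ?_ ?_
  · exact ((hG.comp measurable_fst).sub
      (hG.comp (measurable_fst.sub measurable_snd))).aestronglyMeasurable
  · filter_upwards [ae_bumpMeasure φ] with t ht using hD t ht

/-- Translations of continuously differentiable functions in `L²`. -/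
lemma eLpNorm_sub_translate_le {f : E → ℂ} (hf : ContDiff ℝ 1 f) (t : E) :
    eLpNorm (fun x => f x - f (x - t)) 2 volume ≤ ‖t‖ₑ * eLpNorm (fderiv ℝ f) 2 volume := by
  have hc : Continuous (fderiv ℝ f) := hf.continuous_fderiv one_ne_zero
  let ν : Measure ℝ := volume.restrict (Set.Ioc 0 1)
  have hν : IsProbabilityMeasure ν := ⟨by simp [ν]⟩
  -- The fundamental theorem of calculus on the segment from x - t to x writes the difference as an
  -- average over s of derivatives in the direction t.
  have h : (fun x => f x - f (x - t)) =
      fun x => ∫ s, fderiv ℝ f (x - t + s • t) t ∂ν := by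
    funext x
    have h1 : ∀ s ∈ Set.uIcc (0 : ℝ) 1, HasDerivAt (fun s : ℝ => f (x - t + s • t))
        (fderiv ℝ f (x - t + s • t) t) s := fun s _ => by
      have h2 : HasDerivAt (fun s : ℝ => x - t + s • t) t s := by
        simpa using ((hasDerivAt_id s).smul_const t).const_add (x - t)
      exact ((hf.differentiable one_ne_zero _).hasFDerivAt).comp_hasDerivAt s h2
    have h3 := intervalIntegral.integral_eq_sub_of_hasDerivAt h1
      (Continuous.intervalIntegrable (by fun_prop) _ _)
    rw [intervalIntegral.integral_of_le zero_le_one] at h3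
    rw [h3]
    simp
  rw [h]
  refine eLpNorm_integral_le (Continuous.aestronglyMeasurable ?_) (Eventually.of_forall fun s => ?_)
  · exact ((hc.comp (by fun_prop)).clm_apply continuous_const)
  · have h1 : eLpNorm (fun x => fderiv ℝ f (x - t + s • t)) 2 volume =
        eLpNorm (fderiv ℝ f) 2 volume := by
      have := eLpNorm_comp_measurePreserving (p := 2) (hc.aestronglyMeasurable (μ := volume))
        (measurePreserving_add_right volume (-t + s • t))
      rw [← this]
      congr 1
      funext x
      simp [Function.comp, sub_eq_add_neg, add_assoc]
    rw [← h1]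
    refine eLpNorm_le_nnreal_smul_eLpNorm_of_ae_le_mul (c := ‖t‖₊)
      (Eventually.of_forall fun x => ?_) 2
    rw [mul_comm]
    exact ContinuousLinearMap.le_opNNNorm _ _

end Mollification

/-! ### Regularization of Sobolev functions on hyperbolic space -/

section Regularization

open Filter Topology
open scoped ENNReal Convolution

variable {n : ℕ} [NeZero n]

lemma measurable_L2 (u : L2 n) : Measurable (u : EuclideanSpace ℝ (Fin n) → ℂ) :=
  (Lp.stronglyMeasurable u).measurable

/-- Euclidean `L²` bounds in terms of hyperbolic ones. -/
lemma eLpNorm_smul_le {a : EuclideanSpace ℝ (Fin n) → ℝ} {C : ℝ} (hC : 0 ≤ C)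
    (ha : ∀ z ∈ upperHalfSpace n, |a z| ≤ C * (z 0) ^ (-((n : ℝ) / 2)))
    (ha0 : ∀ z ∉ upperHalfSpace n, a z = 0) (u : L2 n) :
    eLpNorm (fun z => a z • u z) 2 volume ≤ ENNReal.ofReal (C * ‖u‖) := by
  rw [eLpNorm_two_le_iff]
  have hu : ENNReal.ofReal ‖u‖ = eLpNorm u 2 (hypMeasure n) := by
    rw [Lp.norm_def, ENNReal.ofReal_toReal (Lp.eLpNorm_ne_top u)]
  have hsq : ∫⁻ z in upperHalfSpace n, ENNReal.ofReal ((z 0) ^ n)⁻¹ * ‖u z‖ₑ ^ 2 =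
      eLpNorm u 2 (hypMeasure n) ^ 2 := by
    rw [eLpNorm_two_sq]
    exact (lintegral_withDensity_eq_lintegral_mul (volume.restrict (upperHalfSpace n))
      (f := fun z : EuclideanSpace ℝ (Fin n) => ENNReal.ofReal ((z 0) ^ n)⁻¹) (by fun_prop)
      ((measurable_L2 u).enorm.pow_const 2)).symm
  calc ∫⁻ z, ‖a z • u z‖ₑ ^ 2 = ∫⁻ z in upperHalfSpace n, ‖a z • u z‖ₑ ^ 2 := by
        rw [← lintegral_indicator isOpen_upperHalfSpace.measurableSet]
        refine lintegral_congr fun z => ?_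
        by_cases hz : z ∈ upperHalfSpace n
        · rw [Set.indicator_of_mem hz]
        · rw [Set.indicator_of_notMem hz, ha0 z hz]
          simp
    _ ≤ ∫⁻ z in upperHalfSpace n,
          ENNReal.ofReal C ^ 2 * (ENNReal.ofReal ((z 0) ^ n)⁻¹ * ‖u z‖ₑ ^ 2) := by
        refine setLIntegral_mono' isOpen_upperHalfSpace.measurableSet fun z hz => ?_
        have h0 : 0 < z 0 := hz
        -- The weight z₀^(-n/2) is the square root of the hyperbolic density.
        have h1 : ENNReal.ofReal ((z 0) ^ n)⁻¹ = ENNReal.ofReal ((z 0) ^ (-((n : ℝ) / 2))) ^ 2 := by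
          rw [← ENNReal.ofReal_pow (by positivity), ← Real.rpow_natCast, ← Real.rpow_natCast,
            ← Real.rpow_mul h0.le, ← Real.rpow_neg h0.le]
          congr 2
          push_cast
          ring
        rw [h1, ← mul_assoc, ← mul_pow, ← mul_pow, enorm_smul, ← ENNReal.ofReal_mul hC,
          Real.enorm_eq_ofReal_abs]
        gcongr
        exact ha z hz
    _ = ENNReal.ofReal (C * ‖u‖) ^ 2 := by
        rw [lintegral_const_mul', hsq, ENNReal.ofReal_mul hC, hu, mul_pow]
        exact ENNReal.pow_ne_top ENNReal.ofReal_ne_top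

/-- The `i`-th Euclidean partial derivative of `θ u`, if `g` is the weak gradient of `u`. -/
def productGrad (θ : EuclideanSpace ℝ (Fin n) → ℝ) (u : L2 n) (g : Fin n → L2 n) (i : Fin n)
    (z : EuclideanSpace ℝ (Fin n)) : ℂ :=
  fderiv ℝ θ z (EuclideanSpace.single i 1) • u z + (θ z / z 0) • g i z

variable {θ : EuclideanSpace ℝ (Fin n) → ℝ} {u : L2 n} {g : Fin n → L2 n}

lemma IsTest.eq_zero (hθ : IsTest n θ) {z : EuclideanSpace ℝ (Fin n)}
    (hz : z ∉ upperHalfSpace n) : θ z = 0 :=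
  image_eq_zero_of_notMem_tsupport fun hc => hz (hθ.2.2 hc)

lemma IsTest.fderiv_eq_zero (hθ : IsTest n θ) {z : EuclideanSpace ℝ (Fin n)}
    (hz : z ∉ upperHalfSpace n) : fderiv ℝ θ z = 0 := by
  by_contra hc
  exact hz (hθ.2.2 (support_fderiv_subset ℝ hc))

lemma IsTest.continuous_fderiv_apply (hθ : IsTest n θ) (v : EuclideanSpace ℝ (Fin n)) :
    Continuous fun z => fderiv ℝ θ z v :=
  (hθ.1.continuous_fderiv (by simp)).clm_apply continuous_const

lemma IsTest.measurable_smul (hθ : IsTest n θ) (u : L2 n) : Measurable fun z => θ z • u z :=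
  hθ.1.continuous.measurable.smul (measurable_L2 u)

lemma IsTest.integrable_smul (hθ : IsTest n θ) (u : L2 n) : Integrable fun z => θ z • u z :=
  integrable_smul_L2 u hθ.1.continuous.continuousOn hθ.2.1 hθ.2.2
    fun _ hz => image_eq_zero_of_notMem_tsupport hz

lemma IsTest.measurable_productGrad (hθ : IsTest n θ) (u : L2 n) (g : Fin n → L2 n) (i : Fin n) :
    Measurable (productGrad θ u g i) := by
  have h0 : Measurable fun z : EuclideanSpace ℝ (Fin n) => z 0 :=
    (by fun_prop : Continuous fun z : EuclideanSpace ℝ (Fin n) => z 0).measurable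
  exact ((hθ.continuous_fderiv_apply _).measurable.smul (measurable_L2 u)).add
    ((hθ.1.continuous.measurable.div h0).smul (measurable_L2 (g i)))

omit [NeZero n] in
lemma mollify_eq_integral (φ : ContDiffBump (0 : EuclideanSpace ℝ (Fin n)))
    (G : EuclideanSpace ℝ (Fin n) → ℂ) (x : EuclideanSpace ℝ (Fin n)) :
    mollify φ G x = ∫ t, φ.normed volume (x - t) • G t := by
  rw [mollify, convolution_eq_swap]
  rfl

lemma isTest_mul_bump (hθ : IsTest n θ) (φ : ContDiffBump (0 : EuclideanSpace ℝ (Fin n)))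
    (x : EuclideanSpace ℝ (Fin n)) : IsTest n fun t => φ.normed volume (x - t) * θ t := by
  have hsub : tsupport (fun t => φ.normed volume (x - t) * θ t) ⊆ tsupport θ :=
    closure_minimal (fun z hz => subset_tsupport θ (right_ne_zero_of_mul hz)) (isClosed_tsupport θ)
  exact ⟨(φ.contDiff_normed.comp (contDiff_const.sub contDiff_id)).mul hθ.1,
    hθ.2.1.of_isClosed_subset (isClosed_tsupport _) hsub, hsub.trans hθ.2.2⟩

omit [NeZero n] in
lemma contDiff_mollify (φ : ContDiffBump (0 : EuclideanSpace ℝ (Fin n)))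
    {w : EuclideanSpace ℝ (Fin n) → ℂ} (hw : Integrable w) : ContDiff ℝ 1 (mollify φ w) :=
  φ.hasCompactSupport_normed.contDiff_convolution_left _ φ.contDiff_normed hw.locallyIntegrable

/-- The derivative of the mollification of `θ u`. -/
lemma fderiv_mollify (hθ : IsTest n θ) (hg : IsWeakGrad u g)
    (φ : ContDiffBump (0 : EuclideanSpace ℝ (Fin n))) (x : EuclideanSpace ℝ (Fin n)) (i : Fin n) :
    fderiv ℝ (mollify φ fun z => θ z • u z) x (EuclideanSpace.single i 1) =
      mollify φ (productGrad θ u g i) x := by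
  set e : EuclideanSpace ℝ (Fin n) := EuclideanSpace.single i 1
  set ψ := φ.normed (volume : Measure (EuclideanSpace ℝ (Fin n)))
  have hψ : ContDiff ℝ 1 ψ := φ.contDiff_normed
  have hw := (hθ.integrable_smul u).locallyIntegrable
  have h1 : fderiv ℝ (mollify φ fun z => θ z • u z) x e =
      ∫ t, fderiv ℝ ψ (x - t) e • (θ t • u t) := by
    have h2 := φ.hasCompactSupport_normed.hasFDerivAt_convolution_right
      (ContinuousLinearMap.lsmul ℝ ℝ : ℝ →L[ℝ] ℂ →L[ℝ] ℂ).flip hw hψ x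
    rw [convolution_flip] at h2
    rw [mollify, h2.fderiv, convolution_precompR_apply _ hw
      (φ.hasCompactSupport_normed.fderiv ℝ) (hψ.continuous_fderiv one_ne_zero)]
    rfl
  have hset : ∀ F : EuclideanSpace ℝ (Fin n) → ℂ, (∀ t ∉ upperHalfSpace n, F t = 0) →
      ∫ t, F t = ∫ t in upperHalfSpace n, F t := fun F hF =>
    (setIntegral_eq_integral_of_forall_compl_eq_zero hF).symm
  -- The weak gradient is tested with ψ (x - ·) θ. The product rule produces the derivative of the
  -- mollifier, with a minus sign from the reflection, and the derivative of θ.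
  have hweak : ∫ z in upperHalfSpace n, (fderiv ℝ (fun t => ψ (x - t) * θ t) z e) • u z =
      -∫ z in upperHalfSpace n, (ψ (x - z) * θ z / z 0) • g i z :=
    hg i _ (isTest_mul_bump hθ φ x)
  have hder : ∀ t, fderiv ℝ (fun t => ψ (x - t) * θ t) t e =
      ψ (x - t) * fderiv ℝ θ t e - fderiv ℝ ψ (x - t) e * θ t := fun t => by
    have h2 : HasFDerivAt (fun t => ψ (x - t)) (-(fderiv ℝ ψ (x - t))) t := by
      have := (hψ.differentiable one_ne_zero (x - t)).hasFDerivAt.comp t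
        ((hasFDerivAt_id t).const_sub x)
      simpa using! this
    have h3 := (hθ.1.differentiable (by simp) t).hasFDerivAt
    have h4 : HasFDerivAt (fun t => ψ (x - t) * θ t) _ t := h2.mul h3
    rw [h4.fderiv]
    simp only [add_apply, smul_apply, neg_apply, smul_eq_mul]
    ring
  have hcψ : Continuous fun t => ψ (x - t) := hψ.continuous.comp (by fun_prop)
  have hcψ' : Continuous fun t => fderiv ℝ ψ (x - t) e :=
    ((hψ.continuous_fderiv one_ne_zero).comp (by fun_prop)).clm_apply continuous_const
  have i1 : Integrable (fun t => (ψ (x - t) * fderiv ℝ θ t e) • u t) volume := by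
    refine integrable_smul_L2 u (hcψ.mul (hθ.continuous_fderiv_apply e)).continuousOn hθ.2.1 hθ.2.2
      fun z hz => ?_
    have : fderiv ℝ θ z = 0 := by
      by_contra hc
      exact hz (support_fderiv_subset ℝ hc)
    simp [this]
  have i2 : Integrable (fun t => (fderiv ℝ ψ (x - t) e * θ t) • u t) volume := by
    refine integrable_smul_L2 u (hcψ'.mul hθ.1.continuous).continuousOn hθ.2.1 hθ.2.2
      fun z hz => ?_
    rw [image_eq_zero_of_notMem_tsupport hz, mul_zero]
  have i3 : Integrable (fun t => (ψ (x - t) * θ t / t 0) • g i t) volume :=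
    integrable_test_right (g i) (isTest_mul_bump hθ φ x)
  simp only [hder, sub_smul] at hweak
  rw [integral_sub i1.integrableOn i2.integrableOn, sub_eq_iff_eq_add, neg_add_eq_sub,
    eq_sub_iff_add_eq, ← integral_add i1.integrableOn i3.integrableOn] at hweak
  rw [h1, mollify_eq_integral, hset _ fun t ht => by rw [hθ.eq_zero ht]; simp,
    hset _ fun t ht => by simp [productGrad, hθ.eq_zero ht, hθ.fderiv_eq_zero ht]]
  simp only [smul_smul]
  rw [← hweak]
  refine integral_congr_ae (Eventually.of_forall fun t => ?_)
  simp only [productGrad, smul_add, smul_smul, mul_div_assoc]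
  rfl

omit [NeZero n] in
lemma norm_clm_le_sum (L : EuclideanSpace ℝ (Fin n) →L[ℝ] ℂ) :
    ‖L‖ ≤ ∑ i, ‖L (EuclideanSpace.single i 1)‖ := by
  refine L.opNorm_le_bound (Finset.sum_nonneg fun _ _ => norm_nonneg _) fun v => ?_
  have hv : v = ∑ i, v i • EuclideanSpace.single i (1 : ℝ) := by
    have := (EuclideanSpace.basisFun (Fin n) ℝ).sum_repr v
    simpa using this.symm
  conv_lhs => rw [hv]
  rw [map_sum, Finset.sum_mul]
  refine norm_sum_le_of_le _ fun i _ => ?_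
  rw [map_smul, norm_smul, mul_comm]
  gcongr
  exact coord_le_norm v i

/-- Partial derivatives of the mollification of θ u are mollifications of `productGrad`, and
mollification is a contraction in L². The bound is independent of the width of the bump. -/
lemma eLpNorm_fderiv_mollify_le (hθ : IsTest n θ) (hg : IsWeakGrad u g)
    (φ : ContDiffBump (0 : EuclideanSpace ℝ (Fin n))) :
    eLpNorm (fderiv ℝ (mollify φ fun z => θ z • u z)) 2 volume ≤
      ∑ i, eLpNorm (productGrad θ u g i) 2 volume := by
  set f := mollify φ fun z => θ z • u z
  have hf : ContDiff ℝ 1 f := contDiff_mollify φ (hθ.integrable_smul u)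
  have hm : ∀ i : Fin n, AEStronglyMeasurable
      (fun x => ‖fderiv ℝ f x (EuclideanSpace.single i 1)‖) volume := fun i =>
    ((hf.continuous_fderiv one_ne_zero).clm_apply continuous_const).norm.aestronglyMeasurable
  calc eLpNorm (fderiv ℝ f) 2 volume
      ≤ eLpNorm (∑ i, fun x => ‖fderiv ℝ f x (EuclideanSpace.single i 1)‖) 2 volume := by
        refine eLpNorm_mono_real fun x => ?_
        rw [Finset.sum_apply]
        exact norm_clm_le_sum _
    _ ≤ ∑ i, eLpNorm (fun x => ‖fderiv ℝ f x (EuclideanSpace.single i 1)‖) 2 volume :=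
        eLpNorm_sum_le (fun i _ => hm i) one_le_two
    _ ≤ ∑ i, eLpNorm (productGrad θ u g i) 2 volume := by
        refine Finset.sum_le_sum fun i _ => ?_
        rw [eLpNorm_norm]
        simp only [f, fderiv_mollify hθ hg]
        exact eLpNorm_mollify_le φ (hθ.measurable_productGrad u g i)

/-- A sequence of bump functions that concentrates at the origin. -/
def bumpSeq (E : Type*) [NormedAddCommGroup E] [InnerProductSpace ℝ E] (k : ℕ) :
    ContDiffBump (0 : E) :=
  ⟨1 / (k + 1), 2 / (k + 1), by positivity, by gcongr; norm_num⟩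

lemma tendsto_bumpSeq_rOut (E : Type*) [NormedAddCommGroup E] [InnerProductSpace ℝ E] :
    Tendsto (fun k => (bumpSeq E k).rOut) atTop (𝓝 0) := by
  have h : Tendsto (fun k : ℕ => 2 * (1 / ((k : ℝ) + 1))) atTop (𝓝 (2 * 0)) :=
    tendsto_one_div_add_atTop_nhds_zero_nat.const_mul 2
  rw [mul_zero] at h
  refine h.congr fun k => ?_
  change 2 * (1 / ((k : ℝ) + 1)) = 2 / (k + 1)
  ring

omit [NeZero n] in
lemma ae_tendsto_mollify {w : EuclideanSpace ℝ (Fin n) → ℂ} (hw : Integrable w) :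
    ∀ᵐ x, Tendsto (fun k => mollify (bumpSeq _ k) w x) atTop (𝓝 (w x)) := by
  refine ContDiffBump.ae_convolution_tendsto_right_of_locallyIntegrable (K := 2)
    (tendsto_bumpSeq_rOut _) (Eventually.of_forall fun k => ?_) hw.locallyIntegrable
  change 2 / ((k : ℝ) + 1) ≤ 2 * (1 / (k + 1))
  rw [mul_one_div]

/-- The Sobolev inequality for `θ u`. -/
lemma eLpNorm_smul_le_productGrad (hn : 3 ≤ n) {q : NNReal}
    (hq : (q : ℝ)⁻¹ = 2⁻¹ - (n : ℝ)⁻¹) (hθ : IsTest n θ) (hg : IsWeakGrad u g) :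
    eLpNorm (fun z => θ z • u z) q volume ≤
      SNormLESNormFDerivOfEqConst ℂ (volume : Measure (EuclideanSpace ℝ (Fin n)))
          ((2 : NNReal) : ℝ) *
        ∑ i, eLpNorm (productGrad θ u g i) 2 volume := by
  have hw := hθ.integrable_smul u
  have hfin : Module.finrank ℝ (EuclideanSpace ℝ (Fin n)) = n := by simp
  -- Mollifications converge almost everywhere, so Fatou's lemma passes the uniform bound for smooth
  -- functions to the limit.
  refine (Lp.eLpNorm_lim_le_liminf_eLpNorm
    (fun k => (contDiff_mollify (bumpSeq _ k) hw).continuous.aestronglyMeasurable) _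
    (ae_tendsto_mollify hw)).trans ?_
  refine liminf_le_of_le (by isBoundedDefault) fun b hb => ?_
  obtain ⟨k, hk⟩ := hb.exists
  refine hk.trans ?_
  have hcs : HasCompactSupport (mollify (bumpSeq _ k) fun z => θ z • u z) :=
    HasCompactSupport.convolution _ (bumpSeq _ k).hasCompactSupport_normed
      (hθ.2.1.smul_right (f' := fun z => u z))
  have h1 := eLpNorm_le_eLpNorm_fderiv_of_eq (F := ℂ)
    (volume : Measure (EuclideanSpace ℝ (Fin n))) (contDiff_mollify (bumpSeq _ k) hw) hcs
    (p := 2) (p' := q) (by norm_num) (by rw [hfin]; omega) (by rw [hfin, hq]; norm_num)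
  refine h1.trans ?_
  gcongr
  exact eLpNorm_fderiv_mollify_le hθ hg _

/-- Translates of `θ u` in `L²`. -/
lemma eLpNorm_smul_sub_translate_le (hθ : IsTest n θ) (hg : IsWeakGrad u g)
    (t : EuclideanSpace ℝ (Fin n)) :
    eLpNorm (fun x => θ x • u x - θ (x - t) • u (x - t)) 2 volume ≤
      ‖t‖ₑ * ∑ i, eLpNorm (productGrad θ u g i) 2 volume := by
  have hw := hθ.integrable_smul u
  have hae := ae_tendsto_mollify hw
  have hae' := (measurePreserving_sub_right volume t).quasiMeasurePreserving.ae hae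
  have hc := fun k => (contDiff_mollify (bumpSeq (EuclideanSpace ℝ (Fin n)) k) hw).continuous
  refine (Lp.eLpNorm_lim_le_liminf_eLpNorm (f := fun k x =>
    mollify (bumpSeq _ k) (fun z => θ z • u z) x -
      mollify (bumpSeq _ k) (fun z => θ z • u z) (x - t)) (fun k => Continuous.aestronglyMeasurable
      ((hc k).sub ((hc k).comp (by fun_prop)))) _ ?_).trans ?_
  · filter_upwards [hae, hae'] with x h1 h2 using h1.sub h2
  refine liminf_le_of_le (by isBoundedDefault) fun b hb => ?_
  obtain ⟨k, hk⟩ := hb.exists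
  refine hk.trans ((eLpNorm_sub_translate_le (contDiff_mollify _ hw) t).trans ?_)
  gcongr
  exact eLpNorm_fderiv_mollify_le hθ hg _

/-- The weighted cut-offs of Sobolev functions are bounded in the Euclidean Sobolev norm. -/
lemma exists_bound_productGrad : ∃ C : ℝ, 0 ≤ C ∧ ∀ R : ℝ, 0 < R → ∀ w : sobolevGraph n,
    ∑ i, eLpNorm (productGrad (weightedCutoff n R) (sobolevEmbedding n w) (sobolevGrad w) i) 2
      volume ≤ ENNReal.ofReal (C * ‖w‖) := by
  obtain ⟨C, hC, h⟩ := exists_bound_weightedCutoff (n := n)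
  refine ⟨n * (2 * C), by positivity, fun R hR w => ?_⟩
  have hθ := isTest_weightedCutoff (n := n) hR
  have h1 : ∀ i, eLpNorm (productGrad (weightedCutoff n R) (sobolevEmbedding n w)
      (sobolevGrad w) i) 2 volume ≤ ENNReal.ofReal (2 * C * ‖w‖) := by
    intro i
    have h0 : Measurable fun z : EuclideanSpace ℝ (Fin n) => z 0 :=
      (by fun_prop : Continuous fun z : EuclideanSpace ℝ (Fin n) => z 0).measurable
    refine (eLpNorm_add_le
      ((hθ.continuous_fderiv_apply _).measurable.smul (measurable_L2 _)).aestronglyMeasurable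
      ((hθ.1.continuous.measurable.div h0).smul (measurable_L2 _)).aestronglyMeasurable
      one_le_two).trans ?_
    have h2 := eLpNorm_smul_le hC (a := fun z =>
      fderiv ℝ (weightedCutoff n R) z (EuclideanSpace.single i 1))
      (fun z hz => (h R hR z hz).2 i) (fun z hz => by simp [hθ.fderiv_eq_zero hz])
      (sobolevEmbedding n w)
    have h3 := eLpNorm_smul_le hC (a := fun z => weightedCutoff n R z / z 0)
      (fun z hz => (h R hR z hz).1) (fun z hz => by simp [hθ.eq_zero hz]) (sobolevGrad w i)
    refine (add_le_add h2 h3).trans ?_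
    rw [← ENNReal.ofReal_add (by positivity) (by positivity)]
    refine ENNReal.ofReal_le_ofReal ?_
    have h4 := mul_le_mul_of_nonneg_left (norm_sobolevEmbedding_le w) hC
    have h5 := mul_le_mul_of_nonneg_left (norm_sobolevGrad_le w i) hC
    linarith
  refine (Finset.sum_le_sum fun i _ => h1 i).trans ?_
  rw [Finset.sum_const, Finset.card_univ, Fintype.card_fin, nsmul_eq_mul,
    mul_assoc (n : ℝ), ENNReal.ofReal_mul (q := 2 * C * ‖w‖) (Nat.cast_nonneg n),
    ENNReal.ofReal_natCast]

end Regularization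

/-! ### The Sobolev inequality and local compactness -/

section Embeddings

open Filter Topology
open scoped ENNReal

variable {n : ℕ} [NeZero n]

lemma setLIntegral_hypMeasure {S : Set (EuclideanSpace ℝ (Fin n))} (hS : MeasurableSet S)
    (hSU : S ⊆ upperHalfSpace n) {f : EuclideanSpace ℝ (Fin n) → ℝ≥0∞} (hf : Measurable f) :
    ∫⁻ z in S, f z ∂(hypMeasure n) = ∫⁻ z in S, ENNReal.ofReal ((z 0) ^ n)⁻¹ * f z := by
  rw [hypMeasure, restrict_withDensity hS, Measure.restrict_restrict hS,
    Set.inter_eq_left.2 hSU]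
  exact lintegral_withDensity_eq_lintegral_mul _ (by fun_prop) hf

lemma ae_mem_upperHalfSpace : ∀ᵐ z ∂(hypMeasure n), z ∈ upperHalfSpace n :=
  hypMeasure_absolutelyContinuous.ae_le (ae_restrict_mem isOpen_upperHalfSpace.measurableSet)

lemma eventually_mem_hypBall {z : EuclideanSpace ℝ (Fin n)} (hz : z ∈ upperHalfSpace n) :
    ∀ᶠ k : ℕ in atTop, z ∈ hypBall n (k + 1) := by
  filter_upwards [eventually_ge_atTop ⌈coshDist z⌉₊] with k hk
  rw [← coshDist_le_iff hz]
  have := (Nat.le_ceil (coshDist z)).trans (Nat.cast_le.2 hk)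
  linarith

/-- The Sobolev inequality on hyperbolic space. -/
lemma exists_sobolev_bound (hn : 3 ≤ n) {q : NNReal} (hq : (q : ℝ)⁻¹ = 2⁻¹ - (n : ℝ)⁻¹) :
    ∃ C : ℝ, 0 ≤ C ∧ ∀ w : sobolevGraph n,
      eLpNorm (sobolevEmbedding n w) q (hypMeasure n) ≤ ENNReal.ofReal (C * ‖w‖) := by
  obtain ⟨C, hC, hbound⟩ := exists_bound_productGrad (n := n)
  set S : NNReal := SNormLESNormFDerivOfEqConst ℂ
    (volume : Measure (EuclideanSpace ℝ (Fin n))) ((2 : NNReal) : ℝ)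
  have hn' : (3 : ℝ) ≤ n := by exact_mod_cast hn
  have hqinv : 0 < (q : ℝ)⁻¹ := by
    rw [hq, sub_pos]
    exact inv_strictAnti₀ (by norm_num) (by linarith)
  have hq0 : 0 < (q : ℝ) := inv_pos.1 hqinv
  -- This identity explains the weight: the q-th power of z₀^(1 - n/2) is the hyperbolic density
  -- z₀^(-n), so on the ball the Euclidean Lq norm of the weighted function is the hyperbolic Lq
  -- norm of u.
  have hexp : (1 - (n : ℝ) / 2) * q = -n := by
    have h1 : (q : ℝ) * (2⁻¹ - (n : ℝ)⁻¹) = 1 := by rw [← hq, mul_inv_cancel₀ hq0.ne']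
    field_simp at h1 ⊢
    linarith
  refine ⟨S * C, by positivity, fun w => ?_⟩
  have hball : ∀ R : ℝ, 0 < R →
      eLpNorm (sobolevEmbedding n w) q ((hypMeasure n).restrict (hypBall n R)) ≤
        ENNReal.ofReal (S * C * ‖w‖) := by
    intro R hR
    have hθ := isTest_weightedCutoff (n := n) hR
    have hq0' : q ≠ 0 := by exact_mod_cast hq0.ne'
    have hSm := (isCompact_hypBall (n := n) hR).measurableSet
    have hle : eLpNorm (sobolevEmbedding n w) q ((hypMeasure n).restrict (hypBall n R)) ≤
        eLpNorm (fun z => weightedCutoff n R z • sobolevEmbedding n w z) q volume := by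
      rw [← ENNReal.rpow_le_rpow_iff hq0, eLpNorm_nnreal_pow_eq_lintegral hq0',
        eLpNorm_nnreal_pow_eq_lintegral hq0', setLIntegral_hypMeasure hSm (hypBall_subset hR)
          ((measurable_L2 _).enorm.pow_const _)]
      refine le_trans ?_ (setLIntegral_le_lintegral (hypBall n R) _)
      refine setLIntegral_mono' hSm fun z hz => le_of_eq ?_
      have h0 := pos_of_mem_hypBall hR hz
      rw [enorm_smul, ENNReal.mul_rpow_of_nonneg _ _ hq0.le, weightedCutoff_of_mem hR hz,
        Real.enorm_eq_ofReal (by positivity), ENNReal.ofReal_rpow_of_pos (by positivity),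
        ← Real.rpow_mul h0.le, hexp, Real.rpow_neg h0.le, Real.rpow_natCast]
    refine hle.trans ((eLpNorm_smul_le_productGrad hn hq hθ
      (isWeakGrad_sobolevGrad w)).trans ?_)
    rw [mul_assoc, ENNReal.ofReal_mul S.coe_nonneg, ENNReal.ofReal_coe_nnreal]
    exact mul_le_mul' le_rfl (hbound R hR w)
  -- The bound does not depend on the radius; the balls exhaust the half space, and Fatou's lemma
  -- applies.
  refine (Lp.eLpNorm_lim_le_liminf_eLpNorm
    (f := fun k : ℕ => (hypBall n (k + 1)).indicator (sobolevEmbedding n w)) (fun k => ?_) _ ?_).trans ?_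
  · exact ((measurable_L2 _).indicator
      (isCompact_hypBall (by positivity)).measurableSet).aestronglyMeasurable
  · filter_upwards [ae_mem_upperHalfSpace] with z hz
    refine tendsto_const_nhds.congr' ?_
    filter_upwards [eventually_mem_hypBall hz] with k hk
    rw [Set.indicator_of_mem hk]
  · refine liminf_le_of_le (by isBoundedDefault) fun b hb => ?_
    obtain ⟨k, hk⟩ := hb.exists
    refine hk.trans ?_
    rw [eLpNorm_indicator_eq_eLpNorm_restrict (isCompact_hypBall (by positivity)).measurableSet]
    exact hball _ (by positivity)

/-- The `L²` norm over a hyperbolic ball. -/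
def localNorm (R : ℝ) (u : L2 n) : ℝ :=
  (eLpNorm u 2 ((hypMeasure n).restrict (hypBall n R))).toReal

lemma eLpNorm_restrict_hypBall_le (R : ℝ) (u : L2 n) :
    eLpNorm u 2 ((hypMeasure n).restrict (hypBall n R)) ≤ ENNReal.ofReal ‖u‖ := by
  rw [Lp.norm_def, ENNReal.ofReal_toReal (Lp.eLpNorm_ne_top u)]
  exact MeasureTheory.eLpNorm_restrict_le _ _ _ _

lemma eLpNorm_restrict_eq (R : ℝ) (u : L2 n) :
    eLpNorm u 2 ((hypMeasure n).restrict (hypBall n R)) = ENNReal.ofReal (localNorm R u) := by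
  rw [localNorm, ENNReal.ofReal_toReal]
  exact ((eLpNorm_restrict_hypBall_le R u).trans_lt ENNReal.ofReal_lt_top).ne

lemma localNorm_le (R : ℝ) (u : L2 n) : localNorm R u ≤ ‖u‖ :=
  ENNReal.toReal_le_of_le_ofReal (norm_nonneg u) (eLpNorm_restrict_hypBall_le R u)

lemma localNorm_nonneg (R : ℝ) (u : L2 n) : 0 ≤ localNorm R u := ENNReal.toReal_nonneg

/-- The mollification of `θ u` is controlled, uniformly on compact sets, by finitely many
functionals. -/
lemma exists_functionals_mollify {θ : EuclideanSpace ℝ (Fin n) → ℝ} (hθ : IsTest n θ)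
    (φ : ContDiffBump (0 : EuclideanSpace ℝ (Fin n))) {S : Set (EuclideanSpace ℝ (Fin n))}
    (hS : IsCompact S) {ε : ℝ} (hε : 0 < ε) :
    ∃ (m : ℕ) (ℓ : Fin m → L2 n →L[ℂ] ℂ), ∀ (u : L2 n), ∀ x ∈ S,
      ‖mollify φ (fun z => θ z • u z) x‖ ≤ ε * ‖u‖ + ∑ j, ‖ℓ j u‖ := by
  -- Pairing |θ| with |u| bounds the Euclidean L¹ norm of θ u by the hyperbolic L² norm of u.
  obtain ⟨C, hC, hint⟩ : ∃ C : ℝ, 0 ≤ C ∧ ∀ u : L2 n, ∫ z, ‖θ z • u z‖ ≤ C * ‖u‖ := by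
    have hsub : tsupport (fun z => |θ z|) ⊆ tsupport θ :=
      closure_minimal (fun z hz => subset_tsupport θ (abs_ne_zero.1 hz)) (isClosed_tsupport θ)
    obtain ⟨v, hv⟩ := integral_smul_eq_inner (n := n) (ψ := fun z => |θ z|)
      hθ.1.continuous.abs (hθ.2.1.of_isClosed_subset (isClosed_tsupport _) hsub)
      (hsub.trans hθ.2.2)
    refine ⟨‖v‖, norm_nonneg v, fun u => ?_⟩
    have hm : MemLp (fun z => ((‖u z‖ : ℝ) : ℂ)) 2 (hypMeasure n) := (Lp.memLp u).norm.ofReal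
    have h1 := hv (hm.toLp _)
    have h2 : ‖hm.toLp _‖ = ‖u‖ := by
      rw [Lp.norm_toLp, Lp.norm_def]
      congr 1
      exact eLpNorm_congr_norm_ae (Eventually.of_forall fun z => by simp)
    have h3 : ∫ z in upperHalfSpace n, |θ z| • hm.toLp _ z =
        ((∫ z, ‖θ z • u z‖ : ℝ) : ℂ) := by
      rw [← integral_complex_ofReal, ← setIntegral_eq_integral_of_forall_compl_eq_zero
        (s := upperHalfSpace n) (f := fun z => ((‖θ z • u z‖ : ℝ) : ℂ))
        fun z hz => by rw [hθ.eq_zero hz]; simp]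
      refine integral_congr_ae ?_
      filter_upwards [restrict_absolutelyContinuous.ae_le hm.coeFn_toLp] with z hz
      rw [hz, norm_smul, Real.norm_eq_abs, Complex.real_smul]
      push_cast
      rfl
    rw [h3] at h1
    calc ∫ z, ‖θ z • u z‖ ≤ ‖((∫ z, ‖θ z • u z‖ : ℝ) : ℂ)‖ := by
          rw [Complex.norm_real]
          exact Real.le_norm_self _
      _ ≤ ‖v‖ * ‖hm.toLp _‖ := by
          rw [h1]
          exact norm_inner_le_norm _ _
      _ = ‖v‖ * ‖u‖ := by rw [h2]
  have huc : UniformContinuous (φ.normed (volume : Measure (EuclideanSpace ℝ (Fin n)))) :=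
    φ.hasCompactSupport_normed.uniformContinuous_of_continuous φ.continuous_normed
  -- Moving x by less than `δ` changes the mollification by at most ε ‖u‖, so evaluations at the
  -- centres of a finite cover of `S` suffice as functionals. The `+ 1` allows C = 0.
  obtain ⟨δ, hδ, hδε⟩ := Metric.uniformContinuous_iff.1 huc (ε / (C + 1)) (by positivity)
  obtain ⟨t, -, htf, hcov⟩ := hS.finite_cover_balls hδ
  have hfun : ∀ x, ∃ v : L2 n, ∀ u : L2 n, mollify φ (fun z => θ z • u z) x = ⟪v, u⟫_ℂ := by
    intro x
    have hT := isTest_mul_bump hθ φ x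
    obtain ⟨v, hv⟩ := integral_smul_eq_inner (n := n) hT.1.continuous hT.2.1 hT.2.2
    refine ⟨v, fun u => ?_⟩
    rw [← hv, mollify_eq_integral, setIntegral_eq_integral_of_forall_compl_eq_zero
      fun z hz => by rw [hT.eq_zero hz, zero_smul]]
    simp only [smul_smul]
  choose v hv using hfun
  have e := htf.toFinset.equivFin
  refine ⟨_, fun j => innerSL ℂ (v (e.symm j)), fun u x hx => ?_⟩
  obtain ⟨y, hy, hxy⟩ := Set.mem_iUnion₂.1 (hcov hx)
  have hlip : ‖mollify φ (fun z => θ z • u z) x - mollify φ (fun z => θ z • u z) y‖ ≤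
      ε * ‖u‖ := by
    have hi : ∀ x, Integrable fun t => φ.normed volume (x - t) • (θ t • u t) := fun x => by
      simpa only [smul_smul] using (isTest_mul_bump hθ φ x).integrable_smul u
    rw [mollify_eq_integral, mollify_eq_integral, ← integral_sub (hi x) (hi y)]
    refine (norm_integral_le_of_norm_le (g := fun z => ε / (C + 1) * ‖θ z • u z‖)
      ((hθ.integrable_smul u).norm.const_mul _) (Eventually.of_forall fun z => ?_)).trans ?_
    · rw [← sub_smul, norm_smul]
      gcongr
      rw [← dist_eq_norm]
      refine (hδε ?_).le
      rw [dist_sub_right]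
      exact hxy
    · rw [integral_const_mul]
      calc ε / (C + 1) * ∫ z, ‖θ z • u z‖ ≤ ε / (C + 1) * (C * ‖u‖) := by
            gcongr
            exact hint u
        _ = C / (C + 1) * (ε * ‖u‖) := by ring
        _ ≤ 1 * (ε * ‖u‖) := by
            gcongr
            rw [div_le_one (by positivity)]
            linarith
        _ = ε * ‖u‖ := one_mul _
  have hy' : y ∈ htf.toFinset := htf.mem_toFinset.2 hy
  have h1 : ‖mollify φ (fun z => θ z • u z) y‖ ≤ ∑ j, ‖innerSL ℂ (v (e.symm j)) u‖ := by
    have h2 := Finset.single_le_sum (f := fun j => ‖innerSL ℂ (v (e.symm j)) u‖)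
      (fun j _ => norm_nonneg _) (Finset.mem_univ (e ⟨y, hy'⟩))
    simp only [Equiv.symm_apply_apply, innerSL_apply_apply, ← hv] at h2
    simpa only [innerSL_apply_apply, ← hv] using h2
  calc ‖mollify φ (fun z => θ z • u z) x‖
      ≤ ‖mollify φ (fun z => θ z • u z) x - mollify φ (fun z => θ z • u z) y‖ +
        ‖mollify φ (fun z => θ z • u z) y‖ := by
        simpa using norm_add_le (mollify φ (fun z => θ z • u z) x -
          mollify φ (fun z => θ z • u z) y) (mollify φ (fun z => θ z • u z) y)
    _ ≤ _ := add_le_add hlip h1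

/-- On the ball 2 R z₀ ≥ 1, so the hyperbolic density z₀^(-n) is at most (2R)² z₀^(2 - n), which is
(2R)² times the square of the weight. -/
lemma eLpNorm_restrict_le_weightedCutoff {R : ℝ} (hR : 0 < R) (u : L2 n) :
    eLpNorm u 2 ((hypMeasure n).restrict (hypBall n R)) ≤ ENNReal.ofReal (2 * R) *
      eLpNorm (fun z => weightedCutoff n R z • u z) 2 (volume.restrict (hypBall n R)) := by
  have hSm := (isCompact_hypBall (n := n) hR).measurableSet
  rw [eLpNorm_two_le_iff, mul_pow, eLpNorm_two_sq, setLIntegral_hypMeasure hSm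
    (hypBall_subset hR) ((measurable_L2 u).enorm.pow_const 2),
    ← lintegral_const_mul' _ _ (ENNReal.pow_ne_top ENNReal.ofReal_ne_top)]
  refine setLIntegral_mono' hSm fun z hz => ?_
  have h0 := pos_of_mem_hypBall hR hz
  have hz' : 1 + ‖z‖ ^ 2 ≤ 2 * R * z 0 := hz
  rw [weightedCutoff_of_mem hR hz, enorm_smul, mul_pow, ← mul_assoc,
    Real.enorm_eq_ofReal (by positivity), ← ENNReal.ofReal_pow (by positivity),
    ← ENNReal.ofReal_pow (by positivity), ← ENNReal.ofReal_mul (by positivity)]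
  gcongr
  have h1 : ((z 0) ^ (1 - (n : ℝ) / 2)) ^ 2 = (z 0) ^ 2 * ((z 0) ^ n)⁻¹ := by
    rw [← Real.rpow_natCast, ← Real.rpow_mul h0.le, ← Real.rpow_natCast, ← Real.rpow_natCast,
      ← Real.rpow_neg h0.le, ← Real.rpow_add h0]
    congr 1
    push_cast
    ring
  rw [h1, ← mul_assoc, ← mul_pow]
  have h2 : 1 ≤ 2 * R * z 0 := by nlinarith [sq_nonneg ‖z‖]
  have h3 : 0 ≤ ((z 0) ^ n)⁻¹ := by positivity
  nlinarith [one_le_pow₀ h2 (n := 2)]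

/-- Local compactness of the embedding of the Sobolev space in `L²(ℍⁿ)`. -/
lemma exists_functionals_localNorm {R ε : ℝ} (hR : 0 < R) (hε : 0 < ε) :
    ∃ (m : ℕ) (ℓ : Fin m → sobolevGraph n →L[ℂ] ℂ) (C : ℝ), 0 ≤ C ∧ ∀ w : sobolevGraph n,
      localNorm R (sobolevEmbedding n w) ≤ ε * ‖w‖ + C * ∑ j, ‖ℓ j w‖ := by
  obtain ⟨C₀, hC₀, hbound⟩ := exists_bound_productGrad (n := n)
  have hθ := isTest_weightedCutoff (n := n) hR
  have hK := isCompact_hypBall (n := n) hR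
  set A : ℝ := ((volume.restrict (hypBall n R) Set.univ) ^ ((2 : ℝ≥0∞).toReal)⁻¹).toReal
  have hA : 0 ≤ A := ENNReal.toReal_nonneg
  have hA' : (volume.restrict (hypBall n R) Set.univ) ^ ((2 : ℝ≥0∞).toReal)⁻¹ =
      ENNReal.ofReal A := by
    rw [ENNReal.ofReal_toReal]
    refine ENNReal.rpow_ne_top_of_nonneg (by simp) ?_
    rw [Measure.restrict_apply_univ]
    exact hK.measure_lt_top.ne
  -- The width of the bump is chosen so that replacing θ u by its mollification costs at most half
  -- of ε; the tolerance of the functionals below uses the other half.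
  obtain ⟨k, hk⟩ : ∃ k, (bumpSeq (EuclideanSpace ℝ (Fin n)) k).rOut <
      ε / (2 * (2 * R * (C₀ + 1))) :=
    ((tendsto_bumpSeq_rOut (EuclideanSpace ℝ (Fin n))).eventually_lt_const
      (by positivity)).exists
  set φ := bumpSeq (EuclideanSpace ℝ (Fin n)) k
  obtain ⟨m, ℓ, hℓ⟩ := exists_functionals_mollify hθ φ hK
    (ε := ε / (2 * (2 * R * (A + 1)))) (by positivity)
  refine ⟨m, fun j => (ℓ j).comp (sobolevEmbedding n), 2 * R * A, by positivity, fun w => ?_⟩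
  set u := sobolevEmbedding n w
  set f : EuclideanSpace ℝ (Fin n) → ℂ := fun z => weightedCutoff n R z • u z
  have hf := hθ.integrable_smul u
  have hr := φ.rOut_pos.le
  have h1 : eLpNorm (fun z => f z - mollify φ f z) 2 (volume.restrict (hypBall n R)) ≤
      ENNReal.ofReal (φ.rOut * (C₀ * ‖w‖)) := by
    refine (MeasureTheory.eLpNorm_restrict_le _ _ _ _).trans
      (eLpNorm_sub_mollify_le φ (hθ.measurable_smul u) hf fun t ht => ?_)
    refine (eLpNorm_smul_sub_translate_le hθ (isWeakGrad_sobolevGrad w) t).trans ?_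
    rw [ENNReal.ofReal_mul hr]
    refine mul_le_mul' ?_ (hbound R hR w)
    rw [← ofReal_norm]
    exact ENNReal.ofReal_le_ofReal ht
  set s : ℝ := ε / (2 * (2 * R * (A + 1))) * ‖u‖ + ∑ j, ‖ℓ j u‖ with hs
  have h2 : eLpNorm (mollify φ f) 2 (volume.restrict (hypBall n R)) ≤ ENNReal.ofReal (A * s) := by
    rw [ENNReal.ofReal_mul hA, ← hA']
    refine eLpNorm_le_of_ae_bound ?_
    filter_upwards [ae_restrict_mem hK.measurableSet] with x hx using hℓ u x hx
  have hs0 : 0 ≤ s := add_nonneg (by positivity) (Finset.sum_nonneg fun _ _ => norm_nonneg _)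
  have h3 : eLpNorm f 2 (volume.restrict (hypBall n R)) ≤
      ENNReal.ofReal (φ.rOut * (C₀ * ‖w‖) + A * s) := by
    rw [ENNReal.ofReal_add (by positivity) (by positivity)]
    have hcm := (contDiff_mollify φ hf).continuous
    have h4 := eLpNorm_add_le (μ := volume.restrict (hypBall n R)) (p := 2)
      (f := fun z => f z - mollify φ f z) (g := mollify φ f)
      ((hθ.measurable_smul u).sub hcm.measurable).aestronglyMeasurable
      hcm.aestronglyMeasurable one_le_two
    have h5 : (fun z => f z - mollify φ f z) + mollify φ f = f := by
      funext z
      simp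
    rw [h5] at h4
    exact h4.trans (add_le_add h1 h2)
  have h6 : localNorm R u ≤ 2 * R * (φ.rOut * (C₀ * ‖w‖) + A * s) := by
    refine ENNReal.toReal_le_of_le_ofReal (by positivity) ?_
    rw [ENNReal.ofReal_mul (by positivity)]
    exact (eLpNorm_restrict_le_weightedCutoff hR u).trans (by gcongr)
  refine h6.trans ?_
  have hw := norm_sobolevEmbedding_le w
  have h7 : 2 * R * (φ.rOut * (C₀ * ‖w‖)) ≤ ε / 2 * ‖w‖ := by
    calc 2 * R * (φ.rOut * (C₀ * ‖w‖))
        ≤ 2 * R * (ε / (2 * (2 * R * (C₀ + 1))) * ((C₀ + 1) * ‖w‖)) := by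
          gcongr
          linarith
      _ = ε / 2 * ‖w‖ := by field_simp
  have h8 : 2 * R * (A * (ε / (2 * (2 * R * (A + 1))) * ‖u‖)) ≤ ε / 2 * ‖w‖ := by
    calc 2 * R * (A * (ε / (2 * (2 * R * (A + 1))) * ‖u‖))
        ≤ 2 * R * ((A + 1) * (ε / (2 * (2 * R * (A + 1))) * ‖w‖)) := by
          gcongr
          linarith
      _ = ε / 2 * ‖w‖ := by field_simp
  rw [hs]
  change _ ≤ ε * ‖w‖ + 2 * R * A * ∑ j, ‖ℓ j u‖
  nlinarith

end Embeddings

/-! ### The form of the potential -/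

section Potential

open Filter Topology
open scoped ENNReal

lemma lintegral_enorm_mul_enorm_le {α : Type*} [MeasurableSpace α] {μ : Measure α} {u v : α → ℂ}
    (hu : Measurable u) (hv : Measurable v) :
    ∫⁻ z, ‖u z‖ₑ * ‖v z‖ₑ ∂μ ≤ eLpNorm u 2 μ * eLpNorm v 2 μ := by
  have h := ENNReal.lintegral_mul_le_Lp_mul_Lq μ Real.HolderConjugate.two_two
    hu.enorm.aemeasurable hv.enorm.aemeasurable
  rw [eLpNorm_eq_lintegral_rpow_enorm_toReal two_ne_zero ENNReal.ofNat_ne_top,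
    eLpNorm_eq_lintegral_rpow_enorm_toReal two_ne_zero ENNReal.ofNat_ne_top]
  simpa using h

/-- Hölder's inequality for three functions. -/
lemma lintegral_mul_enorm_mul_enorm_le {α : Type*} [MeasurableSpace α] {μ : Measure α}
    {u v : α → ℂ} (hu : Measurable u) (hv : Measurable v) {s : α → ℝ≥0∞} (hs : Measurable s)
    {r : ℝ} {q : NNReal} (hrq : r.HolderConjugate (q / 2)) :
    ∫⁻ z, s z * (‖u z‖ₑ * ‖v z‖ₑ) ∂μ ≤
      (∫⁻ z, s z ^ r ∂μ) ^ (1 / r) * (eLpNorm u q μ * eLpNorm v q μ) := by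
  have hq : 0 < (q : ℝ) / 2 := hrq.symm.pos
  have hq0 : (q : ℝ) ≠ 0 := by
    intro h
    simp [h] at hq
  have hq0' : q ≠ 0 := by exact_mod_cast hq0
  refine (ENNReal.lintegral_mul_le_Lp_mul_Lq μ hrq hs.aemeasurable
    (hu.enorm.mul hv.enorm).aemeasurable).trans (mul_le_mul' le_rfl ?_)
  have h := ENNReal.lintegral_mul_le_Lp_mul_Lq μ Real.HolderConjugate.two_two
    (hu.enorm.pow_const ((q : ℝ) / 2)).aemeasurable (hv.enorm.pow_const ((q : ℝ) / 2)).aemeasurable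
  simp only [Pi.mul_apply, ← ENNReal.rpow_mul, div_mul_cancel₀ (q : ℝ) two_ne_zero,
    ← ENNReal.mul_rpow_of_nonneg _ _ hq.le] at h
  rw [eLpNorm_nnreal_eq_lintegral hq0', eLpNorm_nnreal_eq_lintegral hq0']
  refine (ENNReal.rpow_le_rpow h (by positivity)).trans (le_of_eq ?_)
  rw [ENNReal.mul_rpow_of_nonneg _ _ (by positivity), ← ENNReal.rpow_mul, ← ENNReal.rpow_mul]
  congr 2 <;> field_simp

variable {n : ℕ} [NeZero n]

/-- A potential in `Lᵖ` is the sum of a small bounded function, of a function that is small in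
`Lʳ`, and of a bounded function that vanishes outside a ball, for every `r ≤ p`. -/
lemma exists_potential_splitting {V : EuclideanSpace ℝ (Fin n) → ℂ} {r p : ℝ} (hr : 0 < r)
    (hrp : r ≤ p) (hV : MemLp V (ENNReal.ofReal p) (hypMeasure n)) {ε δ : ℝ} (hε : 0 < ε)
    (hδ : 0 < δ) :
    ∃ (R M : ℝ) (s : EuclideanSpace ℝ (Fin n) → ℝ≥0∞), 0 < R ∧ 0 ≤ M ∧ Measurable s ∧
      (∫⁻ z, s z ^ r ∂(hypMeasure n)) ^ (1 / r) ≤ ENNReal.ofReal δ ∧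
      ∀ᵐ z ∂(hypMeasure n), ‖V z‖ₑ ≤
        ENNReal.ofReal ε + s z + (hypBall n R).indicator (fun _ => ENNReal.ofReal M) z := by
  have hp : 0 < p := hr.trans_le hrp
  set g : EuclideanSpace ℝ (Fin n) → ℝ≥0∞ := fun z => ‖hV.1.mk V z‖ₑ
  have hg : Measurable g := hV.1.stronglyMeasurable_mk.measurable.enorm
  have hgV : ∀ᵐ z ∂(hypMeasure n), ‖V z‖ₑ = g z := by
    filter_upwards [hV.1.ae_eq_mk] with z hz
    rw [hz]
  have hfin : ∫⁻ z, g z ^ p ∂(hypMeasure n) ≠ ⊤ := by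
    have h := lintegral_rpow_enorm_lt_top_of_eLpNorm_lt_top
      (by simpa using hp) ENNReal.ofReal_ne_top hV.2
    rw [ENNReal.toReal_ofReal hp.le] at h
    rw [lintegral_congr_ae (hgV.mono fun z hz => congrArg (· ^ p) hz)] at h
    exact h.ne
  have hgt : ∀ z, g z ≠ ⊤ := fun z => enorm_ne_top
  -- `A k` is where V is neither small nor both bounded by k and inside the ball. It is eventually
  -- left by almost every point, so V restricted to it becomes small in Lʳ.
  set A : ℕ → Set (EuclideanSpace ℝ (Fin n)) := fun k =>
    {z | ENNReal.ofReal ε < g z} ∩ ({z | g z ≤ k} ∩ hypBall n (k + 1))ᶜ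
  have hA : ∀ k, MeasurableSet (A k) := fun k =>
    (measurableSet_lt measurable_const hg).inter
      ((measurableSet_le hg measurable_const).inter
        (isCompact_hypBall (by positivity)).measurableSet).compl
  have hlim : Tendsto (fun k => ∫⁻ z, (A k).indicator g z ^ r ∂(hypMeasure n)) atTop (𝓝 0) := by
    rw [← lintegral_zero (μ := hypMeasure n)]
    -- On `A k` one has g > ε, and since r ≤ p this gives gʳ ≤ ε^(r - p) gᵖ: an integrable bound,
    -- even though V need not lie in Lʳ.
    refine tendsto_lintegral_of_dominated_convergence
      (fun z => ENNReal.ofReal ε ^ (r - p) * g z ^ p)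
      (fun k => (hg.indicator (hA k)).pow_const r) (fun k => Eventually.of_forall fun z => ?_) ?_ ?_
    · beta_reduce
      by_cases hz : z ∈ A k
      · rw [Set.indicator_of_mem hz]
        have hz1 : ENNReal.ofReal ε < g z := hz.1
        have h0 : g z ≠ 0 := (zero_le.trans_lt hz1).ne'
        calc g z ^ r = g z ^ (r - p) * g z ^ p := by
              rw [← ENNReal.rpow_add _ _ h0 (hgt z), sub_add_cancel]
          _ ≤ _ := by
              gcongr ?_ * _
              rw [← neg_sub, ENNReal.rpow_neg, ENNReal.rpow_neg, ENNReal.inv_le_inv]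
              exact ENNReal.rpow_le_rpow hz1.le (by linarith)
      · rw [Set.indicator_of_notMem hz, ENNReal.zero_rpow_of_pos hr]
        exact zero_le
    · rw [lintegral_const_mul _ (hg.pow_const p)]
      refine ENNReal.mul_ne_top ?_ hfin
      rw [ENNReal.ofReal_rpow_of_pos hε]
      exact ENNReal.ofReal_ne_top
    · filter_upwards [ae_mem_upperHalfSpace] with z hz
      refine tendsto_const_nhds.congr' ?_
      obtain ⟨k₀, hk₀⟩ := ENNReal.exists_nat_gt (hgt z)
      filter_upwards [eventually_mem_hypBall hz, eventually_ge_atTop k₀] with k hk hkk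
      rw [Set.indicator_of_notMem, ENNReal.zero_rpow_of_pos hr]
      exact fun hc => hc.2 ⟨hk₀.le.trans (by exact_mod_cast hkk), hk⟩
  obtain ⟨k, hk⟩ := (hlim.eventually_le_const
    (ENNReal.rpow_pos (ENNReal.ofReal_pos.2 hδ) ENNReal.ofReal_ne_top : 0 <
      ENNReal.ofReal δ ^ r)).exists
  refine ⟨k + 1, k, (A k).indicator g, by positivity, by positivity, hg.indicator (hA k), ?_, ?_⟩
  · refine (ENNReal.rpow_le_rpow hk (by positivity)).trans (le_of_eq ?_)
    rw [← ENNReal.rpow_mul, mul_one_div_cancel hr.ne', ENNReal.rpow_one]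
  · filter_upwards [hgV] with z hz
    rw [hz]
    by_cases h1 : g z ≤ ENNReal.ofReal ε
    · exact h1.trans (le_add_right (le_add_right le_rfl))
    by_cases h2 : g z ≤ k ∧ z ∈ hypBall n (k + 1)
    · rw [Set.indicator_of_mem h2.2, ENNReal.ofReal_natCast]
      exact h2.1.trans le_add_self
    · have h3 : z ∈ A k := ⟨not_le.1 h1, h2⟩
      rw [Set.indicator_of_mem h3 g]
      exact le_add_right le_add_self

/-- The form of the potential is compact relative to the Dirichlet form. -/
lemma exists_lintegral_potential_le (hn : 3 ≤ n) {p : ℝ} (hp : (n : ℝ) / 2 ≤ p)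
    {V : EuclideanSpace ℝ (Fin n) → ℂ} (hV : MemLp V (ENNReal.ofReal p) (hypMeasure n))
    {ε : ℝ} (hε : 0 < ε) :
    ∃ R M : ℝ, 0 < R ∧ 0 ≤ M ∧ ∀ w v : sobolevGraph n,
      ∫⁻ z, ‖V z * sobolevEmbedding n w z * conj (sobolevEmbedding n v z)‖ₑ ∂(hypMeasure n) ≤
        ENNReal.ofReal (ε * (‖w‖ * ‖v‖) + M * (localNorm R (sobolevEmbedding n w) *
          localNorm R (sobolevEmbedding n v))) := by
  have hn' : (3 : ℝ) ≤ n := by exact_mod_cast hn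
  have hq0 : 0 < (2⁻¹ - (n : ℝ)⁻¹)⁻¹ := by
    rw [inv_pos, sub_pos]
    exact inv_strictAnti₀ (by norm_num) (by linarith)
  set q : NNReal := ⟨(2⁻¹ - (n : ℝ)⁻¹)⁻¹, hq0.le⟩
  have hq : (q : ℝ)⁻¹ = 2⁻¹ - (n : ℝ)⁻¹ := inv_inv _
  -- 2/n + 2/q = 1: the critical exponent n/2 for V is dual to the Sobolev exponent for the product
  -- of two functions.
  have hrq : ((n : ℝ) / 2).HolderConjugate (q / 2) := by
    rw [Real.holderConjugate_iff]
    refine ⟨by linarith, ?_⟩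
    rw [inv_div, inv_div, div_eq_mul_inv, div_eq_mul_inv 2 (q : ℝ), hq]
    ring
  obtain ⟨S, hS, hSob⟩ := exists_sobolev_bound hn hq
  -- `δ` compensates the squared Sobolev constant, so the part of V that is small in L^(n/2)
  -- contributes at most ε/2.
  obtain ⟨R, M, s, hR, hM, hs, hsr, hVs⟩ := exists_potential_splitting (ε := ε / 2)
    (δ := ε / (2 * (S ^ 2 + 1))) (by linarith) hp hV (by positivity) (by positivity)
  refine ⟨R, M, hR, hM, fun w v => ?_⟩
  have hw := measurable_L2 (sobolevEmbedding n w)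
  have hv := measurable_L2 (sobolevEmbedding n v)
  have hB := (isCompact_hypBall (n := n) hR).measurableSet
  set f : EuclideanSpace ℝ (Fin n) → ℝ≥0∞ := fun z =>
    ‖sobolevEmbedding n w z‖ₑ * ‖sobolevEmbedding n v z‖ₑ
  have hf : Measurable f := hw.enorm.mul hv.enorm
  have h1 : ∫⁻ z, f z ∂(hypMeasure n) ≤ ENNReal.ofReal (‖w‖ * ‖v‖) := by
    refine (lintegral_enorm_mul_enorm_le hw hv).trans ?_
    rw [ENNReal.ofReal_mul (norm_nonneg w), ← Lp.enorm_def, ← Lp.enorm_def, ← ofReal_norm,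
      ← ofReal_norm]
    exact mul_le_mul' (ENNReal.ofReal_le_ofReal (norm_sobolevEmbedding_le w))
      (ENNReal.ofReal_le_ofReal (norm_sobolevEmbedding_le v))
  have h2 : ∫⁻ z, s z * f z ∂(hypMeasure n) ≤ ENNReal.ofReal (ε / 2 * (‖w‖ * ‖v‖)) := by
    refine (lintegral_mul_enorm_mul_enorm_le hw hv hs hrq).trans
      ((mul_le_mul' hsr (mul_le_mul' (hSob w) (hSob v))).trans ?_)
    rw [← ENNReal.ofReal_mul (by positivity), ← ENNReal.ofReal_mul (by positivity)]
    refine ENNReal.ofReal_le_ofReal ?_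
    calc ε / (2 * (S ^ 2 + 1)) * (S * ‖w‖ * (S * ‖v‖))
        = ε / 2 * (‖w‖ * ‖v‖) * (S ^ 2 / (S ^ 2 + 1)) := by field_simp
      _ ≤ ε / 2 * (‖w‖ * ‖v‖) * 1 := by
          gcongr
          rw [div_le_one (by positivity)]
          linarith
      _ = ε / 2 * (‖w‖ * ‖v‖) := mul_one _
  have h3 : ∫⁻ z in hypBall n R, f z ∂(hypMeasure n) ≤ ENNReal.ofReal
      (localNorm R (sobolevEmbedding n w) * localNorm R (sobolevEmbedding n v)) := by
    refine (lintegral_enorm_mul_enorm_le hw hv).trans (le_of_eq ?_)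
    rw [ENNReal.ofReal_mul (localNorm_nonneg _ _), eLpNorm_restrict_eq, eLpNorm_restrict_eq]
  calc ∫⁻ z, ‖V z * sobolevEmbedding n w z * conj (sobolevEmbedding n v z)‖ₑ ∂(hypMeasure n)
      ≤ ∫⁻ z, (ENNReal.ofReal (ε / 2) * f z + s z * f z +
          (hypBall n R).indicator (fun z => ENNReal.ofReal M * f z) z) ∂(hypMeasure n) := by
        refine lintegral_mono_ae (hVs.mono fun z hz => ?_)
        rw [enorm_mul, enorm_mul, RCLike.enorm_conj, mul_assoc]
        refine (mul_le_mul' hz (le_refl (f z))).trans (le_of_eq ?_)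
        rw [add_mul, add_mul]
        congr 1
        by_cases hzR : z ∈ hypBall n R <;> simp [hzR]
    _ = ENNReal.ofReal (ε / 2) * ∫⁻ z, f z ∂(hypMeasure n) + ∫⁻ z, s z * f z ∂(hypMeasure n) +
          ENNReal.ofReal M * ∫⁻ z in hypBall n R, f z ∂(hypMeasure n) := by
        rw [lintegral_add_left (f := fun z => ENNReal.ofReal (ε / 2) * f z + s z * f z)
          ((hf.const_mul _).add (hs.mul hf)),
          lintegral_add_left (hf.const_mul _), lintegral_indicator hB,
          lintegral_const_mul _ hf, lintegral_const_mul _ hf]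
    _ ≤ ENNReal.ofReal (ε / 2) * ENNReal.ofReal (‖w‖ * ‖v‖) +
          ENNReal.ofReal (ε / 2 * (‖w‖ * ‖v‖)) + ENNReal.ofReal M * ENNReal.ofReal
            (localNorm R (sobolevEmbedding n w) * localNorm R (sobolevEmbedding n v)) := by
        gcongr
    _ = _ := by
        have h4 := mul_nonneg (localNorm_nonneg R (sobolevEmbedding n w))
          (localNorm_nonneg R (sobolevEmbedding n v))
        rw [← ENNReal.ofReal_mul (by positivity), ← ENNReal.ofReal_mul hM,
          ← ENNReal.ofReal_add (by positivity) (by positivity),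
          ← ENNReal.ofReal_add (by positivity) (by positivity)]
        congr 1
        ring

end Potential

/-! ### The potential as a compact perturbation of the Dirichlet form -/

section Schrodinger

variable {n : ℕ} [NeZero n]

lemma integrable_potential (hn : 3 ≤ n) {p : ℝ} (hp : (n : ℝ) / 2 ≤ p)
    {V : EuclideanSpace ℝ (Fin n) → ℂ} (hV : MemLp V (ENNReal.ofReal p) (hypMeasure n))
    (w v : sobolevGraph n) :
    Integrable (fun z => V z * sobolevEmbedding n w z * conj (sobolevEmbedding n v z))
      (hypMeasure n) := by
  obtain ⟨R, M, -, -, h⟩ := exists_lintegral_potential_le hn hp hV one_pos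
  exact ⟨(hV.1.mul (Lp.aestronglyMeasurable _)).mul
    (RCLike.continuous_conj.comp_aestronglyMeasurable (Lp.aestronglyMeasurable _)),
    (h w v).trans_lt ENNReal.ofReal_lt_top⟩

lemma exists_norm_integral_potential_le (hn : 3 ≤ n) {p : ℝ} (hp : (n : ℝ) / 2 ≤ p)
    {V : EuclideanSpace ℝ (Fin n) → ℂ} (hV : MemLp V (ENNReal.ofReal p) (hypMeasure n))
    {ε : ℝ} (hε : 0 < ε) :
    ∃ R M : ℝ, 0 < R ∧ 0 ≤ M ∧ ∀ w v : sobolevGraph n,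
      ‖∫ z, V z * sobolevEmbedding n w z * conj (sobolevEmbedding n v z) ∂(hypMeasure n)‖ ≤
        ε * (‖w‖ * ‖v‖) + M * (localNorm R (sobolevEmbedding n w) *
          localNorm R (sobolevEmbedding n v)) := by
  obtain ⟨R, M, hR, hM, h⟩ := exists_lintegral_potential_le hn hp hV hε
  refine ⟨R, M, hR, hM, fun w v => ?_⟩
  have h4 := mul_nonneg (localNorm_nonneg R (sobolevEmbedding n w))
    (localNorm_nonneg R (sobolevEmbedding n v))
  rw [← ENNReal.ofReal_le_ofReal_iff (by positivity), ofReal_norm]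
  exact (enorm_integral_le_lintegral_enorm _).trans (h w v)

/-- The form of a potential in `Lᵖ`, `n / 2 ≤ p < ∞`, is represented by a compact operator on the
Sobolev space, which is infinitesimally bounded relative to the `L²` norm. -/
lemma exists_compact_potential_operator (hn : 3 ≤ n) {p : ℝ} (hp : (n : ℝ) / 2 ≤ p)
    {V : EuclideanSpace ℝ (Fin n) → ℂ} (hV : MemLp V (ENNReal.ofReal p) (hypMeasure n)) :
    ∃ B : sobolevGraph n →L[ℂ] sobolevGraph n,
      IsFormOperator (schrodinger n V) (sobolevEmbedding n) B ∧ IsFiniteRankLimit B ∧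
      ∃ C : ℝ, ∀ w, ‖⟪w, B w⟫_ℂ‖ ≤ 1 / 2 * ‖w‖ ^ 2 + C * ‖sobolevEmbedding n w‖ ^ 2 := by
  have hint := integrable_potential hn hp hV
  have hloc : ∀ (R : ℝ) (v : sobolevGraph n), localNorm R (sobolevEmbedding n v) ≤ ‖v‖ :=
    fun R v => (localNorm_le R _).trans (norm_sobolevEmbedding_le v)
  obtain ⟨R₁, M₁, -, hM₁, h₁⟩ := exists_norm_integral_potential_le hn hp hV one_pos
  obtain ⟨B, hB⟩ := exists_potential_operator (C := 1 + M₁) hint fun w v => by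
    refine (h₁ w v).trans ?_
    calc 1 * (‖w‖ * ‖v‖) + M₁ * (localNorm R₁ (sobolevEmbedding n w) *
          localNorm R₁ (sobolevEmbedding n v))
        ≤ 1 * (‖w‖ * ‖v‖) + M₁ * (‖w‖ * ‖v‖) := by
          gcongr
          · exact localNorm_nonneg _ _
          · exact hloc R₁ w
          · exact hloc R₁ v
      _ = (1 + M₁) * ‖v‖ * ‖w‖ := by ring
  refine ⟨B, isFormOperator_schrodinger hint hB, isFiniteRankLimit_of_norm_le fun ε hε => ?_, ?_⟩
  · obtain ⟨R, M, hR, hM, h⟩ := exists_norm_integral_potential_le hn hp hV (half_pos hε)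
    obtain ⟨m, ℓ, C, hC, hℓ⟩ := exists_functionals_localNorm (n := n) hR
      (ε := ε / (2 * (M + 1))) (by positivity)
    refine ⟨m, ℓ, M * C, fun w => ?_⟩
    -- The form bound is applied with v = B w and divided by ‖B w‖. The local norm of w is then
    -- controlled by finitely many functionals, which is the criterion for approximation by finite
    -- rank.
    have h1 : ‖B w‖ ≤ ε / 2 * ‖w‖ + M * localNorm R (sobolevEmbedding n w) := by
      have h2 := h w (B w)
      have h3 : ‖⟪B w, B w⟫_ℂ‖ = ‖B w‖ ^ 2 := by
        rw [← inner_self_eq_norm_sq (𝕜 := ℂ) (B w), inner_self_re_eq_norm]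
      rw [← hB, h3] at h2
      rcases (norm_nonneg (B w)).eq_or_lt with h0 | h0
      · rw [← h0]
        have := localNorm_nonneg R (sobolevEmbedding n w)
        positivity
      · refine le_of_mul_le_mul_right ?_ h0
        calc ‖B w‖ * ‖B w‖ = ‖B w‖ ^ 2 := (sq _).symm
          _ ≤ _ := h2
          _ ≤ ε / 2 * (‖w‖ * ‖B w‖) + M * (localNorm R (sobolevEmbedding n w) * ‖B w‖) := by
              gcongr
              · exact localNorm_nonneg _ _
              · exact hloc R (B w)
          _ = _ := by ring
    calc ‖B w‖ ≤ ε / 2 * ‖w‖ + M * localNorm R (sobolevEmbedding n w) := h1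
      _ ≤ ε / 2 * ‖w‖ + M * (ε / (2 * (M + 1)) * ‖w‖ + C * ∑ j, ‖ℓ j w‖) := by
          gcongr
          exact hℓ w
      _ = ε / 2 * ‖w‖ + M / (M + 1) * (ε / 2 * ‖w‖) + M * C * ∑ j, ‖ℓ j w‖ := by
          field_simp
          ring
      _ ≤ ε / 2 * ‖w‖ + 1 * (ε / 2 * ‖w‖) + M * C * ∑ j, ‖ℓ j w‖ := by
          gcongr
          rw [div_le_one (by positivity)]
          linarith
      _ = ε * ‖w‖ + M * C * ∑ j, ‖ℓ j w‖ := by ring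
  -- With ε = 1/2 and v = w, the local norm is simply estimated by the full L² norm.
  · obtain ⟨R, M, hR, hM, h⟩ := exists_norm_integral_potential_le hn hp hV one_half_pos
    refine ⟨M, fun w => ?_⟩
    rw [hB]
    refine (h w w).trans ?_
    rw [← sq, ← sq]
    gcongr
    · exact localNorm_nonneg _ _
    · exact localNorm_le R _

lemma isFormOperator_laplacian :
    IsFormOperator (laplacian n) (sobolevEmbedding n) 0 :=
  isFormOperator_schrodinger (fun w v => by simp) fun w v => by simp

end Schrodinger

end HypSchrodinger

end

theorem propositionA1 (n : ℕ) [NeZero n] (hn : 3 ≤ n) (p : ℝ) (hp : (n : ℝ) / 2 ≤ p)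
    (V : EuclideanSpace ℝ (Fin n) → ℂ)
    (hV : MemLp V (ENNReal.ofReal p) (HypSchrodinger.hypMeasure n)) :
    (∀ u ∈ HypSchrodinger.H1 n, ∀ v ∈ HypSchrodinger.H1 n,
      Integrable (fun z => V z * u z * conj (v z)) (HypSchrodinger.hypMeasure n)) ∧
    HypSchrodinger.IsMSectorial (HypSchrodinger.schrodinger n V) ∧
    (HypSchrodinger.schrodinger n V).domain ≤ HypSchrodinger.H1 n ∧
    HypSchrodinger.spectrum (HypSchrodinger.schrodinger n V) =
      HypSchrodinger.essentialSpectrum (HypSchrodinger.laplacian n) ∪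
        HypSchrodinger.discreteSpectrum (HypSchrodinger.schrodinger n V) := by
  obtain ⟨B, hT, hcomp, C, hB⟩ := HypSchrodinger.exists_compact_potential_operator hn hp hV
  refine ⟨fun u hu v hv => ?_, hT.isMSectorial hB, HypSchrodinger.schrodinger_domain_le V,
    hT.spectrum_eq HypSchrodinger.isFormOperator_laplacian
      HypSchrodinger.sobolevEmbedding_injective hB hcomp⟩
  obtain ⟨w, rfl⟩ := HypSchrodinger.mem_H1_iff.1 hu
  obtain ⟨v, rfl⟩ := HypSchrodinger.mem_H1_iff.1 hv
  exact HypSchrodinger.integrable_potential hn hp hV w v
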